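/- **Theorem 3.4.** In the $(n,k,\eta)$-LSPN problem there is an unknown vector $\mathbf{secret}\in\mathbf F_2^n$ of Hamming weight at most $k$. A sample is a pair $(x,y)$ with $x$ uniform in $\mathbf F_2^n$ and $y=\langle x,\mathbf{secret}\rangle+e$, where $e\in\{0,1\}$ is an independent Bernoulli bit with $\Pr[e=1]=\eta$; different samples are independent. An algorithm is given $n$ and $k$ and may request samples; it solves the problem if for every such $\mathbf{secret}$ it outputs $\mathbf{secret}$ with probability at least $0.9$ over the samples and its own randomness. For every constant $\eta\in[0,1/2)$ there are an algorithm, depending only on $\eta$, and a constant $C=C(\eta)>0$ such that, for all integers $n$ and $k\ge 2$ with $k<n/\log n$, the algorithm solves the $(n,k,\eta)$-LSPN problem in time at most $$\Big(C\cdot\frac{n}{k\log k}\Big)^{k}$$ and requests at most $$2^{Ck}+C\,k\log\frac nk$$ samples, both bounds holding in the worst case (almost surely). Here $\log$ is the natural logarithm, and an algorithm is a single program of a randomized word RAM with word length $O(k+\log n)$ (with a constant depending only on $\eta$). Each word operation, memory access, draw of a uniform random integer below a given word, request of a sample, and access to one bit of a requested sample takes one unit of time. -/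

import Mathlib

open scoped NNReal ENNReal

noncomputable section

namespace LSPN

/-! ## The learning problem -/

/-- A labelled example `(x, y)` with `x ∈ 𝔽₂ⁿ` and `y ∈ 𝔽₂`. -/
abbrev Sample (n : ℕ) : Type := (Fin n → ZMod 2) × ZMod 2

/-- The Bernoulli law on `𝔽₂`: the value `1` has probability `η` and the value `0` has
probability `1 - η`. -/
def noiseLaw (η : ℝ≥0) (hη : η ≤ 1) : PMF (ZMod 2) :=
  PMF.ofFintype (fun e => if e = 1 then (η : ℝ≥0∞) else ((1 - η : ℝ≥0) : ℝ≥0∞)) <| by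
    have h : (∑ e : ZMod 2, if e = 1 then (η : ℝ≥0∞) else ((1 - η : ℝ≥0) : ℝ≥0∞))
        = ((1 - η : ℝ≥0) : ℝ≥0∞) + (η : ℝ≥0∞) :=
      Fin.sum_univ_two (fun e : Fin 2 => if e = 1 then (η : ℝ≥0∞) else ((1 - η : ℝ≥0) : ℝ≥0∞))
    rw [h, ← ENNReal.coe_add, tsub_add_cancel_of_le hη, ENNReal.coe_one]

/-- The law of one example: `x` is uniform in `𝔽₂ⁿ`, `e` is an independent Bernoulli bit which
equals `1` with probability `η`, and `y = ⟨x, secret⟩ + e`. -/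
def sampleLaw {n : ℕ} (η : ℝ≥0) (hη : η ≤ 1) (secret : Fin n → ZMod 2) : PMF (Sample n) :=
  (PMF.uniformOfFintype (Fin n → ZMod 2)).bind fun x =>
    (noiseLaw η hη).bind fun e => PMF.pure (x, x ⬝ᵥ secret + e)

/-! ## The machine model: a randomized word RAM with a sample oracle

Programs are finite while-programs over unboundedly many registers and named one-dimensional
arrays (a program mentions only finitely many of both).  All contents and addresses are natural
numbers below `W = 2 ^ w`, where `w` is the word length. -/

/-- Binary word operations. -/
inductive WordOp
  | add | sub | mul | div | mod
  | and | or | xor | shl | shr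
  | lt | eq

/-- The value of a word operation before reduction modulo `W`. -/
def WordOp.eval : WordOp → ℕ → ℕ → ℕ
  | .add, a, b => a + b
  | .sub, a, b => a - b
  | .mul, a, b => a * b
  | .div, a, b => a / b
  | .mod, a, b => a % b
  | .and, a, b => a &&& b
  | .or, a, b => a ||| b
  | .xor, a, b => a ^^^ b
  | .shl, a, b => a <<< b
  | .shr, a, b => a >>> b
  | .lt, a, b => if a < b then 1 else 0
  | .eq, a, b => if a = b then 1 else 0

/-- Programs.  In the comments `r i` is the content of register `i`. -/
inductive Prog
  /-- `r d := v` -/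
  | const (d v : ℕ)
  /-- `r d := r a ∘ r b` -/
  | op (o : WordOp) (d a b : ℕ)
  /-- `r d := A[r i]` for the array with name `A` -/
  | load (d A i : ℕ)
  /-- `A[r i] := r a` for the array with name `A` -/
  | store (A i a : ℕ)
  /-- `r d :=` a fresh uniform element of `{0, …, r b - 1}` (and `0` if `r b = 0`) -/
  | rand (d b : ℕ)
  /-- ask the oracle for a fresh example and append it to the list of examples -/
  | draw
  /-- `r d :=` the bit with number `r j` of the vector of the example with number `r i` -/
  | readX (d i j : ℕ)
  /-- `r d :=` the label of the example with number `r i` -/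
  | readY (d i : ℕ)
  /-- first `p`, then `q` -/
  | seq (p q : Prog)
  /-- if `r a ≠ 0` then `p` else `q` -/
  | ite (a : ℕ) (p q : Prog)
  /-- while `r a ≠ 0` do `p` -/
  | loop (a : ℕ) (p : Prog)

/-- The memory of the machine. -/
structure State where
  /-- contents of the registers -/
  reg : ℕ → ℕ
  /-- `arr A i` is the cell with index `i` of the array with name `A` -/
  arr : ℕ → ℕ → ℕ
  /-- number of examples requested so far -/
  drawn : ℕ
  /-- the vectors of the examples requested so far (`0` elsewhere) -/
  exX : ℕ → ℕ → ℕ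
  /-- the labels of the examples requested so far (`0` elsewhere) -/
  exY : ℕ → ℕ

/-- Write a value to a register, reduced modulo `W`. -/
def State.set (W : ℕ) (s : State) (d v : ℕ) : State :=
  { s with reg := Function.update s.reg d (v % W) }

/-- Append an example. -/
def State.push {n : ℕ} (s : State) (z : Sample n) : State :=
  { s with
    drawn := s.drawn + 1
    exX := Function.update s.exX s.drawn
      (fun j => if h : j < n then (z.1 ⟨j, h⟩).val else 0)
    exY := Function.update s.exY s.drawn z.2.val }

/-- A configuration: the stack of programs still to be executed, and the memory.  The machine has
halted when the stack is empty. -/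
abbrev Config : Type := List Prog × State

/-- One unit-cost step of the machine with word modulus `W` and the given sample oracle. -/
def step {n : ℕ} (W : ℕ) (oracle : PMF (Sample n)) : Config → PMF Config
  | ([], s) => PMF.pure ([], s)
  | (.const d v :: K, s) => PMF.pure (K, s.set W d v)
  | (.op o d a b :: K, s) => PMF.pure (K, s.set W d (o.eval (s.reg a) (s.reg b)))
  | (.load d A i :: K, s) => PMF.pure (K, s.set W d (s.arr A (s.reg i)))
  | (.store A i a :: K, s) =>
      PMF.pure (K, { s with
        arr := Function.update s.arr A (Function.update (s.arr A) (s.reg i) (s.reg a)) })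
  | (.rand d b :: K, s) =>
      (PMF.uniformOfFinset (Finset.range (max 1 (s.reg b)))
        (Finset.nonempty_range_iff.mpr (by omega))).bind fun v => PMF.pure (K, s.set W d v)
  | (.draw :: K, s) => oracle.bind fun z => PMF.pure (K, s.push z)
  | (.readX d i j :: K, s) => PMF.pure (K, s.set W d (s.exX (s.reg i) (s.reg j)))
  | (.readY d i :: K, s) => PMF.pure (K, s.set W d (s.exY (s.reg i)))
  | (.seq p q :: K, s) => PMF.pure (p :: q :: K, s)
  | (.ite a p q :: K, s) => PMF.pure ((if s.reg a ≠ 0 then p else q) :: K, s)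
  | (.loop a p :: K, s) =>
      PMF.pure (if s.reg a ≠ 0 then p :: .loop a p :: K else K, s)

/-- The law of the configuration after `t` steps. -/
def run {n : ℕ} (W : ℕ) (oracle : PMF (Sample n)) : ℕ → Config → PMF Config
  | 0, c => PMF.pure c
  | t + 1, c => (step W oracle c).bind (run W oracle t)

/-- The initial configuration: `n` in register `0`, `k` in register `1`, and `0` everywhere else;
no example has been requested. -/
def init (P : Prog) (n k : ℕ) : Config :=
  ([P], { reg := fun i => if i = 0 then n else if i = 1 then k else 0
          arr := fun _ _ => 0
          drawn := 0
          exX := fun _ _ => 0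
          exY := fun _ => 0 })

/-- The machine has halted and the first `n` cells of array `0` hold the vector `v`. -/
def Outputs {n : ℕ} (v : Fin n → ZMod 2) (c : Config) : Prop :=
  c.1 = [] ∧ ∀ j : Fin n, c.2.arr 0 j = (v j).val

/-- On a machine with word length `w`, the program `P` solves the `(n, k, η)`-LSPN problem in time
`T` with `M` examples: for every secret of Hamming weight at most `k`, the program on input `n, k`
halts after at most `T` steps and requests at most `M` examples, whatever the examples and the
random choices are, and its output is the secret with probability at least `9 / 10`. -/
def Solves (P : Prog) (w n k : ℕ) (η : ℝ≥0) (hη : η ≤ 1) (T M : ℕ) : Prop :=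
  ∀ secret : Fin n → ZMod 2, hammingNorm secret ≤ k →
    (∀ c ∈ (run (2 ^ w) (sampleLaw η hη secret) T (init P n k)).support,
      c.1 = [] ∧ c.2.drawn ≤ M) ∧
    9 / 10 ≤ (run (2 ^ w) (sampleLaw η hη secret) T (init P n k)).toOuterMeasure
      {c | Outputs secret c}

end LSPN

end

/-!
The program combines an exhaustive search over sets of blocks of coordinates with the blockwise
elimination of Blum, Kalai and Wasserman.

The coordinates are cut into blocks of `l = ⌊log₂ k⌋` consecutive ones.  A secret with at most `k`
ones lives on at most `k` blocks, so one of the `k`-element sets of blocks covers it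
(`exists_covers`), and there are only `(O(n / (k log k))) ^ k` such sets (`Par.choose_le`).  They are
enumerated in the order of the combinatorial number system (`exists_combSeq`).  It remains to spend
time `2 ^ O(k)`, independent of `n`, on each set of blocks.

Within a covering set the secret has `k * l` relevant coordinates, which form `l` words of `k` bits.
To learn the coordinate `q`, mask it and eliminate the words of a batch of `4 ^ k` examples one after
the other: at each level the first vector with a given key is sacrificed and added to the later ones
with the same key.  A level costs at most `2 ^ k` vectors, hence some combination of
`2 ^ l ≤ k` examples survives all levels (`relation_spec`).  It vanishes on all relevant coordinates
except possibly `q`.  It was found without looking at the coordinate `q` or at the labels, so its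
coordinate `q` is one with probability `1 / 2`, by flipping that coordinate in an example that occurs
in it; in this case its label is the bit `q` of the secret with bias at least
`(1 - 2 * η) ^ (2 ^ l) ≥ (1 - 2 * η) ^ k` (`half_le_mean_signal`, `half_le_mean_vote`).  A majority vote
over `2 ^ (α * k)` disjoint batches therefore errs with tiny probability for all relevant `q` at
once (`prob_vote_le`).  That the blocks have length `log k` is what balances the number of sets of
blocks against the bias, which must not drop below `2 ^ (-O(k))`.

A set of blocks that does not cover the secret yields a worthless candidate, so every candidate is
tested on `O(k log n)` further examples, which suffice for a union bound over all sparse vectors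
(`prob_contradictions_le`, `prob_failure_le`).  These examples are packed, `⌊log₂ n⌋` to a word,
once and for all, and a table gives the number of ones of a word.  Thus a test takes time polynomial
in `k`.

The bookkeeping on the machine goes through a small structured language with a verified compiler
(`Exec.compile`) and a program logic with time bounds (`wp`).  The program draws all its examples
first (`run_drawLoop`), so its output is a function of independent examples (`solves_solver`), and the
probabilities above are finite sums over a product space.
-/

noncomputable section

namespace LSPN

/-! ### A structured language and its compilation to the word RAM -/

/-- Side-effect free expressions over the variables and arrays of a program. -/
inductive Expr
  /-- the content of a variable -/
  | var (r : ℕ)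
  /-- a numeral -/
  | lit (v : ℕ)
  /-- a binary word operation -/
  | bin (o : WordOp) (e f : Expr)
  /-- a cell of an array -/
  | get (A : ℕ) (e : Expr)
  /-- a bit of the vector of an example: the example number comes first -/
  | bit (e f : Expr)
  /-- the label of an example -/
  | lab (e : Expr)

instance : Add Expr := ⟨.bin .add⟩
instance : Sub Expr := ⟨.bin .sub⟩
instance : Mul Expr := ⟨.bin .mul⟩
instance : Div Expr := ⟨.bin .div⟩
instance : Mod Expr := ⟨.bin .mod⟩

/-- The value of an expression, computed in `ℕ` without reduction modulo the word size. -/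
def Expr.eval : Expr → State → ℕ
  | .var r, s => s.reg r
  | .lit v, _ => v
  | .bin o e f, s => o.eval (e.eval s) (f.eval s)
  | .get A e, s => s.arr A (e.eval s)
  | .bit e f, s => s.exX (e.eval s) (f.eval s)
  | .lab e, s => s.exY (e.eval s)

/-- No intermediate result of the evaluation overflows the word size. -/
def Expr.Ok (W : ℕ) : Expr → State → Prop
  | .var _, _ => True
  | .lit v, _ => v < W
  | .bin o e f, s => e.Ok W s ∧ f.Ok W s ∧ o.eval (e.eval s) (f.eval s) < W
  | .get _ e, s => e.Ok W s
  | .bit e f, s => e.Ok W s ∧ f.Ok W s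
  | .lab e, s => e.Ok W s

/-- The number of machine steps that the compiled expression takes. -/
def Expr.cost : Expr → ℕ
  | .var _ => 1
  | .lit _ => 1
  | .bin _ e f => e.cost + f.cost + 3
  | .get _ e => e.cost + 2
  | .bit e f => e.cost + f.cost + 3
  | .lab e => e.cost + 2

section expr_lemmas
variable (W : ℕ) (s : State) (e f : Expr) (o : WordOp) (r v A : ℕ)

@[simp] theorem Expr.eval_var : (Expr.var r).eval s = s.reg r := rfl
@[simp] theorem Expr.eval_lit : (Expr.lit v).eval s = v := rfl
@[simp] theorem Expr.eval_bin : (Expr.bin o e f).eval s = o.eval (e.eval s) (f.eval s) := rfl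
@[simp] theorem Expr.eval_get : (Expr.get A e).eval s = s.arr A (e.eval s) := rfl
@[simp] theorem Expr.eval_bit : (Expr.bit e f).eval s = s.exX (e.eval s) (f.eval s) := rfl
@[simp] theorem Expr.eval_lab : (Expr.lab e).eval s = s.exY (e.eval s) := rfl
@[simp] theorem Expr.eval_add : (e + f).eval s = e.eval s + f.eval s := rfl
@[simp] theorem Expr.eval_sub : (e - f).eval s = e.eval s - f.eval s := rfl
@[simp] theorem Expr.eval_mul : (e * f).eval s = e.eval s * f.eval s := rfl
@[simp] theorem Expr.eval_div : (e / f).eval s = e.eval s / f.eval s := rfl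
@[simp] theorem Expr.eval_mod : (e % f).eval s = e.eval s % f.eval s := rfl

@[simp] theorem Expr.ok_var : (Expr.var r).Ok W s := trivial
@[simp] theorem Expr.ok_lit : (Expr.lit v).Ok W s ↔ v < W := Iff.rfl
@[simp] theorem Expr.ok_bin : (Expr.bin o e f).Ok W s ↔
    e.Ok W s ∧ f.Ok W s ∧ o.eval (e.eval s) (f.eval s) < W := Iff.rfl
@[simp] theorem Expr.ok_get : (Expr.get A e).Ok W s ↔ e.Ok W s := Iff.rfl
@[simp] theorem Expr.ok_bit : (Expr.bit e f).Ok W s ↔ e.Ok W s ∧ f.Ok W s := Iff.rfl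
@[simp] theorem Expr.ok_lab : (Expr.lab e).Ok W s ↔ e.Ok W s := Iff.rfl
@[simp] theorem Expr.ok_add : (e + f).Ok W s ↔ e.Ok W s ∧ f.Ok W s ∧ e.eval s + f.eval s < W :=
  Iff.rfl
@[simp] theorem Expr.ok_sub : (e - f).Ok W s ↔ e.Ok W s ∧ f.Ok W s ∧ e.eval s - f.eval s < W :=
  Iff.rfl
@[simp] theorem Expr.ok_mul : (e * f).Ok W s ↔ e.Ok W s ∧ f.Ok W s ∧ e.eval s * f.eval s < W :=
  Iff.rfl
@[simp] theorem Expr.ok_div : (e / f).Ok W s ↔ e.Ok W s ∧ f.Ok W s ∧ e.eval s / f.eval s < W :=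
  Iff.rfl
@[simp] theorem Expr.ok_mod : (e % f).Ok W s ↔ e.Ok W s ∧ f.Ok W s ∧ e.eval s % f.eval s < W :=
  Iff.rfl

theorem WordOp.eval_eq_ne {a b : ℕ} : WordOp.eq.eval a b ≠ 0 ↔ a = b := by
  simp only [WordOp.eval]; split_ifs <;> simp_all

theorem WordOp.eval_eq_zero {a b : ℕ} : WordOp.eq.eval a b = 0 ↔ a ≠ b := by
  simp only [WordOp.eval]; split_ifs <;> simp_all

theorem WordOp.eval_eq_lt {a b : ℕ} : WordOp.eq.eval a b < 2 := by
  simp only [WordOp.eval]; split_ifs <;> norm_num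

theorem WordOp.eval_lt_ne {a b : ℕ} : WordOp.lt.eval a b ≠ 0 ↔ a < b := by
  simp only [WordOp.eval]; split_ifs <;> simp_all

theorem WordOp.eval_lt_zero {a b : ℕ} : WordOp.lt.eval a b = 0 ↔ b ≤ a := by
  simp only [WordOp.eval]; split_ifs <;> simp_all

theorem WordOp.eval_lt_lt {a b : ℕ} : WordOp.lt.eval a b < 2 := by
  simp only [WordOp.eval]; split_ifs <;> norm_num

theorem WordOp.ok_eq {W : ℕ} {s : State} {e f : Expr} (hW : 1 < W) (he : e.Ok W s)
    (hf : f.Ok W s) : (Expr.bin .eq e f).Ok W s :=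
  ⟨he, hf, by have := WordOp.eval_eq_lt (a := e.eval s) (b := f.eval s); omega⟩

theorem WordOp.ok_lt {W : ℕ} {s : State} {e f : Expr} (hW : 1 < W) (he : e.Ok W s)
    (hf : f.Ok W s) : (Expr.bin .lt e f).Ok W s :=
  ⟨he, hf, by have := WordOp.eval_lt_lt (a := e.eval s) (b := f.eval s); omega⟩

end expr_lemmas

/-- Commands of the structured language. -/
inductive Cmd
  /-- assignment to a variable -/
  | assign (x : ℕ) (e : Expr)
  /-- assignment to an array cell -/
  | store (A : ℕ) (i e : Expr)
  /-- sequential composition -/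
  | seq (c d : Cmd)
  /-- conditional on a nonzero value -/
  | ite (e : Expr) (c d : Cmd)
  /-- loop as long as the value is nonzero -/
  | while (e : Expr) (c : Cmd)

/-- The program which evaluates an expression into the temporary with number `d`; the temporaries
are the odd registers, and the variable `r` lives in the even register `2 * r`. -/
def Expr.compile : Expr → ℕ → Prog
  | .var r, d => .op .or (2 * d + 1) (2 * r) (2 * r)
  | .lit v, d => .const (2 * d + 1) v
  | .bin o e f, d =>
      .seq (e.compile d) (.seq (f.compile (d + 1)) (.op o (2 * d + 1) (2 * d + 1) (2 * (d + 1) + 1)))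
  | .get A e, d => .seq (e.compile d) (.load (2 * d + 1) A (2 * d + 1))
  | .bit e f, d =>
      .seq (e.compile d) (.seq (f.compile (d + 1)) (.readX (2 * d + 1) (2 * d + 1) (2 * (d + 1) + 1)))
  | .lab e, d => .seq (e.compile d) (.readY (2 * d + 1) (2 * d + 1))

/-- The compiler from commands to programs. -/
def Cmd.compile : Cmd → Prog
  | .assign x e => .seq (e.compile 0) (.op .or (2 * x) 1 1)
  | .store A i e => .seq (i.compile 0) (.seq (e.compile 1) (.store A 1 3))
  | .seq c d => .seq c.compile d.compile
  | .ite e c d => .seq (e.compile 0) (.ite 1 c.compile d.compile)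
  | .while e c => .seq (e.compile 0) (.loop 1 (.seq c.compile (e.compile 0)))

/-- Set a variable. -/
def State.put (s : State) (x v : ℕ) : State := { s with reg := Function.update s.reg x v }

/-- Set an array cell. -/
def State.sto (s : State) (A i v : ℕ) : State :=
  { s with arr := Function.update s.arr A (Function.update (s.arr A) i v) }

section simp_lemmas
variable (s : State) (x v y A i B j : ℕ)

@[simp] theorem State.put_reg : (s.put x v).reg y = if y = x then v else s.reg y := by
  simp [State.put, Function.update_apply]
@[simp] theorem State.put_arr : (s.put x v).arr = s.arr := rfl
@[simp] theorem State.put_exX : (s.put x v).exX = s.exX := rfl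
@[simp] theorem State.put_exY : (s.put x v).exY = s.exY := rfl
@[simp] theorem State.sto_reg : (s.sto A i v).reg = s.reg := rfl
@[simp] theorem State.sto_arr :
    (s.sto A i v).arr B j = if B = A ∧ j = i then v else s.arr B j := by
  by_cases h : B = A
  · subst h; simp [State.sto, Function.update_apply]
  · simp [State.sto, h]
@[simp] theorem State.sto_exX : (s.sto A i v).exX = s.exX := rfl
@[simp] theorem State.sto_exY : (s.sto A i v).exY = s.exY := rfl

end simp_lemmas

/-- Big-step semantics with exact cost: `Exec W c s t s'` says that `c`, started in `s`, ends in
`s'` after `t` machine steps, and that no overflow occurs. -/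
inductive Exec (W : ℕ) : Cmd → State → ℕ → State → Prop
  | assign {x e s} (h : e.Ok W s) : Exec W (.assign x e) s (e.cost + 2) (s.put x (e.eval s))
  | store {A i e s} (hi : i.Ok W s) (he : e.Ok W s) :
      Exec W (.store A i e) s (i.cost + e.cost + 3) (s.sto A (i.eval s) (e.eval s))
  | seq {c d s s' s'' t t'} (hc : Exec W c s t s') (hd : Exec W d s' t' s'') :
      Exec W (.seq c d) s (t + t' + 1) s''
  | iteT {e c d s s' t} (h : e.Ok W s) (h0 : e.eval s ≠ 0) (hc : Exec W c s t s') :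
      Exec W (.ite e c d) s (e.cost + t + 2) s'
  | iteF {e c d s s' t} (h : e.Ok W s) (h0 : e.eval s = 0) (hd : Exec W d s t s') :
      Exec W (.ite e c d) s (e.cost + t + 2) s'
  | whileF {e c s} (h : e.Ok W s) (h0 : e.eval s = 0) :
      Exec W (.while e c) s (e.cost + 2) s
  | whileT {e c s s' s'' t t'} (h : e.Ok W s) (h0 : e.eval s ≠ 0) (hc : Exec W c s t s')
      (hw : Exec W (.while e c) s' t' s'') :
      Exec W (.while e c) s (e.cost + t + t' + 2) s''

/-- From the configuration `c` the machine reaches `c'` in `t` steps without asking the oracle or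
using random numbers. -/
def Reach (W t : ℕ) (c c' : Config) : Prop :=
  ∀ (n : ℕ) (oracle : PMF (Sample n)) (T : ℕ), run W oracle (t + T) c = run W oracle T c'

theorem Reach.trans {W t t' : ℕ} {c c' c'' : Config} (h : Reach W t c c') (h' : Reach W t' c' c'') :
    Reach W (t + t') c c'' := fun n o T => by rw [add_assoc, h, h']

theorem Reach.cast {W t t' : ℕ} {c c' : Config} (h : Reach W t c c') (ht : t = t') :
    Reach W t' c c' := ht ▸ h

theorem Reach.of_step {W : ℕ} {c c' : Config}
    (h : ∀ {n : ℕ} (oracle : PMF (Sample n)), step W oracle c = PMF.pure c') : Reach W 1 c c' :=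
  fun n o T => by rw [add_comm 1 T, run, h o, PMF.pure_bind]

theorem Reach.seq {W : ℕ} (p q : Prog) (K : List Prog) (s : State) :
    Reach W 1 (.seq p q :: K, s) (p :: q :: K, s) := Reach.of_step fun _ => rfl

/-- All memory cells and all bits of examples fit into a word. -/
structure Bounded (W : ℕ) (s : State) : Prop where
  reg : ∀ r, s.reg r < W
  arr : ∀ A i, s.arr A i < W
  exX : ∀ i j, s.exX i j < W
  exY : ∀ i, s.exY i < W

/-- The machine state `σ` represents the state `s` of the structured language. -/
structure Sim (W : ℕ) (σ s : State) : Prop where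
  bdd : Bounded W σ
  reg : ∀ r, σ.reg (2 * r) = s.reg r
  arr : σ.arr = s.arr
  exX : σ.exX = s.exX
  exY : σ.exY = s.exY
  drawn : σ.drawn = s.drawn

theorem Bounded.set {W : ℕ} {s : State} (h : Bounded W s) (d v : ℕ) : Bounded W (s.set W d v) := by
  refine ⟨fun r => ?_, h.arr, h.exX, h.exY⟩
  have := h.reg r
  simp only [State.set, Function.update_apply]
  split_ifs
  · exact Nat.mod_lt _ (by omega)
  · exact this

theorem Sim.set_odd {W : ℕ} {σ s : State} (h : Sim W σ s) (d v : ℕ) :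
    Sim W (σ.set W (2 * d + 1) v) s := by
  refine ⟨h.bdd.set _ _, fun r => ?_, h.arr, h.exX, h.exY, h.drawn⟩
  simp only [State.set, Function.update_apply]
  rw [if_neg (by omega), h.reg]

/-- Correctness of the compilation of expressions; temporaries below the target are kept. -/
theorem Expr.compile_spec {W : ℕ} {s : State} (e : Expr) :
    ∀ {σ : State} (_ : Sim W σ s) (_ : e.Ok W s) (d : ℕ) (K : List Prog),
      ∃ σ', Reach W e.cost (e.compile d :: K, σ) (K, σ') ∧ Sim W σ' s ∧
        σ'.reg (2 * d + 1) = e.eval s ∧ ∀ d' < d, σ'.reg (2 * d' + 1) = σ.reg (2 * d' + 1) := by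
  have hset : ∀ {σ : State} (_ : Sim W σ s) (d v : ℕ), v < W →
      Sim W (σ.set W (2 * d + 1) v) s ∧ (σ.set W (2 * d + 1) v).reg (2 * d + 1) = v ∧
      ∀ d' < d, (σ.set W (2 * d + 1) v).reg (2 * d' + 1) = σ.reg (2 * d' + 1) := by
    intro σ h d v hv
    refine ⟨h.set_odd d v, by simp [State.set, Nat.mod_eq_of_lt hv], fun d' hd' => ?_⟩
    simp only [State.set, Function.update_apply]
    rw [if_neg (by omega)]
  induction e with
  | var r =>
    intro σ h _ d K
    have hb := h.bdd.reg (2 * r)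
    refine ⟨σ.set W (2 * d + 1) (s.reg r), Reach.of_step fun _ => ?_,
      hset h d _ (by rw [← h.reg]; exact hb)⟩
    simp [step, Expr.compile, WordOp.eval, h.reg]
  | lit v =>
    intro σ h hv d K
    exact ⟨σ.set W (2 * d + 1) v, Reach.of_step fun _ => rfl, hset h d _ hv⟩
  | bin o e f ihe ihf =>
    intro σ h hok d K
    obtain ⟨he, hf, hv⟩ := hok
    obtain ⟨σ₁, r₁, h₁, v₁, k₁⟩ := ihe h he d
      (.seq (f.compile (d + 1)) (.op o (2 * d + 1) (2 * d + 1) (2 * (d + 1) + 1)) :: K)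
    obtain ⟨σ₂, r₂, h₂, v₂, k₂⟩ := ihf h₁ hf (d + 1)
      (.op o (2 * d + 1) (2 * d + 1) (2 * (d + 1) + 1) :: K)
    obtain ⟨h₃, v₃, k₃⟩ := hset h₂ d _ hv
    refine ⟨_, ?_, h₃, v₃, fun d' hd' => by rw [k₃ d' hd', k₂ d' (by omega), k₁ d' hd']⟩
    have r₃ : Reach W 1 (.op o (2 * d + 1) (2 * d + 1) (2 * (d + 1) + 1) :: K, σ₂)
        (K, σ₂.set W (2 * d + 1) (o.eval (e.eval s) (f.eval s))) :=
      Reach.of_step fun _ => by simp only [step]; rw [k₂ d (by omega), v₁, v₂]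
    have := ((Reach.seq _ _ _ _).trans r₁).trans (((Reach.seq _ _ _ _).trans r₂).trans r₃)
    exact this.cast (by simp only [Expr.cost]; omega)
  | get A e ihe =>
    intro σ h hok d K
    obtain ⟨σ₁, r₁, h₁, v₁, k₁⟩ := ihe h hok d (.load (2 * d + 1) A (2 * d + 1) :: K)
    obtain ⟨h₃, v₃, k₃⟩ := hset h₁ d (s.arr A (e.eval s)) (by rw [← h₁.arr]; exact h₁.bdd.arr _ _)
    refine ⟨_, ?_, h₃, v₃, fun d' hd' => by rw [k₃ d' hd', k₁ d' hd']⟩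
    have r₃ : Reach W 1 (.load (2 * d + 1) A (2 * d + 1) :: K, σ₁)
        (K, σ₁.set W (2 * d + 1) (s.arr A (e.eval s))) :=
      Reach.of_step fun _ => by simp only [step]; rw [v₁, h₁.arr]
    have := ((Reach.seq _ _ _ _).trans r₁).trans r₃
    exact this.cast (by simp only [Expr.cost]; omega)
  | bit e f ihe ihf =>
    intro σ h hok d K
    obtain ⟨he, hf⟩ := hok
    obtain ⟨σ₁, r₁, h₁, v₁, k₁⟩ := ihe h he d
      (.seq (f.compile (d + 1)) (.readX (2 * d + 1) (2 * d + 1) (2 * (d + 1) + 1)) :: K)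
    obtain ⟨σ₂, r₂, h₂, v₂, k₂⟩ := ihf h₁ hf (d + 1)
      (.readX (2 * d + 1) (2 * d + 1) (2 * (d + 1) + 1) :: K)
    obtain ⟨h₃, v₃, k₃⟩ := hset h₂ d (s.exX (e.eval s) (f.eval s))
      (by rw [← h₂.exX]; exact h₂.bdd.exX _ _)
    refine ⟨_, ?_, h₃, v₃, fun d' hd' => by rw [k₃ d' hd', k₂ d' (by omega), k₁ d' hd']⟩
    have r₃ : Reach W 1 (.readX (2 * d + 1) (2 * d + 1) (2 * (d + 1) + 1) :: K, σ₂)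
        (K, σ₂.set W (2 * d + 1) (s.exX (e.eval s) (f.eval s))) :=
      Reach.of_step fun _ => by simp only [step]; rw [k₂ d (by omega), v₁, v₂, h₂.exX]
    have := ((Reach.seq _ _ _ _).trans r₁).trans (((Reach.seq _ _ _ _).trans r₂).trans r₃)
    exact this.cast (by simp only [Expr.cost]; omega)
  | lab e ihe =>
    intro σ h hok d K
    obtain ⟨σ₁, r₁, h₁, v₁, k₁⟩ := ihe h hok d (.readY (2 * d + 1) (2 * d + 1) :: K)
    obtain ⟨h₃, v₃, k₃⟩ := hset h₁ d (s.exY (e.eval s)) (by rw [← h₁.exY]; exact h₁.bdd.exY _)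
    refine ⟨_, ?_, h₃, v₃, fun d' hd' => by rw [k₃ d' hd', k₁ d' hd']⟩
    have r₃ : Reach W 1 (.readY (2 * d + 1) (2 * d + 1) :: K, σ₁)
        (K, σ₁.set W (2 * d + 1) (s.exY (e.eval s))) :=
      Reach.of_step fun _ => by simp only [step]; rw [v₁, h₁.exY]
    have := ((Reach.seq _ _ _ _).trans r₁).trans r₃
    exact this.cast (by simp only [Expr.cost]; omega)

/-- Correctness of the compiler. -/
theorem Exec.compile {W : ℕ} {c : Cmd} {s s' : State} {t : ℕ} (hx : Exec W c s t s') :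
    ∀ {σ : State} (_ : Sim W σ s) (K : List Prog),
      ∃ σ', Reach W t (c.compile :: K, σ) (K, σ') ∧ Sim W σ' s' := by
  induction hx with
  | @assign x e s h =>
    intro σ hs K
    obtain ⟨σ₁, r₁, h₁, v₁, -⟩ := e.compile_spec hs h 0 (.op .or (2 * x) 1 1 :: K)
    have hv : e.eval s < W := by rw [← v₁]; exact h₁.bdd.reg _
    refine ⟨σ₁.set W (2 * x) (e.eval s), ?_, h₁.bdd.set _ _, fun r => ?_, h₁.arr, h₁.exX, h₁.exY,
      h₁.drawn⟩
    · have r₂ : Reach W 1 (.op .or (2 * x) 1 1 :: K, σ₁) (K, σ₁.set W (2 * x) (e.eval s)) :=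
        Reach.of_step fun _ => by
          simp only [step, WordOp.eval, Nat.or_self]; simp only [mul_zero, zero_add] at v₁; rw [v₁]
      have := ((Reach.seq _ _ _ _).trans r₁).trans r₂
      exact this.cast (by omega)
    · by_cases hr : r = x
      · subst hr; simp [State.set, Nat.mod_eq_of_lt hv]
      · have : 2 * r ≠ 2 * x := by omega
        simp [State.set, this, hr, h₁.reg]
  | @store A i e s hi he =>
    intro σ hs K
    obtain ⟨σ₁, r₁, h₁, v₁, -⟩ := i.compile_spec hs hi 0 (.seq (e.compile 1) (.store A 1 3) :: K)
    obtain ⟨σ₂, r₂, h₂, v₂, k₂⟩ := e.compile_spec h₁ he 1 (.store A 1 3 :: K)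
    have v₁' := (k₂ 0 (by omega)).trans v₁
    simp only [mul_zero, zero_add, mul_one] at v₁' v₂
    refine ⟨σ₂.sto A (i.eval s) (e.eval s), ?_, ⟨h₂.bdd.reg, fun B j => ?_, h₂.bdd.exX, h₂.bdd.exY⟩,
      h₂.reg, ?_, h₂.exX, h₂.exY, h₂.drawn⟩
    · have r₃ : Reach W 1 (.store A 1 3 :: K, σ₂) (K, σ₂.sto A (i.eval s) (e.eval s)) :=
        Reach.of_step fun _ => by simp only [step, State.sto]; rw [v₁', v₂]
      have := ((Reach.seq _ _ _ _).trans r₁).trans (((Reach.seq _ _ _ _).trans r₂).trans r₃)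
      exact this.cast (by omega)
    · rw [State.sto_arr]
      split_ifs
      · rw [← v₂]; exact h₂.bdd.reg _
      · exact h₂.bdd.arr _ _
    · simp only [State.sto, h₂.arr]
  | seq _ _ ihc ihd =>
    intro σ hs K
    obtain ⟨σ₁, r₁, h₁⟩ := ihc hs (_ :: K)
    obtain ⟨σ₂, r₂, h₂⟩ := ihd h₁ K
    refine ⟨σ₂, ?_, h₂⟩
    have := ((Reach.seq _ _ _ _).trans r₁).trans r₂
    exact this.cast (by omega)
  | @iteT e c d s s' t h h0 _ ih =>
    intro σ hs K
    obtain ⟨σ₁, r₁, h₁, v₁, -⟩ := e.compile_spec hs h 0 (.ite 1 c.compile d.compile :: K)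
    obtain ⟨σ₂, r₂, h₂⟩ := ih h₁ K
    refine ⟨σ₂, ?_, h₂⟩
    have r₃ : Reach W 1 (.ite 1 c.compile d.compile :: K, σ₁) (c.compile :: K, σ₁) :=
      Reach.of_step fun _ => by
        simp only [mul_zero, zero_add] at v₁
        simp [step, v₁, h0]
    have := (((Reach.seq _ _ _ _).trans r₁).trans r₃).trans r₂
    exact this.cast (by omega)
  | @iteF e c d s s' t h h0 _ ih =>
    intro σ hs K
    obtain ⟨σ₁, r₁, h₁, v₁, -⟩ := e.compile_spec hs h 0 (.ite 1 c.compile d.compile :: K)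
    obtain ⟨σ₂, r₂, h₂⟩ := ih h₁ K
    refine ⟨σ₂, ?_, h₂⟩
    have r₃ : Reach W 1 (.ite 1 c.compile d.compile :: K, σ₁) (d.compile :: K, σ₁) :=
      Reach.of_step fun _ => by
        simp only [mul_zero, zero_add] at v₁
        simp [step, v₁, h0]
    have := (((Reach.seq _ _ _ _).trans r₁).trans r₃).trans r₂
    exact this.cast (by omega)
  | @whileF e c s h h0 =>
    intro σ hs K
    obtain ⟨σ₁, r₁, h₁, v₁, -⟩ := e.compile_spec hs h 0
      (.loop 1 (.seq c.compile (e.compile 0)) :: K)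
    refine ⟨σ₁, ?_, h₁⟩
    have r₃ : Reach W 1 (.loop 1 (.seq c.compile (e.compile 0)) :: K, σ₁) (K, σ₁) :=
      Reach.of_step fun _ => by
        simp only [mul_zero, zero_add] at v₁
        simp [step, v₁, h0]
    have := ((Reach.seq _ _ _ _).trans r₁).trans r₃
    exact this.cast (by omega)
  | @whileT e c s s' s'' t t' h h0 _ hw ihc ihw =>
    intro σ hs K
    obtain ⟨σ₁, r₁, h₁, v₁, -⟩ := e.compile_spec hs h 0
      (.loop 1 (.seq c.compile (e.compile 0)) :: K)
    obtain ⟨σ₂, r₂, h₂⟩ := ihc h₁ (e.compile 0 :: .loop 1 (.seq c.compile (e.compile 0)) :: K)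
    obtain ⟨σ₃, r₃, h₃⟩ := ihw h₂ K
    obtain ⟨t'', rfl⟩ : ∃ t'', t' = 1 + t'' := by
      refine ⟨t' - 1, ?_⟩
      cases hw <;> omega
    refine ⟨σ₃, ?_, h₃⟩
    have r₄ : Reach W 1 (.loop 1 (.seq c.compile (e.compile 0)) :: K, σ₁)
        (.seq c.compile (e.compile 0) :: .loop 1 (.seq c.compile (e.compile 0)) :: K, σ₁) :=
      Reach.of_step fun _ => by
        simp only [mul_zero, zero_add] at v₁
        simp [step, v₁, h0]
    -- the first step of the compiled loop only unfolds the sequence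
    have r₅ : Reach W t'' (e.compile 0 :: .loop 1 (.seq c.compile (e.compile 0)) :: K, σ₂)
        (K, σ₃) := fun n o T => by
      have h₅ := r₃ n o T
      rw [add_assoc, Cmd.compile, Reach.seq _ _ _ _ n o (t'' + T)] at h₅
      exact h₅
    have := ((((Reach.seq _ _ _ _).trans r₁).trans r₄).trans ((Reach.seq _ _ _ _).trans r₂)).trans r₅
    exact this.cast (by omega)

/-! ### Program logic with time bounds -/

/-- Started in `s`, the command ends within `τ` steps, without overflow, in a state satisfying
`Q`. -/
def wp (W : ℕ) (c : Cmd) (τ : ℕ) (Q : State → Prop) (s : State) : Prop :=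
  ∃ t s', t ≤ τ ∧ Exec W c s t s' ∧ Q s'

/-- The variables that a command may change. -/
def Cmd.regs : Cmd → List ℕ
  | .assign x _ => [x]
  | .store _ _ _ => []
  | .seq c d => c.regs ++ d.regs
  | .ite _ c d => c.regs ++ d.regs
  | .while _ c => c.regs

/-- The arrays that a command may change. -/
def Cmd.arrs : Cmd → List ℕ
  | .assign _ _ => []
  | .store A _ _ => [A]
  | .seq c d => c.arrs ++ d.arrs
  | .ite _ c d => c.arrs ++ d.arrs
  | .while _ c => c.arrs

/-- The state `s'` differs from `s` only in the variables `R` and the arrays `L`. -/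
structure Frame (R L : List ℕ) (s s' : State) : Prop where
  reg : ∀ r, r ∉ R → s'.reg r = s.reg r
  arr : ∀ A, A ∉ L → s'.arr A = s.arr A
  exX : s'.exX = s.exX
  exY : s'.exY = s.exY
  drawn : s'.drawn = s.drawn

theorem Frame.refl (R L : List ℕ) (s : State) : Frame R L s s :=
  ⟨fun _ _ => rfl, fun _ _ => rfl, rfl, rfl, rfl⟩

theorem Frame.trans {R L : List ℕ} {s s' s'' : State} (h : Frame R L s s') (h' : Frame R L s' s'') :
    Frame R L s s'' :=
  ⟨fun r hr => (h'.reg r hr).trans (h.reg r hr), fun A hA => (h'.arr A hA).trans (h.arr A hA),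
    h'.exX.trans h.exX, h'.exY.trans h.exY, h'.drawn.trans h.drawn⟩

theorem Frame.mono {R L R' L' : List ℕ} {s s' : State} (h : Frame R L s s') (hR : R ⊆ R')
    (hL : L ⊆ L') : Frame R' L' s s' :=
  ⟨fun r hr => h.reg r fun h' => hr (hR h'), fun A hA => h.arr A fun h' => hA (hL h'), h.exX, h.exY,
    h.drawn⟩

theorem Frame.put {R L : List ℕ} {s s' : State} {x : ℕ} (v : ℕ) (h : Frame R L s s') (hx : x ∈ R) :
    Frame R L s (s'.put x v) :=
  ⟨fun r hr => by
    rw [State.put_reg, if_neg (by rintro rfl; exact hr hx), h.reg r hr], h.arr, h.exX, h.exY, h.drawn⟩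

/-- A command changes only the variables and arrays that it mentions as targets. -/
theorem Exec.frame {W : ℕ} {c : Cmd} {s s' : State} {t : ℕ} (hx : Exec W c s t s') :
    Frame c.regs c.arrs s s' := by
  induction hx with
  | assign h =>
    exact (Frame.refl _ _ _).put _ (by simp [Cmd.regs])
  | @store A i e s hi he =>
    refine ⟨fun _ _ => rfl, fun B hB => ?_, rfl, rfl, rfl⟩
    simp only [Cmd.arrs, List.mem_singleton] at hB
    simp [State.sto, hB]
  | seq _ _ ihc ihd =>
    exact (ihc.mono (by simp [Cmd.regs]) (by simp [Cmd.arrs])).trans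
      (ihd.mono (by simp [Cmd.regs]) (by simp [Cmd.arrs]))
  | iteT _ _ _ ih => exact ih.mono (by simp [Cmd.regs]) (by simp [Cmd.arrs])
  | iteF _ _ _ ih => exact ih.mono (by simp [Cmd.regs]) (by simp [Cmd.arrs])
  | whileF _ _ => exact Frame.refl _ _ _
  | whileT _ _ _ _ ihc ihw => exact Frame.trans ihc ihw

theorem wp.mono {W : ℕ} {c : Cmd} {τ τ' : ℕ} {Q Q' : State → Prop} {s : State} (h : wp W c τ Q s)
    (hτ : τ ≤ τ') (hQ : ∀ s', Frame c.regs c.arrs s s' → Q s' → Q' s') : wp W c τ' Q' s := by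
  obtain ⟨t, s', ht, hx, hq⟩ := h
  exact ⟨t, s', ht.trans hτ, hx, hQ s' hx.frame hq⟩

theorem wp.assign {W x τ : ℕ} {e : Expr} {Q : State → Prop} {s : State} (hτ : e.cost + 2 ≤ τ)
    (h : e.Ok W s) (hQ : Q (s.put x (e.eval s))) : wp W (.assign x e) τ Q s :=
  ⟨_, _, hτ, .assign h, hQ⟩

theorem wp.store {W A τ : ℕ} {i e : Expr} {Q : State → Prop} {s : State}
    (hτ : i.cost + e.cost + 3 ≤ τ) (hi : i.Ok W s) (he : e.Ok W s)
    (hQ : Q (s.sto A (i.eval s) (e.eval s))) : wp W (.store A i e) τ Q s :=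
  ⟨_, _, hτ, .store hi he, hQ⟩

theorem wp.seq {W τ τ₁ : ℕ} (τ₂ : ℕ) {c d : Cmd} {Q : State → Prop} {s : State}
    (h : wp W c τ₁ (fun s' => wp W d τ₂ Q s') s) (hτ : τ₁ + τ₂ + 1 ≤ τ) :
    wp W (.seq c d) τ Q s := by
  obtain ⟨t, s', ht, hx, t', s'', ht', hx', hq⟩ := h
  exact ⟨_, _, by omega, .seq hx hx', hq⟩

theorem wp.ite {W τ τ' : ℕ} {e : Expr} {c d : Cmd} {Q : State → Prop} {s : State}
    (hτ : e.cost + τ' + 2 ≤ τ) (he : e.Ok W s) (hc : e.eval s ≠ 0 → wp W c τ' Q s)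
    (hd : e.eval s = 0 → wp W d τ' Q s) : wp W (.ite e c d) τ Q s := by
  by_cases h0 : e.eval s = 0
  · obtain ⟨t, s', ht, hx, hq⟩ := hd h0
    exact ⟨_, _, by omega, .iteF he h0 hx, hq⟩
  · obtain ⟨t, s', ht, hx, hq⟩ := hc h0
    exact ⟨_, _, by omega, .iteT he h0 hx, hq⟩

/-- A loop whose number of iterations `N` is known. -/
theorem wp.while {W N τ τ' : ℕ} {e : Expr} {c : Cmd} {s : State} (I : ℕ → State → Prop)
    (h0 : I 0 s) (hτ : N * (τ' + e.cost + 2) + e.cost + 2 ≤ τ)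
    (hc : ∀ i < N, ∀ s', Frame c.regs c.arrs s s' → I i s' →
      e.Ok W s' ∧ e.eval s' ≠ 0 ∧ wp W c τ' (I (i + 1)) s')
    (hN : ∀ s', Frame c.regs c.arrs s s' → I N s' → e.Ok W s' ∧ e.eval s' = 0) :
    wp W (.while e c) τ (I N) s := by
  suffices H : ∀ m ≤ N, ∀ s', Frame c.regs c.arrs s s' → I (N - m) s' →
      wp W (.while e c) (m * (τ' + e.cost + 2) + e.cost + 2) (I N) s' from
    (H N le_rfl s (.refl _ _ _) (by simpa using h0)).mono hτ fun _ _ h => h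
  intro m
  induction m with
  | zero =>
    intro _ s' hf hI
    obtain ⟨ho, hz⟩ := hN s' hf (by simpa using hI)
    exact ⟨_, _, by omega, .whileF ho hz, by simpa using hI⟩
  | succ m ih =>
    intro hm s' hf hI
    obtain ⟨ho, hz, t, s₁, ht, hx, hq⟩ := hc _ (by omega) s' hf hI
    obtain ⟨t', s₂, ht', hx', hq'⟩ := ih (by omega) s₁ (hf.trans hx.frame)
      (by convert hq using 1; omega)
    refine ⟨_, _, ?_, .whileT ho hz hx hx', hq'⟩
    rw [add_one_mul]; omega

/-- `for x := 0, …, e - 1 do c`. -/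
def Cmd.for (x : ℕ) (e : Expr) (c : Cmd) : Cmd :=
  .seq (.assign x (.lit 0))
    (.while (.bin .lt (.var x) e) (.seq c (.assign x (.var x + .lit 1))))

/-- The rule for counting loops.  The invariant is to be proved after the counter has been
increased. -/
theorem wp.for {W x N τ τ' : ℕ} {e : Expr} {c : Cmd} {s : State} (I : ℕ → State → Prop)
    (hτ : N * (τ' + 2 * e.cost + 20) + 2 * e.cost + 20 ≤ τ) (hW : N + 1 < W)
    (he : ∀ s', Frame (x :: c.regs) c.arrs s s' → e.Ok W s' ∧ e.eval s' = N)
    (hx : x ∉ c.regs)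
    (h0 : I 0 (s.put x 0))
    (hc : ∀ i < N, ∀ s', Frame (x :: c.regs) c.arrs s s' → s'.reg x = i → I i s' →
      wp W c τ' (fun s'' => I (i + 1) (s''.put x (i + 1))) s') :
    wp W (.for x e c) τ (I N) s := by
  refine wp.seq (τ - 4) (τ₁ := 3) (wp.assign le_rfl (show 0 < W by omega) ?_) (by omega)
  refine wp.mono (Q := fun s' => I N s' ∧ s'.reg x = N)
    (wp.while (N := N) (τ' := τ' + 8) (fun i s' => I i s' ∧ s'.reg x = i) ?_ le_rfl ?_ ?_) ?_
    (fun _ _ h => h.1)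
  · exact ⟨h0, by simp [Expr.eval]⟩
  · rintro i hi s' hf ⟨hI, hxi⟩
    have hf' : Frame (x :: c.regs) c.arrs s s' := by
      refine Frame.trans ((Frame.refl _ _ s).put (x := x) 0 (by simp)) ?_
      exact hf.mono (by simp [Cmd.regs]) (by simp [Cmd.arrs])
    obtain ⟨ho, hv⟩ := he s' hf'
    refine ⟨⟨trivial, ho, ?_⟩, ?_, ?_⟩
    · simp only [WordOp.eval]; split_ifs <;> omega
    · simp [Expr.eval, WordOp.eval, hv, hxi, hi]
    · refine wp.seq 7 ((hc i hi s' hf' hxi hI).mono le_rfl fun s'' hf'' h'' => ?_) (by omega)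
      have hxi' : s''.reg x = i := by rw [hf''.reg x hx, hxi]
      refine wp.assign le_rfl ⟨trivial, ?_, ?_⟩ ?_
      · show 1 < W; omega
      · simp only [Expr.eval, WordOp.eval, hxi']; omega
      · have : (Expr.var x + Expr.lit 1).eval s'' = i + 1 := by
          show s''.reg x + 1 = i + 1
          rw [hxi']
        rw [this]
        exact ⟨h'', by simp⟩
  · rintro s' hf ⟨hI, hxi⟩
    have hf' : Frame (x :: c.regs) c.arrs s s' := by
      refine Frame.trans ((Frame.refl _ _ s).put (x := x) 0 (by simp)) ?_
      exact hf.mono (by simp [Cmd.regs]) (by simp [Cmd.arrs])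
    obtain ⟨ho, hv⟩ := he s' hf'
    refine ⟨⟨trivial, ho, ?_⟩, ?_⟩
    · simp only [WordOp.eval]; split_ifs <;> omega
    · simp [Expr.eval, WordOp.eval, hv, hxi]
  · simp only [Expr.cost]
    have : τ' + 8 + (1 + e.cost + 3) + 2 ≤ τ' + 2 * e.cost + 20 := by omega
    have := Nat.mul_le_mul_left N this
    omega

/-- The rule for counting loops whose bound is a variable. -/
theorem wp.forVar {W x r N τ τ' : ℕ} {c : Cmd} {s : State} (I : ℕ → State → Prop)
    (hτ : N * (τ' + 22) + 22 ≤ τ) (hW : N + 1 < W) (hr : s.reg r = N) (h0 : I 0 (s.put x 0))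
    (hc : ∀ i < N, ∀ s', Frame (x :: c.regs) c.arrs s s' → s'.reg x = i → I i s' →
      wp W c τ' (fun s'' => I (i + 1) (s''.put x (i + 1))) s')
    (hr' : r ∉ x :: c.regs := by decide) (hx : x ∉ c.regs := by decide) :
    wp W (.for x (.var r) c) τ (I N) s :=
  wp.for I hτ hW (fun _ hs' => ⟨trivial, (hs'.reg r hr').trans hr⟩) hx h0 hc

/-! ### Words as bit vectors -/

/-- The word with the `m` bits `f 0, …, f (m - 1)`, the first one being the most significant. -/
def packBits (f : ℕ → ℕ) : ℕ → ℕ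
  | 0 => 0
  | m + 1 => 2 * packBits f m + f m

theorem packBits_lt {f : ℕ → ℕ} (hf : ∀ j, f j < 2) (m : ℕ) : packBits f m < 2 ^ m := by
  induction m with
  | zero => simp [packBits]
  | succ m ih => have := hf m; simp only [packBits, pow_succ]; omega

/-- Bitwise sums can be computed separately for the last bit and the rest. -/
theorem two_mul_add_xor {a b c d : ℕ} (hb : b < 2) (hd : d < 2) :
    (2 * a + b) ^^^ (2 * c + d) = 2 * (a ^^^ c) + (b ^^^ d) := by
  apply Nat.eq_of_testBit_eq
  intro i
  have hbd : b ^^^ d < 2 := Nat.xor_lt_two_pow (n := 1) hb hd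
  cases i with
  | zero =>
    rw [Nat.testBit_xor]
    simp only [Nat.testBit_zero]
    interval_cases b <;> interval_cases d <;> simp [Nat.add_mod]
  | succ i =>
    rw [Nat.testBit_xor, Nat.testBit_succ, Nat.testBit_succ, Nat.testBit_succ]
    rw [show (2 * a + b) / 2 = a by omega, show (2 * c + d) / 2 = c by omega,
      show (2 * (a ^^^ c) + (b ^^^ d)) / 2 = a ^^^ c by omega, Nat.testBit_xor]

theorem packBits_xor {f g : ℕ → ℕ} (hf : ∀ j, f j < 2) (hg : ∀ j, g j < 2) (m : ℕ) :
    packBits f m ^^^ packBits g m = packBits (fun j => f j ^^^ g j) m := by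
  induction m with
  | zero => simp [packBits]
  | succ m ih => rw [packBits, packBits, packBits, two_mul_add_xor (hf m) (hg m), ih]

theorem packBits_eq_zero {f : ℕ → ℕ} {m : ℕ} (h : packBits f m = 0) : ∀ j < m, f j = 0 := by
  induction m with
  | zero => simp
  | succ m ih =>
    rw [packBits] at h
    intro j hj
    rcases Nat.lt_succ_iff_lt_or_eq.mp hj with hj | rfl
    · exact ih (by omega) j hj
    · omega

theorem packBits_congr {f g : ℕ → ℕ} {m : ℕ} (h : ∀ j < m, f j = g j) :
    packBits f m = packBits g m := by
  induction m with
  | zero => rfl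
  | succ m ih => rw [packBits, packBits, ih fun j hj => h j (by omega), h m (by omega)]

/-- The number of ones in the binary expansion. -/
def popCount (i : ℕ) : ℕ := (Nat.digits 2 i).sum

/-- The recursion by which the table of the numbers of ones is filled. -/
theorem popCount_eq (i : ℕ) : popCount i = popCount (i / 2) + i % 2 := by
  rcases Nat.eq_zero_or_pos i with rfl | hi
  · simp [popCount]
  · rw [popCount, Nat.digits_def' (by norm_num) hi, List.sum_cons, popCount, add_comm]

theorem popCount_packBits {f : ℕ → ℕ} (hf : ∀ j, f j < 2) (m : ℕ) :
    popCount (packBits f m) = ∑ j ∈ Finset.range m, f j := by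
  induction m with
  | zero => simp [packBits, popCount]
  | succ m ih =>
    have := hf m
    rw [packBits, popCount_eq, Finset.sum_range_succ, ← ih]
    congr 1
    · congr 1; omega
    · omega

theorem popCount_le (i : ℕ) : popCount i ≤ i := by
  induction i using Nat.strong_induction_on with
  | _ i ih =>
    rcases Nat.eq_zero_or_pos i with rfl | hi
    · simp [popCount]
    · rw [popCount_eq]; have := ih (i / 2) (by omega); omega

/-- The bitwise sum of the words `f u`, `u ∈ L`. -/
def xorSum (f : ℕ → ℕ) (L : List ℕ) : ℕ := (L.map f).foldr (· ^^^ ·) 0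

@[simp] theorem xorSum_nil (f : ℕ → ℕ) : xorSum f [] = 0 := rfl

@[simp] theorem xorSum_cons (f : ℕ → ℕ) (u : ℕ) (L : List ℕ) :
    xorSum f (u :: L) = f u ^^^ xorSum f L := rfl

theorem xorSum_congr {f g : ℕ → ℕ} {L : List ℕ} (h : ∀ u ∈ L, f u = g u) :
    xorSum f L = xorSum g L := by
  rw [xorSum, xorSum, List.map_congr_left h]

theorem xorSum_append (f : ℕ → ℕ) (L L' : List ℕ) :
    xorSum f (L ++ L') = xorSum f L ^^^ xorSum f L' := by
  induction L with
  | nil => simp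
  | cons u L ih => simp [ih, Nat.xor_assoc]

theorem xorSum_lt {f : ℕ → ℕ} {m : ℕ} (hf : ∀ u, f u < 2 ^ m) (L : List ℕ) :
    xorSum f L < 2 ^ m := by
  induction L with
  | nil => simp
  | cons u L ih => exact Nat.xor_lt_two_pow (hf u) ih

theorem xorSum_packBits {g : ℕ → ℕ → ℕ} (hg : ∀ u j, g u j < 2) (m : ℕ) (L : List ℕ) :
    xorSum (fun u => packBits (g u) m) L = packBits (fun j => xorSum (fun u => g u j) L) m := by
  induction L with
  | nil =>
    simp only [xorSum_nil]
    induction m with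
    | zero => rfl
    | succ m ih => rw [packBits, ← ih]
  | cons u L ih =>
    rw [xorSum_cons, ih, packBits_xor (hg u) fun j => xorSum_lt (m := 1) (fun u => hg u j) L]
    rfl

theorem xorSum_eq_mod {f : ℕ → ℕ} (hf : ∀ u, f u < 2) (L : List ℕ) :
    xorSum f L = (L.map f).sum % 2 := by
  induction L with
  | nil => rfl
  | cons u L ih =>
    have h := hf u
    rw [xorSum_cons, ih, List.map_cons, List.sum_cons]
    rcases Nat.mod_two_eq_zero_or_one (L.map f).sum with h' | h' <;> rw [h'] <;>
      interval_cases f u <;> simp <;> omega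

/-- Words of the form `f u + 2 * g u` with bits `f u` and `g u` are added componentwise. -/
theorem xorSum_pair {f g : ℕ → ℕ} (hf : ∀ u, f u < 2) (L : List ℕ) :
    xorSum (fun u => f u + 2 * g u) L = xorSum f L + 2 * xorSum g L := by
  induction L with
  | nil => rfl
  | cons u L ih =>
    simp only [xorSum_cons, ih]
    rw [add_comm (f u), add_comm (xorSum f L),
      two_mul_add_xor (hf u) (xorSum_lt (m := 1) hf L), add_comm]

/-! ### Elimination of the words of a batch of vectors -/

/-- The table entry for the key `x` after the vectors with numbers below `m` have been processed:
`f + 1` if `f` is the first nonempty entry of `C` with key `x`, and `0` if there is none. -/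
def hit (C : ℕ → List ℕ) (key : ℕ → ℕ) (x : ℕ) : ℕ → ℕ
  | 0 => 0
  | m + 1 => if hit C key x m ≠ 0 then hit C key x m
      else if C m ≠ [] ∧ key m = x then m + 1 else 0

/-- Blockwise elimination.  The vector with number `u` has the words `w u 0, w u 1, …`; the list
`elim w i u` holds the numbers of the vectors which have been added up in place `u` after the words
below `i` have been eliminated, and it is empty if the place `u` has been given up.  At level `i`
the first vector with a given word number `i` is given up and added to the later ones. -/
def elim (w : ℕ → ℕ → ℕ) : ℕ → ℕ → List ℕ
  | 0, u => [u]
  | i + 1, u =>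
    if elim w i u = [] ∨ hit (elim w i) (fun v => xorSum (w · i) (elim w i v))
        (xorSum (w · i) (elim w i u)) u = 0 then []
    else elim w i (hit (elim w i) (fun v => xorSum (w · i) (elim w i v))
        (xorSum (w · i) (elim w i u)) u - 1) ++ elim w i u

/-- The word number `i` of the vector in place `u` after the words below `i` have been
eliminated. -/
def elimKey (w : ℕ → ℕ → ℕ) (i u : ℕ) : ℕ := xorSum (w · i) (elim w i u)

/-- The table of level `i` after the first `m` vectors have been processed. -/
def elimHit (w : ℕ → ℕ → ℕ) (i m x : ℕ) : ℕ := hit (elim w i) (elimKey w i) x m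

theorem elim_succ (w : ℕ → ℕ → ℕ) (i u : ℕ) : elim w (i + 1) u =
    if elim w i u = [] ∨ elimHit w i u (elimKey w i u) = 0 then []
    else elim w i (elimHit w i u (elimKey w i u) - 1) ++ elim w i u := rfl

theorem elimHit_succ (w : ℕ → ℕ → ℕ) (i m x : ℕ) : elimHit w i (m + 1) x =
    if elimHit w i m x ≠ 0 then elimHit w i m x
    else if elim w i m ≠ [] ∧ elimKey w i m = x then m + 1 else 0 := rfl

/-- A nonzero table entry is one more than the place of an earlier vector with the given key. -/
theorem elimHit_spec {w : ℕ → ℕ → ℕ} {i m x : ℕ} (h : elimHit w i m x ≠ 0) :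
    elimHit w i m x - 1 < m ∧ elim w i (elimHit w i m x - 1) ≠ [] ∧
      elimKey w i (elimHit w i m x - 1) = x := by
  induction m with
  | zero => exact absurd rfl h
  | succ m ih =>
    rw [elimHit_succ] at h ⊢
    by_cases h₁ : elimHit w i m x ≠ 0
    · obtain ⟨h₂, h₃⟩ := ih h₁
      rw [if_pos h₁]
      exact ⟨by omega, h₃⟩
    · rw [if_neg h₁] at h ⊢
      split_ifs at h ⊢ with h₂
      · exact ⟨by simp, by simpa using h₂⟩
      · exact absurd rfl h

theorem elimHit_eq_zero {w : ℕ → ℕ → ℕ} {i m x : ℕ} (h : elimHit w i m x = 0) :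
    ∀ f < m, elim w i f ≠ [] → elimKey w i f ≠ x := by
  induction m with
  | zero => intro f hf; omega
  | succ m ih =>
    rw [elimHit_succ] at h
    split_ifs at h with h₁ h₂
    · exact absurd h h₁
    · intro f hf hne hk
      rcases Nat.lt_succ_iff_lt_or_eq.mp hf with hf | rfl
      · exact ih (by simpa using h₁) f hf hne hk
      · exact h₂ ⟨hne, hk⟩

/-- The vector in the table met an empty entry when it was processed, so it did not survive. -/
theorem elimHit_first {w : ℕ → ℕ → ℕ} {i m x : ℕ} (h : elimHit w i m x ≠ 0) :
    elimHit w i (elimHit w i m x - 1) x = 0 := by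
  induction m with
  | zero => exact absurd rfl h
  | succ m ih =>
    rw [elimHit_succ] at h ⊢
    by_cases h₁ : elimHit w i m x ≠ 0
    · rw [if_pos h₁]; exact ih h₁
    · rw [if_neg h₁] at h ⊢
      split_ifs at h ⊢ with h₂
      · simpa using h₁
      · exact absurd rfl h

/-- The form of the recursion that matches the machine: processing a vector changes at most the
entry for the key of that vector. -/
theorem elimHit_succ' (w : ℕ → ℕ → ℕ) (i m x : ℕ) : elimHit w i (m + 1) x =
    if x = elimKey w i m ∧ elim w i m ≠ [] ∧ elimHit w i m (elimKey w i m) = 0 then m + 1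
    else elimHit w i m x := by
  rw [elimHit_succ]
  by_cases hx : x = elimKey w i m
  · subst hx
    by_cases h : elimHit w i m (elimKey w i m) = 0 <;> simp [h]
  · have hx' : ¬elimKey w i m = x := fun h => hx h.symm
    by_cases h : elimHit w i m x = 0 <;> simp [h, hx, hx']

theorem elim_succ_eq_nil_of_hit {w : ℕ → ℕ → ℕ} {i m x : ℕ} (h : elimHit w i m x ≠ 0) :
    elim w (i + 1) (elimHit w i m x - 1) = [] := by
  rw [elim_succ, (elimHit_spec h).2.2, if_pos (Or.inr (elimHit_first h))]

theorem elimHit_le (w : ℕ → ℕ → ℕ) (i m x : ℕ) : elimHit w i m x ≤ m := by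
  by_cases h : elimHit w i m x = 0
  · omega
  · have := (elimHit_spec h).1; omega

theorem elim_ne_nil_of_succ {w : ℕ → ℕ → ℕ} {i u : ℕ} (h : elim w (i + 1) u ≠ []) :
    elim w i u ≠ [] ∧ elimHit w i u (elimKey w i u) ≠ 0 ∧
      elim w (i + 1) u = elim w i (elimHit w i u (elimKey w i u) - 1) ++ elim w i u := by
  rw [elim_succ] at h ⊢
  split_ifs at h ⊢ with h₁
  · exact absurd rfl h
  · push Not at h₁
    exact ⟨h₁.1, h₁.2, rfl⟩

theorem mem_elim_le {w : ℕ → ℕ → ℕ} {i : ℕ} : ∀ {u v : ℕ}, v ∈ elim w i u → v ≤ u := by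
  induction i with
  | zero => intro u v hv; simp only [elim, List.mem_singleton] at hv; omega
  | succ i ih =>
    intro u v hv
    obtain ⟨-, h₁, h₂⟩ := elim_ne_nil_of_succ (List.ne_nil_of_mem hv)
    rw [h₂, List.mem_append] at hv
    rcases hv with hv | hv
    · have := ih hv; have := (elimHit_spec h₁).1; omega
    · exact ih hv

/-- The vector `u` itself occurs exactly once in its combination, because the vectors that are
added to it are earlier ones.  In particular the combination is nontrivial modulo two. -/
theorem count_elim {w : ℕ → ℕ → ℕ} {i u : ℕ} (h : elim w i u ≠ []) :
    (elim w i u).count u = 1 := by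
  induction i with
  | zero => simp [elim]
  | succ i ih =>
    obtain ⟨h₀, h₁, h₂⟩ := elim_ne_nil_of_succ h
    rw [h₂, List.count_append, ih h₀, List.count_eq_zero_of_not_mem]
    intro hm
    have := mem_elim_le hm; have := (elimHit_spec h₁).1; omega

theorem length_elim {w : ℕ → ℕ → ℕ} {i u : ℕ} (h : elim w i u ≠ []) :
    (elim w i u).length = 2 ^ i := by
  induction i generalizing u with
  | zero => simp [elim]
  | succ i ih =>
    obtain ⟨h₀, h₁, h₂⟩ := elim_ne_nil_of_succ h
    rw [h₂, List.length_append, ih h₀, ih (elimHit_spec h₁).2.1]; ring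

/-- A surviving combination vanishes on the words that have been eliminated. -/
theorem xorSum_elim {w : ℕ → ℕ → ℕ} {i u : ℕ} (h : elim w i u ≠ []) :
    ∀ i' < i, xorSum (w · i') (elim w i u) = 0 := by
  induction i generalizing u with
  | zero => intro i' hi'; omega
  | succ i ih =>
    obtain ⟨h₀, h₁, h₂⟩ := elim_ne_nil_of_succ h
    obtain ⟨-, h₃, h₄⟩ := elimHit_spec h₁
    intro i' hi'
    rw [h₂, xorSum_append]
    rcases Nat.lt_succ_iff_lt_or_eq.mp hi' with hi' | rfl
    · rw [ih h₀ i' hi', ih h₃ i' hi', Nat.xor_self]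
    · rw [elimKey] at h₄
      rw [h₄, elimKey, Nat.xor_self]

theorem hit_congr {C C' : ℕ → List ℕ} {key key' : ℕ → ℕ} (x : ℕ) {m : ℕ}
    (hC : ∀ v < m, C v = C' v) (hk : ∀ v < m, key v = key' v) :
    hit C key x m = hit C' key' x m := by
  induction m with
  | zero => rfl
  | succ m ih =>
    rw [hit, hit, ih (fun v hv => hC v (by omega)) (fun v hv => hk v (by omega)), hC m (by omega),
      hk m (by omega)]

/-- The elimination of the first `l` words depends on these words only. -/
theorem elim_congr {w w' : ℕ → ℕ → ℕ} {l N : ℕ} (h : ∀ u < N, ∀ i < l, w u i = w' u i) :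
    ∀ i ≤ l, ∀ u < N, elim w i u = elim w' i u := by
  intro i
  induction i with
  | zero => intro _ _ _; rfl
  | succ i ih =>
    intro hi u hu
    have hC := ih (by omega)
    have hk : ∀ v < N, elimKey w i v = elimKey w' i v := fun v hv => by
      rw [elimKey, elimKey, ← hC v hv]
      exact xorSum_congr fun x hx => h x ((mem_elim_le hx).trans_lt hv) i (by omega)
    have hh : ∀ x, elimHit w i u x = elimHit w' i u x := fun x =>
      hit_congr x (fun v hv => hC v (by omega)) fun v hv => hk v (by omega)
    have hle := elimHit_le w' i u (elimKey w' i u)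
    rw [elim_succ, elim_succ, hk u hu, hh, hC u hu, hC _ (by omega)]

/-- At each level every key costs at most one vector. -/
theorem card_elim_le {w : ℕ → ℕ → ℕ} {m : ℕ} (hw : ∀ u i, w u i < 2 ^ m) (N i : ℕ) :
    N ≤ ((Finset.range N).filter fun u => elim w i u ≠ []).card + i * 2 ^ m := by
  induction i with
  | zero => simp [elim]
  | succ i ih =>
    refine ih.trans ?_
    have hsub : (Finset.range N).filter (fun u => elim w i u ≠ []) ⊆
        (Finset.range N).filter (fun u => elim w (i + 1) u ≠ []) ∪
        (Finset.range N).filter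
          (fun u => elim w i u ≠ [] ∧ elimHit w i u (elimKey w i u) = 0) := by
      intro u hu
      simp only [Finset.mem_union, Finset.mem_filter] at hu ⊢
      by_cases h0 : elimHit w i u (elimKey w i u) = 0
      · exact Or.inr ⟨hu.1, hu.2, h0⟩
      · refine Or.inl ⟨hu.1, ?_⟩
        rw [elim_succ, if_neg (by tauto)]
        simp [hu.2]
    have hinj : ((Finset.range N).filter
          (fun u => elim w i u ≠ [] ∧ elimHit w i u (elimKey w i u) = 0)).card ≤ 2 ^ m := by
      rw [← Finset.card_range (2 ^ m)]
      apply Finset.card_le_card_of_injOn (elimKey w i)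
      · intro u _
        exact Finset.mem_coe.mpr (Finset.mem_range.mpr (xorSum_lt (fun u => hw u i) _))
      · intro u hu v hv huv
        simp only [Finset.coe_filter, Set.mem_ofPred_eq] at hu hv
        by_contra hne
        rcases Nat.lt_or_gt_of_ne hne with hlt | hlt
        · exact elimHit_eq_zero hv.2.2 u hlt hu.2.1 huv
        · exact elimHit_eq_zero hu.2.2 v hlt hv.2.1 huv.symm
    have := (Finset.card_le_card hsub).trans (Finset.card_union_le _ _)
    rw [add_one_mul]
    omega

/-- The last nonempty entry below `N`. -/
def lastList (C : ℕ → List ℕ) : ℕ → List ℕ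
  | 0 => []
  | m + 1 => if C m ≠ [] then C m else lastList C m

theorem lastList_spec {C : ℕ → List ℕ} {N : ℕ} (h : ∃ u < N, C u ≠ []) :
    ∃ u < N, C u ≠ [] ∧ lastList C N = C u := by
  induction N with
  | zero => obtain ⟨u, hu, _⟩ := h; omega
  | succ N ih =>
    by_cases hN : C N = []
    · obtain ⟨u, hu, hne⟩ := h
      have : u ≠ N := by rintro rfl; exact hne hN
      obtain ⟨v, hv, hv', hl⟩ := ih ⟨u, by omega, hne⟩
      exact ⟨v, by omega, hv', by simp [lastList, hN, hl]⟩
    · exact ⟨N, by omega, hN, by simp [lastList, hN]⟩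

/-- The combination of vectors that the elimination of the words below `l` selects from a batch
of `N` vectors. -/
def relation (w : ℕ → ℕ → ℕ) (l N : ℕ) : List ℕ := lastList (elim w l) N

theorem relation_congr {w w' : ℕ → ℕ → ℕ} {l N : ℕ} (h : ∀ u < N, ∀ i < l, w u i = w' u i) :
    relation w l N = relation w' l N := by
  have hC := elim_congr h l le_rfl
  have : ∀ m ≤ N, lastList (elim w l) m = lastList (elim w' l) m := by
    intro m
    induction m with
    | zero => intro _; rfl
    | succ m ih => intro hm; rw [lastList, lastList, ih (by omega), hC m (by omega)]
  exact this N le_rfl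

/-- A batch with more than `l * 2 ^ m` vectors contains a nontrivial short relation of its
`m`-bit words. -/
theorem relation_spec {w : ℕ → ℕ → ℕ} {m l N : ℕ} (hw : ∀ u, ∀ i < l, w u i < 2 ^ m)
    (hN : l * 2 ^ m < N) :
    ∃ u < N, (relation w l N).count u = 1 ∧ (∀ v ∈ relation w l N, v < N) ∧
      (relation w l N).length = 2 ^ l ∧ ∀ i < l, xorSum (w · i) (relation w l N) = 0 := by
  set w' : ℕ → ℕ → ℕ := fun u i => if i < l then w u i else 0
  have hw' : ∀ u, ∀ i < l, w u i = w' u i := fun u i hi => by simp [w', hi]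
  rw [relation_congr fun u _ => hw' u]
  have hw'' : ∀ u i, w' u i < 2 ^ m := fun u i => by
    by_cases hi : i < l
    · rw [← hw' u i hi]; exact hw u i hi
    · simp [w', hi]
  have hcard := card_elim_le hw'' N l
  obtain ⟨u, hu⟩ : ((Finset.range N).filter fun u => elim w' l u ≠ []).Nonempty := by
    rw [← Finset.card_pos]; omega
  simp only [Finset.mem_filter, Finset.mem_range] at hu
  obtain ⟨v, hv, hne, hl⟩ := lastList_spec ⟨u, hu.1, hu.2⟩
  rw [relation, hl]
  refine ⟨v, hv, count_elim hne, fun x hx => (mem_elim_le hx).trans_lt hv, length_elim hne,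
    fun i hi => ?_⟩
  rw [← xorSum_elim hne i hi]
  congr 1
  funext x
  exact hw' x i hi

/-! ### Enumeration of the subsets of a given size -/

/-- The length of the longest prefix of consecutive numbers among `c 0, …, c m`, minus one. -/
def runLength (c : ℕ → ℕ) : ℕ → ℕ
  | 0 => 0
  | m + 1 => if runLength c m = m ∧ c m + 1 = c (m + 1) then m + 1 else runLength c m

/-- The next combination: the end of the first run is increased and the elements below it are
reset. -/
def nextComb (k : ℕ) (c : ℕ → ℕ) : ℕ → ℕ := fun x =>
  if x < runLength c k then x else if x = runLength c k then c x + 1 else c x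

/-- The sequence of all `k`-element subsets of `{0, …, D - 1}`, each given by its increasing
enumeration followed by the sentinel `D`. -/
def combSeq (k D : ℕ) : ℕ → ℕ → ℕ
  | 0 => fun x => if x < k then x else D
  | t + 1 => nextComb k (combSeq k D t)

/-- The entries `c 0 < … < c (k - 1)` are below the sentinel `c k = D`. -/
structure IsComb (k D : ℕ) (c : ℕ → ℕ) : Prop where
  lt_succ : ∀ x < k, c x < c (x + 1)
  last : c k = D

/-- The position in the combinatorial number system. -/
def combRank (k : ℕ) (c : ℕ → ℕ) : ℕ := ∑ x ∈ Finset.range k, (c x).choose (x + 1)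

/-- The run cannot be extended: either it is maximal or a gap follows it. -/
theorem runLength_spec (c : ℕ → ℕ) (m : ℕ) : runLength c m ≤ m ∧
    (∀ y < runLength c m, c y + 1 = c (y + 1)) ∧
    (runLength c m < m → c (runLength c m) + 1 ≠ c (runLength c m + 1)) := by
  induction m with
  | zero => simp [runLength]
  | succ m ih =>
    obtain ⟨h₁, h₂, h₃⟩ := ih
    rw [runLength]
    split_ifs with h
    · refine ⟨le_rfl, fun y hy => ?_, fun h' => absurd h' (lt_irrefl _)⟩
      rcases Nat.lt_succ_iff_lt_or_eq.mp hy with hy | rfl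
      · exact h₂ y (by omega)
      · exact h.2
    · refine ⟨by omega, h₂, fun _ => ?_⟩
      rcases Nat.lt_or_ge (runLength c m) m with h' | h'
      · exact h₃ h'
      · have : runLength c m = m := le_antisymm h₁ h'
        rw [this]; exact fun h'' => h ⟨this, h''⟩

/-- The hockey-stick identity along a diagonal of Pascal's triangle. -/
theorem sum_choose_add_one (a i : ℕ) :
    ∑ x ∈ Finset.range i, (a + x).choose (x + 1) + 1 = (a + i).choose i := by
  induction i with
  | zero => simp
  | succ i ih =>
    rw [Finset.sum_range_succ, add_right_comm, ih, ← add_assoc, Nat.choose_succ_succ']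

theorem runLength_prefix (c : ℕ → ℕ) (m : ℕ) : ∀ y ≤ runLength c m, c y = c 0 + y := by
  intro y
  induction y with
  | zero => simp
  | succ y ih =>
    intro hy
    rw [← (runLength_spec c m).2.1 y (by omega), ih (by omega)]; omega

/-- If the run extends up to the sentinel, the combination is the last one. -/
theorem combRank_of_runLength_eq {k D : ℕ} {c : ℕ → ℕ} (h : IsComb k D c)
    (hr : runLength c k = k) : combRank k c + 1 = D.choose k := by
  have hp := runLength_prefix c k
  rw [hr] at hp
  rw [← h.last, hp k le_rfl, ← sum_choose_add_one, combRank]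
  congr 1
  exact Finset.sum_congr rfl fun x hx => by rw [hp x (Finset.mem_range.mp hx).le]

/-- The rank increases by one: the reset of the run `a, …, a + i` loses its partial rank, and this
is what raising its end gains, up to one. -/
theorem nextComb_spec {k D : ℕ} {c : ℕ → ℕ} (h : IsComb k D c) (hr : runLength c k < k) :
    IsComb k D (nextComb k c) ∧ combRank k (nextComb k c) = combRank k c + 1 := by
  have hp := runLength_prefix c k
  obtain ⟨-, -, h₃⟩ := runLength_spec c k
  have h₃ := h₃ hr
  set i := runLength c k with hi
  have hn : ∀ x, nextComb k c x = if x < i then x else if x = i then c x + 1 else c x :=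
    fun x => rfl
  refine ⟨⟨fun x hx => ?_, ?_⟩, ?_⟩
  · have h₄ := h.lt_succ x hx
    rw [hn, hn]
    rcases lt_trichotomy x i with hxi | rfl | hxi
    · have := hp i le_rfl
      split_ifs <;> first | omega | skip
      have hxi' : x + 1 = i := by assumption
      rw [hxi', this]; omega
    · rw [if_neg (lt_irrefl _), if_pos rfl, if_neg (by omega), if_neg (by omega)]
      omega
    · rw [if_neg (by omega), if_neg (by omega), if_neg (by omega), if_neg (by omega)]
      exact h₄
  · rw [hn, if_neg (by omega), if_neg (by omega), h.last]
  · obtain ⟨j, hj⟩ : ∃ j, k = (i + 1) + j := ⟨k - (i + 1), by omega⟩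
    rw [combRank, combRank, hj, Finset.sum_range_add, Finset.sum_range_add _ _ j,
      Finset.sum_range_succ, Finset.sum_range_succ _ i, ← hj]
    have e₁ : ∑ x ∈ Finset.range i, (nextComb k c x).choose (x + 1) = 0 :=
      Finset.sum_eq_zero fun x hx => by
        rw [hn, if_pos (Finset.mem_range.mp hx), Nat.choose_eq_zero_of_lt (by omega)]
    have e₂ : ∑ x ∈ Finset.range j, (nextComb k c (i + 1 + x)).choose (i + 1 + x + 1) =
        ∑ x ∈ Finset.range j, (c (i + 1 + x)).choose (i + 1 + x + 1) :=
      Finset.sum_congr rfl fun x _ => by rw [hn, if_neg (by omega), if_neg (by omega)]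
    have e₃ : ∑ x ∈ Finset.range i, (c x).choose (x + 1) + 1 = (c 0 + i).choose i := by
      rw [← sum_choose_add_one]
      congr 1
      exact Finset.sum_congr rfl fun x hx => by rw [hp x (Finset.mem_range.mp hx).le]
    rw [e₁, e₂, hn, if_neg (lt_irrefl _), if_pos rfl, hp i le_rfl, Nat.choose_succ_succ', ← e₃]
    omega

theorem combSeq_spec {k D : ℕ} (hkD : k ≤ D) :
    ∀ t < D.choose k, IsComb k D (combSeq k D t) ∧ combRank k (combSeq k D t) = t := by
  intro t
  induction t with
  | zero =>
    intro _
    refine ⟨⟨fun x hx => ?_, by simp [combSeq]⟩, ?_⟩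
    · simp only [combSeq, if_pos hx]; split_ifs <;> omega
    · refine Finset.sum_eq_zero fun x hx => ?_
      simp only [combSeq, if_pos (Finset.mem_range.mp hx)]
      exact Nat.choose_eq_zero_of_lt (by omega)
  | succ t ih =>
    intro ht
    obtain ⟨h₁, h₂⟩ := ih (by omega)
    have hr : runLength (combSeq k D t) k < k := by
      refine lt_of_le_of_ne (runLength_spec _ k).1 fun hr => ?_
      have := combRank_of_runLength_eq h₁ hr
      omega
    obtain ⟨h₃, h₄⟩ := nextComb_spec h₁ hr
    exact ⟨h₃, by rw [combSeq, h₄, h₂]⟩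

/-- The enumeration can be stopped as soon as the run reaches the sentinel. -/
theorem runLength_combSeq {k D t : ℕ} (hkD : k ≤ D) (ht : t < D.choose k) :
    runLength (combSeq k D t) k = k ↔ t + 1 = D.choose k := by
  obtain ⟨h₁, h₂⟩ := combSeq_spec hkD t ht
  constructor
  · intro h; rw [← combRank_of_runLength_eq h₁ h, h₂]
  · intro h
    refine le_antisymm (runLength_spec _ k).1 (not_lt.mp fun hr => ?_)
    obtain ⟨h₃, h₄⟩ := nextComb_spec h₁ hr
    -- a further combination would have a rank which no combination has
    have hlt : ∀ (k : ℕ) {D : ℕ} {c : ℕ → ℕ}, IsComb k D c → combRank k c < D.choose k := by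
      intro k
      induction k with
      | zero => intro D c _; simp [combRank]
      | succ k ih =>
        intro D c hc
        have h := ih (D := c k) (c := c) ⟨fun x hx => hc.lt_succ x (by omega), rfl⟩
        have h' : (c k).choose k + (c k).choose (k + 1) ≤ D.choose (k + 1) := by
          rw [← Nat.choose_succ_succ']
          exact Nat.choose_le_choose _ (by rw [← hc.last]; exact hc.lt_succ k (by omega))
        rw [combRank, Finset.sum_range_succ]
        rw [combRank] at h
        omega
    have := hlt k h₃
    omega

theorem IsComb.lt {k D : ℕ} {c : ℕ → ℕ} (h : IsComb k D c) {x y : ℕ} (hxy : x < y) (hy : y ≤ k) :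
    c x < c y := by
  induction y with
  | zero => omega
  | succ y ih =>
    have := h.lt_succ y (by omega)
    rcases Nat.lt_succ_iff_lt_or_eq.mp hxy with h' | rfl
    · exact (ih h' (by omega)).trans this
    · exact this

theorem IsComb.injOn {k D : ℕ} {c : ℕ → ℕ} (h : IsComb k D c) :
    Set.InjOn c (Finset.range k : Set ℕ) := by
  intro x hx y hy hxy
  simp only [Finset.coe_range, Set.mem_Iio] at hx hy
  rcases lt_trichotomy x y with h' | h' | h'
  · exact absurd hxy (h.lt h' hy.le).ne
  · exact h'
  · exact absurd hxy (h.lt h' hx.le).ne'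

theorem combRank_eq_of_image_eq {k D : ℕ} {c c' : ℕ → ℕ} (h : IsComb k D c) (h' : IsComb k D c')
    (hi : (Finset.range k).image c = (Finset.range k).image c') : combRank k c = combRank k c' := by
  have hcard : ((Finset.range k).image c).card = k := by
    rw [Finset.card_image_of_injOn h.injOn, Finset.card_range]
  have key : ∀ {c : ℕ → ℕ} (_ : IsComb k D c) {S : Finset ℕ} (hS : S.card = k)
      (_ : (Finset.range k).image c = S), (fun x : Fin k => c x) = S.orderEmbOfFin hS := by
    intro c h S hS hcS
    apply Finset.orderEmbOfFin_unique hS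
    · intro x; rw [← hcS]; exact Finset.mem_image_of_mem _ (Finset.mem_range.mpr x.2)
    · intro x y hxy; exact h.lt hxy y.2.le
  have h₁ := key h hcard rfl
  have h₂ := key h' hcard hi.symm
  refine Finset.sum_congr rfl fun x hx => ?_
  have := congrFun (h₁.trans h₂.symm) ⟨x, Finset.mem_range.mp hx⟩
  simp only at this
  rw [this]

/-- Every `k`-element subset is enumerated: the ranks are distinct, and there are as many of them as
subsets. -/
theorem exists_combSeq {k D : ℕ} (hkD : k ≤ D) {S : Finset ℕ} (hS : S ⊆ Finset.range D)
    (hc : S.card = k) : ∃ t < D.choose k, (Finset.range k).image (combSeq k D t) = S := by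
  have := Finset.surj_on_of_inj_on_of_card_le (s := Finset.range (D.choose k))
    (t := (Finset.range D).powersetCard k)
    (fun t _ => (Finset.range k).image (combSeq k D t)) ?_ ?_ (by simp) S
    (Finset.mem_powersetCard.mpr ⟨hS, hc⟩)
  · obtain ⟨t, ht, h⟩ := this
    exact ⟨t, Finset.mem_range.mp ht, h.symm⟩
  · intro t ht
    obtain ⟨h₁, -⟩ := combSeq_spec hkD t (Finset.mem_range.mp ht)
    refine Finset.mem_powersetCard.mpr ⟨?_, ?_⟩
    · intro y hy
      obtain ⟨x, hx, rfl⟩ := Finset.mem_image.mp hy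
      have := h₁.lt (Finset.mem_range.mp hx) le_rfl
      rw [h₁.last] at this
      exact Finset.mem_range.mpr this
    · rw [Finset.card_image_of_injOn h₁.injOn, Finset.card_range]
  · intro t t' ht ht' h
    obtain ⟨h₁, h₂⟩ := combSeq_spec hkD t (Finset.mem_range.mp ht)
    obtain ⟨h₃, h₄⟩ := combSeq_spec hkD t' (Finset.mem_range.mp ht')
    rw [← h₂, ← h₄]
    exact combRank_eq_of_image_eq h₁ h₃ h

/-! ### The variables and arrays of the algorithm -/

-- The names of variables begin with `r`, those of arrays with `a`.  The variables `rN, …, rBlocks`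
-- with numbers at most `9` hold parameters and are constant once they are computed.  The array
-- `aOut` with number `0` is the output array of the machine.
local notation "rN" => (0 : ℕ)
local notation "rK" => (1 : ℕ)
local notation "rL" => (2 : ℕ)
local notation "rBits" => (3 : ℕ)
local notation "rKeys" => (4 : ℕ)
local notation "rBatch" => (5 : ℕ)
local notation "rNumB" => (6 : ℕ)
local notation "rChunks" => (7 : ℕ)
local notation "rTrain" => (8 : ℕ)
local notation "rBlocks" => (9 : ℕ)
local notation "rTotal" => (10 : ℕ)
local notation "rJ" => (11 : ℕ)
local notation "rI" => (12 : ℕ)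
local notation "rB" => (13 : ℕ)
local notation "rU" => (14 : ℕ)
local notation "rLevel" => (15 : ℕ)
local notation "rX" => (16 : ℕ)
local notation "rWord" => (17 : ℕ)
local notation "rHit" => (18 : ℕ)
local notation "rC" => (19 : ℕ)
local notation "rT" => (20 : ℕ)
local notation "rQ" => (21 : ℕ)
local notation "rZero" => (22 : ℕ)
local notation "rOne" => (23 : ℕ)
local notation "rSupp" => (24 : ℕ)
local notation "rGo" => (25 : ℕ)
local notation "rRes" => (26 : ℕ)
local notation "rErr" => (27 : ℕ)
local notation "rAcc" => (28 : ℕ)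
local notation "rBase" => (29 : ℕ)
local notation "rKey" => (30 : ℕ)
local notation "rRun" => (31 : ℕ)

local notation "aOut" => (0 : ℕ)
local notation "aComb" => (1 : ℕ)
local notation "aPack" => (2 : ℕ)
local notation "aLab" => (3 : ℕ)
local notation "aPop" => (4 : ℕ)
local notation "aVec" => (5 : ℕ)
local notation "aAlive" => (6 : ℕ)
local notation "aTable" => (7 : ℕ)
local notation "aSupp" => (8 : ℕ)

/-- The parameters of the algorithm: the inputs `n` and `k`, and constants which depend on the noise
rate only. -/
structure Par where
  /-- the dimension -/
  n : ℕ
  /-- the sparsity -/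
  k : ℕ
  /-- there are `2 ^ (α * k)` batches -/
  α : ℕ
  /-- there are `κ * k` words of examples for the verification -/
  κ : ℕ
  /-- numerator of the admissible error rate in the verification -/
  num : ℕ
  /-- denominator of the admissible error rate in the verification -/
  den : ℕ

namespace Par
variable (P : Par)

-- The numbers and the time bounds that are computed from the parameters are irreducible, so that
-- unification and `omega` treat them as atoms.

/-- The length of a block of coordinates, which is also the number of levels of the elimination. -/
@[irreducible] def l : ℕ := Nat.log 2 P.k
/-- The number of verification examples that are packed into one word. -/
@[irreducible] def b : ℕ := Nat.log 2 P.n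
/-- The number of keys of one level of the elimination. -/
@[irreducible] def keys : ℕ := 2 ^ P.k
/-- The number of examples in a batch. -/
@[irreducible] def nb : ℕ := 2 ^ (2 * P.k)
/-- The number of batches. -/
@[irreducible] def nf : ℕ := 2 ^ (P.α * P.k)
/-- The number of words of verification examples. -/
@[irreducible] def kc : ℕ := P.κ * P.k
/-- The number of examples in all batches. -/
@[irreducible] def mB : ℕ := P.nf * P.nb
/-- The number of blocks; the last blocks lie beyond the coordinate `n - 1` and read as `0`. -/
@[irreducible] def D : ℕ := P.n / P.l + P.k

/-- The numbers that occur in the computation fit into a word. -/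
structure Fits (W : ℕ) : Prop where
  vec : (P.nb + 1) * (P.l + 2) < W
  coord : (P.D + 1) * (P.l + 1) < W
  total : P.mB + P.kc * P.b + 2 < W
  keys : 2 * P.keys + 2 < W
  pack : (P.n + 2) * (P.kc + 1) < W
  len : 2 * P.n + 4 < W
  supp : P.k * P.l + P.k + 2 < W
  err : (P.kc * P.b + 1) * (P.den + P.num + 1) < W
  exps : (P.α + P.κ + 2) * P.k + 4 < W
  consts : P.α + P.κ + P.num + P.den + 4 < W

end Par

/-- The variables that hold the parameters have the right values, and the bits of the examples are
bits. -/
structure Ctx (P : Par) (s : State) : Prop where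
  n : s.reg rN = P.n
  k : s.reg rK = P.k
  l : s.reg rL = P.l
  b : s.reg rBits = P.b
  keys : s.reg rKeys = P.keys
  nb : s.reg rBatch = P.nb
  nf : s.reg rNumB = P.nf
  kc : s.reg rChunks = P.kc
  mB : s.reg rTrain = P.mB
  D : s.reg rBlocks = P.D
  exX : ∀ i j, s.exX i j < 2
  exY : ∀ i, s.exY i < 2

/-- The parameters survive every command that changes only variables with numbers above `9`. -/
theorem Ctx.frame {P : Par} {s s' : State} {R L : List ℕ} (h : Ctx P s) (hf : Frame R L s s')
    (hR : ∀ r ∈ R, 9 < r := by decide) : Ctx P s' := by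
  have hr : ∀ r ≤ 9, s'.reg r = s.reg r := fun r hr => hf.reg r fun h' => by
    have := hR r h'; omega
  constructor
  · rw [hr _ (by norm_num), h.n]
  · rw [hr _ (by norm_num), h.k]
  · rw [hr _ (by norm_num), h.l]
  · rw [hr _ (by norm_num), h.b]
  · rw [hr _ (by norm_num), h.keys]
  · rw [hr _ (by norm_num), h.nb]
  · rw [hr _ (by norm_num), h.nf]
  · rw [hr _ (by norm_num), h.kc]
  · rw [hr _ (by norm_num), h.mB]
  · rw [hr _ (by norm_num), h.D]
  · rw [hf.exX]; exact h.exX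
  · rw [hf.exY]; exact h.exY

theorem mul_add_inj {d a a' x x' : ℕ} (hx : x < d) (hx' : x' < d) :
    a * d + x = a' * d + x' ↔ a = a' ∧ x = x' := by
  constructor
  · intro h
    have h₁ : a = a' := by
      have := congrArg (· / d) h
      simpa [Nat.div_eq_of_lt hx, Nat.div_eq_of_lt hx', Nat.add_comm,
        Nat.add_mul_div_right _ _ (by omega : 0 < d)] using this
    subst h₁
    exact ⟨rfl, by omega⟩
  · rintro ⟨rfl, rfl⟩; rfl

/-! ### One batch -/

/-- The word number `i` of the example `u` of a batch, with respect to the blocks `c`: its bits are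
the `i`-th coordinates of the blocks, except that the coordinate `q` is masked.  The word number `l`
holds the coordinate `q` and the label. -/
def batchWord (X : ℕ → ℕ → ℕ) (Y c : ℕ → ℕ) (k l q base u i : ℕ) : ℕ :=
  if i < l then
    packBits (fun j => if c j * l + i = q then 0 else X (base + u) (c j * l + i)) k
  else X (base + u) q + 2 * Y (base + u)

/-- The value `z + 2 * y` where `z` is the coordinate `q` and `y` is the label of the combination of
examples found in a batch. -/
def batchVal (X : ℕ → ℕ → ℕ) (Y c : ℕ → ℕ) (k l q N base : ℕ) : ℕ :=
  xorSum (batchWord X Y c k l q base · l) (relation (batchWord X Y c k l q base) l N)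

/-- Compute one word of an example of the batch. -/
def cWord : Cmd :=
  .seq (.assign rWord (.lit 0)) <|
  .for rX (.var rK) <|
    .assign rWord (.lit 2 * .var rWord +
      (.lit 1 - .bin .eq (.get aComb (.var rX) * .var rL + .var rLevel) (.var rQ)) *
        .bit (.var rBase + .var rU) (.get aComb (.var rX) * .var rL + .var rLevel))

/-- A bound for the running time of `cWord`.  Here and in the other bounds a summand `22` next to the
cost of a loop body is the overhead of one iteration (see `wp.forVar`). -/
@[irreducible] def Par.tWord (P : Par) : ℕ := P.k * 82 + 40

theorem lt_of_comb {P : Par} {c i : ℕ} (hc : c < P.D) (hi : i ≤ P.l) :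
    c * P.l + i < (P.D + 1) * (P.l + 1) := by
  have := Nat.mul_le_mul_right P.l hc.le
  nlinarith

theorem cWord_spec {W : ℕ} {P : Par} (hW : P.Fits W) {s : State} (hs : Ctx P s)
    (hc : ∀ j < P.k, s.arr aComb j < P.D) (hi : s.reg rLevel < P.l)
    (hu : s.reg rBase + s.reg rU < P.mB) :
    wp W cWord P.tWord
      (fun s' => s'.reg rWord = batchWord s.exX s.exY (s.arr aComb) P.k P.l (s.reg rQ)
        (s.reg rBase) (s.reg rU) (s.reg rLevel)) s := by
  have hf : ∀ j, (if s.arr aComb j * P.l + s.reg rLevel = s.reg rQ then 0 else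
    s.exX (s.reg rBase + s.reg rU) (s.arr aComb j * P.l + s.reg rLevel)) < 2 := fun j => by
      split_ifs
      · norm_num
      · exact hs.exX _ _
  have hK := hW.supp
  have hC := hW.coord
  have hT := hW.total
  have hKeys := hW.keys
  refine wp.seq (P.k * 82 + 22) (wp.assign le_rfl (by simp; omega) ?_)
    (by simp [Expr.cost, Par.tWord]; omega)
  refine wp.mono (wp.forVar (N := P.k) (τ' := 60) (fun m s' => s'.reg rWord =
    packBits (fun j => if s.arr aComb j * P.l + s.reg rLevel = s.reg rQ then 0 else
      s.exX (s.reg rBase + s.reg rU) (s.arr aComb j * P.l + s.reg rLevel)) m) le_rfl (by omega)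
      (by simp [hs.k]) (by simp [packBits]) ?_) le_rfl ?_
  · intro m hm s' hs' hx hI
    have e₁ := hs'.reg rL (by decide)
    have e₂ := hs'.reg rLevel (by decide)
    have e₃ := hs'.reg rQ (by decide)
    have e₄ := hs'.reg rBase (by decide)
    have e₅ := hs'.reg rU (by decide)
    have e₆ := hs'.arr aComb (by decide)
    have e₇ := hs'.exX
    simp only [State.put_reg, State.put_arr, State.put_exX] at e₁ e₂ e₃ e₄ e₅ e₆ e₇
    norm_num at e₁ e₂ e₃ e₄ e₅
    have h₁ := lt_of_comb (hc m hm) hi.le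
    have h₂ := packBits_lt hf m
    have h₃ : 2 ^ m ≤ P.keys := by
      rw [Par.keys]; exact Nat.pow_le_pow_right (by norm_num) hm.le
    have h₄ := hs.exX (s.reg rBase + s.reg rU) (s.arr aComb m * P.l + s.reg rLevel)
    have key : 2 * packBits (fun j => if s.arr aComb j * P.l + s.reg rLevel = s.reg rQ then 0 else
        s.exX (s.reg rBase + s.reg rU) (s.arr aComb j * P.l + s.reg rLevel)) m +
        (1 - if s.arr aComb m * P.l + s.reg rLevel = s.reg rQ then 1 else 0) *
        s.exX (s.reg rBase + s.reg rU) (s.arr aComb m * P.l + s.reg rLevel) =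
        packBits (fun j => if s.arr aComb j * P.l + s.reg rLevel = s.reg rQ then 0 else
        s.exX (s.reg rBase + s.reg rU) (s.arr aComb j * P.l + s.reg rLevel)) (m + 1) := by
      rw [packBits]
      split_ifs <;> simp
    refine wp.assign (by decide) ?_ ?_
    · simp only [Expr.ok_add, Expr.ok_mul, Expr.ok_sub, Expr.ok_lit, Expr.ok_var, Expr.ok_bin,
        Expr.ok_get, Expr.ok_bit, Expr.eval_add, Expr.eval_mul, Expr.eval_sub, Expr.eval_lit,
        Expr.eval_var, Expr.eval_bin, Expr.eval_get, Expr.eval_bit, WordOp.eval, e₁, e₂, e₃, e₄, e₅,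
        e₆, e₇, hx, hI, hs.l, true_and]
      rw [key]
      have h₅ := packBits_lt hf (m + 1)
      rw [pow_succ] at h₅
      have h₆ : (1 - if s.arr aComb m * P.l + s.reg rLevel = s.reg rQ then 1 else 0) *
        s.exX (s.reg rBase + s.reg rU) (s.arr aComb m * P.l + s.reg rLevel) < 2 := by
        split_ifs <;> simp [h₄]
      have h₇ : (if s.arr aComb m * P.l + s.reg rLevel = s.reg rQ then 1 else 0) ≤ 1 := by
        split_ifs <;> simp
      refine ⟨⟨?_, ?_⟩, ⟨⟨?_, ⟨⟨?_, ?_⟩, ?_⟩, ?_⟩, ⟨?_, ?_, ?_⟩, ?_⟩, ?_⟩ <;> omega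
    · simp only [Expr.eval_add, Expr.eval_mul, Expr.eval_sub, Expr.eval_lit,
        Expr.eval_var, Expr.eval_bin, Expr.eval_get, Expr.eval_bit, WordOp.eval, e₁, e₂, e₃, e₄, e₅,
        e₆, e₇, hx, hI, hs.l]
      rw [← key]
      simp
  · intro s' _ h
    rw [h, batchWord, if_pos hi]

theorem State.sto_arr_row {s : State} {A d a a' x x' v : ℕ} (hx : x < d) (hx' : x' < d) :
    (s.sto A (a * d + x) v).arr A (a' * d + x') =
      if a' = a ∧ x' = x then v else s.arr A (a' * d + x') := by
  simp only [State.sto_arr, mul_add_inj hx' hx, true_and]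

theorem row_lt {d a x N : ℕ} (ha : a < N) (hx : x < d) : a * d + x < N * d := by
  have := Nat.mul_le_mul_right d (Nat.succ_le_of_lt ha)
  rw [Nat.succ_mul] at this
  omega

/-- Read the examples of the batch and compute their words. -/
def cFill : Cmd :=
  .for rU (.var rBatch) <|
    .seq (.for rLevel (.var rL) <|
      .seq cWord (.store aVec (.var rU * (.var rL + .lit 1) + .var rLevel) (.var rWord))) <|
    .seq (.store aVec (.var rU * (.var rL + .lit 1) + .var rL)
      (.bit (.var rBase + .var rU) (.var rQ) + .lit 2 * .lab (.var rBase + .var rU)))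
    (.store aAlive (.var rU) (.lit 1))

/-- A bound for the running time of `cFill`. -/
@[irreducible] def Par.tFill (P : Par) : ℕ :=
  P.nb * (P.l * (P.tWord + 40 + 22) + 22 + 60 + 22) + 22

theorem Par.Fits.row {W : ℕ} {P : Par} (hW : P.Fits W) {u x : ℕ} (hu : u < P.nb) (hx : x ≤ P.l) :
    u * (P.l + 1) + x < W := by
  have := hW.vec
  have := row_lt hu (Nat.lt_succ_of_le hx)
  nlinarith

theorem Par.Fits.nb_add {W : ℕ} {P : Par} (hW : P.Fits W) : P.nb + P.l + 2 < W := by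
  have := hW.vec
  nlinarith

theorem cFill_words {W : ℕ} {P : Par} (hW : P.Fits W) {s : State} (hs : Ctx P s)
    (hc : ∀ j < P.k, s.arr aComb j < P.D) (hbase : s.reg rBase + P.nb ≤ P.mB)
    (hu : s.reg rU < P.nb) :
    wp W (.for rLevel (.var rL) <|
      .seq cWord (.store aVec (.var rU * (.var rL + .lit 1) + .var rLevel) (.var rWord)))
      (P.l * (P.tWord + 40 + 22) + 22) (fun s' =>
        (∀ i < P.l, s'.arr aVec (s.reg rU * (P.l + 1) + i) = batchWord s.exX s.exY (s.arr aComb)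
          P.k P.l (s.reg rQ) (s.reg rBase) (s.reg rU) i) ∧
        ∀ u < s.reg rU, ∀ i ≤ P.l, s'.arr aVec (u * (P.l + 1) + i) =
          s.arr aVec (u * (P.l + 1) + i)) s := by
  have hT := hW.total
  have hV' := hW.nb_add
  set w := batchWord s.exX s.exY (s.arr aComb) P.k P.l (s.reg rQ) (s.reg rBase) with hw
  refine wp.mono (wp.forVar (N := P.l) (τ' := P.tWord + 40)
      (fun i s' => (∀ i' < i, s'.arr aVec (s.reg rU * (P.l + 1) + i') = w (s.reg rU) i') ∧
        ∀ u < s.reg rU, ∀ i ≤ P.l, s'.arr aVec (u * (P.l + 1) + i) =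
          s.arr aVec (u * (P.l + 1) + i)) le_rfl (by omega) hs.l (by simp) ?_) le_rfl
          (fun _ _ h => h)
  intro i hi s' hs' hxi hJ
  have c' := hs.frame hs'
  have eu := hs'.reg rU (by decide)
  have ec := hs'.arr aComb (by decide)
  refine wp.seq 30 ((cWord_spec hW c' (by rw [ec]; exact hc) (by rw [hxi]; exact hi)
    (by rw [eu, hs'.reg rBase (by decide)]; omega)).mono le_rfl fun s₂ f₂ h₂ => ?_) (by omega)
  rw [ec, hs'.exX, hs'.exY, hs'.reg rQ (by decide), hs'.reg rBase (by decide), eu, hxi, ← hw] at h₂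
  have eu' := (f₂.reg rU (by decide)).trans eu
  have ei' := (f₂.reg rLevel (by decide)).trans hxi
  have el' := (c'.frame f₂).l
  have ea' := f₂.arr aVec (by decide)
  have hmi := hW.row hu hi.le
  have hm0 := hW.row hu le_rfl
  refine wp.store (by decide) ?_ (by simp) ?_
  · simp [eu', ei', el']; omega
  · simp only [Expr.eval_add, Expr.eval_mul, Expr.eval_var, Expr.eval_lit, eu', ei', el', h₂,
      State.put_arr]
    refine ⟨fun i' hi' => ?_, fun u hu' i' hi' => ?_⟩
    · rw [State.sto_arr_row (by omega) (by omega)]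
      split_ifs with h
      · rw [h.2]
      · rw [ea']; exact hJ.1 i' (by omega)
    · rw [State.sto_arr_row (by omega) (by omega), if_neg (by omega), ea']
      exact hJ.2 u hu' i' hi'

/-- The batch is read into the rows of `aVec`, and all its vectors are alive. -/
theorem cFill_spec {W : ℕ} {P : Par} (hW : P.Fits W) {s : State} (hs : Ctx P s)
    (hc : ∀ j < P.k, s.arr aComb j < P.D) (hbase : s.reg rBase + P.nb ≤ P.mB) :
    wp W cFill P.tFill (fun s' => ∀ u < P.nb, (∀ i ≤ P.l, s'.arr aVec (u * (P.l + 1) + i) =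
      batchWord s.exX s.exY (s.arr aComb) P.k P.l (s.reg rQ) (s.reg rBase) u i) ∧
      s'.arr aAlive u = 1) s := by
  have hT := hW.total
  have hV' := hW.nb_add
  set w := batchWord s.exX s.exY (s.arr aComb) P.k P.l (s.reg rQ) (s.reg rBase) with hw
  refine wp.mono (wp.forVar (N := P.nb) (τ' := P.l * (P.tWord + 40 + 22) + 22 + 60)
    (fun m s' => ∀ u < m, (∀ i ≤ P.l, s'.arr aVec (u * (P.l + 1) + i) = w u i) ∧
      s'.arr aAlive u = 1) le_rfl (by omega) hs.nb (by simp) ?_) (by rw [Par.tFill])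
      (fun _ _ h => h)
  intro m hm s' hs' hx hI
  have c' := hs.frame hs'
  have eb := hs'.reg rBase (by decide)
  have eq := hs'.reg rQ (by decide)
  have ec := hs'.arr aComb (by decide)
  refine wp.seq 50 ((cFill_words hW c' (by rw [ec]; exact hc) (by rw [eb]; exact hbase)
    (by rw [hx]; exact hm)).mono le_rfl fun s₁ f₁ h₁ => ?_) (by omega)
  rw [ec, hs'.exX, hs'.exY, eq, eb, hx, ← hw] at h₁
  have c₁ := c'.frame f₁
  have eu := (f₁.reg rU (by decide)).trans hx
  have eb := (f₁.reg rBase (by decide)).trans eb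
  have eq := (f₁.reg rQ (by decide)).trans eq
  have ex := f₁.exX.trans hs'.exX
  have ey := f₁.exY.trans hs'.exY
  have ea := f₁.arr aAlive (by decide)
  have hm0 := hW.row hm le_rfl
  have b₁ := hs.exX (s.reg rBase + m) (s.reg rQ)
  have b₂ := hs.exY (s.reg rBase + m)
  refine wp.seq 10 (wp.store le_rfl ?_ ?_ (wp.store (by decide) ?_ ?_ ?_)) (by decide)
  · simp [eu, c₁.l]; omega
  · simp [eu, eb, eq, ex, ey]; omega
  · simp
  · simp; omega
  · simp only [Expr.eval_add, Expr.eval_mul, Expr.eval_var, Expr.eval_lit, Expr.eval_bit,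
      Expr.eval_lab, State.sto_reg, eu, eb, eq, ex, ey, c₁.l, State.put_arr]
    intro u hu
    refine ⟨fun i hi => ?_, ?_⟩
    · rw [State.sto_arr, if_neg (by simp), State.sto_arr_row (by omega) (by omega)]
      split_ifs with h
      · rw [h.1, h.2, hw, batchWord, if_neg (lt_irrefl _)]
      · rcases Nat.lt_succ_iff_lt_or_eq.mp hu with hu | rfl
        · rw [h₁.2 u hu i hi]; exact (hI u hu).1 i hi
        · exact h₁.1 i (by omega)
    · rw [State.sto_arr]
      split_ifs with h
      · rfl
      · rw [State.sto_arr, if_neg (by simp), ea]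
        exact (hI u (by omega)).2

/-- Add the vector in the place `hit - 1` to the vector in the place `u`. -/
def cXor : Cmd :=
  .for rX (.var rL + .lit 1) <|
    .store aVec (.var rU * (.var rL + .lit 1) + .var rX)
      (.bin .xor (.get aVec (.var rU * (.var rL + .lit 1) + .var rX))
        (.get aVec ((.var rHit - .lit 1) * (.var rL + .lit 1) + .var rX)))

theorem cXor_spec {W : ℕ} {P : Par} (hW : P.Fits W) {s : State} (hs : Ctx P s)
    (hu : s.reg rU < P.nb) (hh : s.reg rHit - 1 < P.nb)
    (hb : ∀ x ≤ P.l, s.arr aVec (s.reg rU * (P.l + 1) + x) < P.keys)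
    (hb' : ∀ x ≤ P.l, s.arr aVec ((s.reg rHit - 1) * (P.l + 1) + x) < P.keys) :
    wp W cXor ((P.l + 1) * (60 + 30) + 30) (fun s' => ∀ f < P.nb, ∀ x ≤ P.l,
      s'.arr aVec (f * (P.l + 1) + x) = if f = s.reg rU then
        s.arr aVec (f * (P.l + 1) + x) ^^^ s.arr aVec ((s.reg rHit - 1) * (P.l + 1) + x)
      else s.arr aVec (f * (P.l + 1) + x)) s := by
  have hV' := hW.nb_add
  refine wp.mono (wp.for (N := P.l + 1) (τ' := 60) (fun m s' => ∀ f < P.nb, ∀ x ≤ P.l,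
      s'.arr aVec (f * (P.l + 1) + x) = if f = s.reg rU ∧ x < m then
        s.arr aVec (f * (P.l + 1) + x) ^^^ s.arr aVec ((s.reg rHit - 1) * (P.l + 1) + x)
      else s.arr aVec (f * (P.l + 1) + x)) le_rfl (by omega) ?_ (by decide) (by simp) ?_)
      le_rfl ?_
  · intro s' hs'
    have := (hs.frame hs').l
    simp [this]; omega
  · intro m hm s' hs' hx hI
    have c' := hs.frame hs'
    have eu := hs'.reg rU (by decide)
    have eh := hs'.reg rHit (by decide)
    have r₁ := hW.row hu (Nat.le_of_lt_succ hm)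
    have r₂ := hW.row hh (Nat.le_of_lt_succ hm)
    have h₁ := hI _ hu m (by omega)
    have h₂ := hI _ hh m (by omega)
    rw [if_neg (by omega)] at h₁
    rw [if_neg (by omega)] at h₂
    have hk := hW.keys
    have r₃ : s.reg rU * (P.l + 1) ≤ s.reg rU * (P.l + 1) + m := Nat.le_add_right _ _
    have r₄ : (s.reg rHit - 1) * (P.l + 1) ≤ (s.reg rHit - 1) * (P.l + 1) + m :=
      Nat.le_add_right _ _
    have hxor : s.arr aVec (s.reg rU * (P.l + 1) + m) ^^^
        s.arr aVec ((s.reg rHit - 1) * (P.l + 1) + m) < P.keys := by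
      have b₁ := hb m (by omega)
      have b₂ := hb' m (by omega)
      rw [Par.keys] at b₁ b₂ ⊢
      exact Nat.xor_lt_two_pow b₁ b₂
    refine wp.store (by decide) ?_ ?_ ?_
    · simp [eu, hx, c'.l]; omega
    · simp [eu, hx, c'.l, eh, h₁, h₂, WordOp.eval]; omega
    · simp only [Expr.eval_add, Expr.eval_mul, Expr.eval_var, Expr.eval_lit, Expr.eval_bin,
        Expr.eval_get, Expr.eval_sub, WordOp.eval, eu, eh, hx, c'.l, h₁, h₂, State.put_arr]
      intro f hf x hxl
      rw [State.sto_arr_row (by omega) (by omega), hI f hf x hxl]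
      by_cases hfu : f = s.reg rU
      · subst hfu
        rcases lt_trichotomy x m with h | rfl | h
        · simp [h, h.ne, h.trans (Nat.lt_succ_self m)]
        · simp
        · simp [h.ne', not_lt.mpr h.le, not_lt.mpr (Nat.succ_le_of_lt h)]
      · simp [hfu]
  · intro s' _ h f hf x hx
    rw [h f hf x hx]
    by_cases hfu : f = s.reg rU
    · rw [if_pos ⟨hfu, by omega⟩, if_pos hfu]
    · rw [if_neg (by tauto), if_neg hfu]

/-- Process one vector at one level of the elimination. -/
def cPlace : Cmd :=
  .ite (.get aAlive (.var rU))
    (.seq (.assign rKey (.get aVec (.var rU * (.var rL + .lit 1) + .var rLevel))) <|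
      .seq (.assign rHit (.get aTable (.var rKey))) <|
      .ite (.var rHit) cXor
        (.seq (.store aTable (.var rKey) (.var rU + .lit 1)) (.store aAlive (.var rU) (.lit 0))))
    (.assign rHit (.lit 0))

/-- The contents of the arrays after `m` vectors have been processed at level `i`. -/
structure LevelInv (P : Par) (w : ℕ → ℕ → ℕ) (i m : ℕ) (s : State) : Prop where
  vec : ∀ f < P.nb, ∀ x ≤ P.l, elim w i f ≠ [] → s.arr aVec (f * (P.l + 1) + x) =
    xorSum (w · x) (if f < m ∧ elim w (i + 1) f ≠ [] then elim w (i + 1) f else elim w i f)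
  alive : ∀ f < P.nb, s.arr aAlive f =
    if (if f < m then elim w (i + 1) f else elim w i f) = [] then 0 else 1
  table : ∀ x < P.keys, s.arr aTable x = elimHit w i m x

/-- A bound for the running time of `cPlace`. -/
@[irreducible] def Par.tPlace (P : Par) : ℕ := (P.l + 1) * (60 + 30) + 30 + 100

/-- One vector is processed as in the recursion for `elim`: it is dropped, is entered into the
table and dropped, or is added to. -/
theorem cPlace_spec {W : ℕ} {P : Par} (hW : P.Fits W) {s : State} (hs : Ctx P s)
    {w : ℕ → ℕ → ℕ} {i m : ℕ} (hw : ∀ u, ∀ i ≤ P.l, w u i < P.keys)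
    (hi : i < P.l) (hm : m < P.nb) (hu : s.reg rU = m) (hl : s.reg rLevel = i)
    (hI : LevelInv P w i m s) :
    wp W cPlace P.tPlace (LevelInv P w i (m + 1)) s := by
  have hV' := hW.nb_add
  have hk := hW.keys
  have hwx : ∀ x ≤ P.l, ∀ L, xorSum (w · x) L < P.keys := fun x hx L => by
    have := fun u => hw u x hx
    rw [Par.keys] at this ⊢
    exact xorSum_lt this L
  have hmi := hW.row hm hi.le
  have hal := hI.alive m hm
  rw [if_neg (lt_irrefl m)] at hal
  rw [Par.tPlace]
  refine wp.ite (τ' := (P.l + 1) * (60 + 30) + 30 + 80) (by simp [Expr.cost]; omega)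
    (by simp) ?_ ?_
  · intro h0
    have hne : elim w i m ≠ [] := by
      intro h; simp [hu, hal, h] at h0
    have hkey := hI.vec m hm i hi.le hne
    rw [if_neg (by omega)] at hkey
    change _ = elimKey w i m at hkey
    have hkl : elimKey w i m < P.keys := hwx i hi.le _
    refine wp.seq ((P.l + 1) * (60 + 30) + 30 + 60) (wp.assign (τ := 18) (by decide) ?_ ?_)
      (by omega)
    · simp [hu, hl, hs.l]; omega
    refine wp.seq ((P.l + 1) * (60 + 30) + 30 + 30) (wp.assign (τ := 10) (by decide) (by simp) ?_)
      (by omega)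
    have hkv : (Expr.get aVec (.var rU * (.var rL + .lit 1) + .var rLevel)).eval s =
        elimKey w i m := by
      simp [hu, hl, hs.l, hkey]
    rw [hkv]
    simp only [Expr.eval_get, Expr.eval_var, State.put_reg, State.put_arr, if_true,
      hI.table _ hkl]
    refine wp.ite (τ' := (P.l + 1) * (60 + 30) + 30 + 20) (by simp [Expr.cost]; omega)
      (by simp) ?_ ?_
    · intro h1
      simp only [Expr.eval_var, State.put_reg, if_true] at h1
      obtain ⟨g₁, g₂, g₃⟩ := elimHit_spec h1
      have g₄ := elim_succ_eq_nil_of_hit h1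
      set f₀ := elimHit w i m (elimKey w i m) - 1 with hf₀
      have hv₀ : ∀ x ≤ P.l, s.arr aVec (f₀ * (P.l + 1) + x) = xorSum (w · x) (elim w i f₀) := by
        intro x hx
        rw [hI.vec f₀ (by omega) x hx g₂, if_neg (by tauto)]
      have hv₁ : ∀ x ≤ P.l, s.arr aVec (m * (P.l + 1) + x) = xorSum (w · x) (elim w i m) := by
        intro x hx
        rw [hI.vec m (by omega) x hx hne, if_neg (by omega)]
      have hsucc : elim w (i + 1) m = elim w i f₀ ++ elim w i m := by
        rw [elim_succ, if_neg (by tauto)]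
      refine (cXor_spec hW (s := (s.put rKey (elimKey w i m)).put rHit
        (elimHit w i m (elimKey w i m))) ?_ (by simp [hu, hm]) (by simp; omega)
        (by simpa [hu] using fun x hx => (hv₁ x hx).trans_lt (hwx x hx _))
        (by simpa using fun x hx => (hv₀ x hx).trans_lt (hwx x hx _))).mono (by omega) ?_
      · constructor <;> simp [hs.n, hs.k, hs.l, hs.b, hs.keys, hs.nb, hs.nf, hs.kc, hs.mB, hs.D,
          hs.exX, hs.exY]
      intro s' hs' h
      simp only [State.put_reg, State.put_arr] at h
      norm_num [hu] at h
      refine ⟨fun f hf x hx hfne => ?_, fun f hf => ?_, fun x hx => ?_⟩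
      · rw [h f hf x hx]
        split_ifs with e₁ e₂ e₂
        · subst e₁
          rw [hv₁ x hx, hsucc, xorSum_append, ← hv₀ x hx, Nat.xor_comm, hv₀ x hx]
        · subst e₁
          refine absurd ⟨Nat.lt_succ_self f, ?_⟩ e₂
          rw [hsucc]; simp [hne]
        · rw [hI.vec f hf x hx hfne, if_pos ⟨by omega, e₂.2⟩]
        · rw [hI.vec f hf x hx hfne, if_neg (fun h' => e₂ ⟨by omega, h'.2⟩)]
      · rw [hs'.arr aAlive (by decide)]
        simp only [State.put_arr]
        rcases lt_trichotomy f m with h' | rfl | h'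
        · rw [hI.alive f hf, if_pos h', if_pos (show f < m + 1 by omega)]
        · rw [hal, if_neg hne, if_pos (Nat.lt_succ_self f), hsucc, if_neg (by simp [hne])]
        · rw [hI.alive f hf, if_neg (show ¬f < m by omega), if_neg (show ¬f < m + 1 by omega)]
      · rw [hs'.arr aTable (by decide)]
        simp only [State.put_arr]
        rw [hI.table x hx, elimHit_succ', if_neg (by tauto)]
    · intro h1
      simp only [Expr.eval_var, State.put_reg, if_true] at h1
      have hsucc : elim w (i + 1) m = [] := by rw [elim_succ, if_pos (Or.inr h1)]
      refine (wp.seq 8 (wp.store (τ := 20) (by decide) (by simp)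
        (by simp [hu]; omega) (wp.store (by decide) (by simp) (by simp; omega) ?_))
        (τ := 40) (by decide)).mono (by omega) fun s' _ h => h
      simp only [Expr.eval_add, Expr.eval_var, Expr.eval_lit, State.put_reg, State.sto_reg]
      norm_num [hu]
      refine ⟨fun f hf x hx hfne => ?_, fun f hf => ?_, fun x hx => ?_⟩
      · simp only [State.sto_arr, State.put_arr]
        norm_num
        rw [hI.vec f hf x hx hfne]
        by_cases e₁ : f = m
        · subst e₁; simp [hsucc]
        · simp [show f ≤ m ↔ f < m by omega]
      · simp only [State.sto_arr, State.put_arr]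
        norm_num
        by_cases e₁ : f = m
        · subst e₁; simp [hsucc]
        · rw [if_neg e₁, hI.alive f hf]; simp only [show f ≤ m ↔ f < m by omega]
      · simp only [State.sto_arr, State.put_arr]
        norm_num
        rw [hI.table x hx, elimHit_succ']
        by_cases e₁ : x = elimKey w i m
        · simp [e₁, hne, h1]
        · simp [e₁]
  · intro h0
    have hnil : elim w i m = [] := by
      by_contra h; simp [hu, hal, h] at h0
    have hsucc : elim w (i + 1) m = [] := by rw [elim_succ, if_pos (Or.inl hnil)]
    refine wp.assign (by simp [Expr.cost]) (by simp; omega) ⟨fun f hf x hx hfne => ?_,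
      fun f hf => ?_, fun x hx => ?_⟩
    · have e₁ : f ≠ m := by rintro rfl; exact hfne hnil
      rw [State.put_arr, hI.vec f hf x hx hfne]
      simp [show f < m + 1 ↔ f < m by omega]
    · rw [State.put_arr, hI.alive f hf]
      by_cases e₁ : f = m
      · subst e₁; simp [hsucc, hnil]
      · simp [show f < m + 1 ↔ f < m by omega]
    · rw [State.put_arr, hI.table x hx, elimHit_succ', if_neg (by tauto)]

/-- Clear the table. -/
def cClear : Cmd := .for rX (.var rKeys) (.store aTable (.var rX) (.lit 0))

/-- Eliminate all words of a batch, level by level. -/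
def cElim : Cmd :=
  .for rLevel (.var rL) (.seq cClear (.for rU (.var rBatch) cPlace))

/-- A bound for the running time of `cElim`. -/
@[irreducible] def Par.tElim (P : Par) : ℕ :=
  P.l * ((P.keys * (5 + 22) + 22) + (P.nb * (P.tPlace + 22) + 22) + 1 + 22) + 22

/-- The contents of the arrays between two levels of the elimination. -/
structure StageInv (P : Par) (w : ℕ → ℕ → ℕ) (i : ℕ) (s : State) : Prop where
  vec : ∀ f < P.nb, ∀ x ≤ P.l, elim w i f ≠ [] → s.arr aVec (f * (P.l + 1) + x) =
    xorSum (w · x) (elim w i f)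
  alive : ∀ f < P.nb, s.arr aAlive f = if elim w i f = [] then 0 else 1

theorem cClear_spec {W : ℕ} {P : Par} (hW : P.Fits W) {s : State} (hs : Ctx P s) :
    wp W cClear (P.keys * (5 + 22) + 22) (fun s' => ∀ x < P.keys, s'.arr aTable x = 0) s := by
  have hk := hW.keys
  refine wp.forVar (N := P.keys) (fun m s' => ∀ x < m, s'.arr aTable x = 0) le_rfl (by omega)
    hs.keys (by simp) ?_
  intro m hm s' hs' hx hI
  refine wp.store le_rfl (by simp) (by simp; omega) ?_
  intro x hx'
  simp only [State.put_arr, State.sto_arr, Expr.eval_var, Expr.eval_lit, hx, true_and]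
  split_ifs with h
  · rfl
  · exact hI x (by omega)

/-- The rows of the vectors that are alive hold the combinations that `elim` describes. -/
theorem cElim_spec {W : ℕ} {P : Par} (hW : P.Fits W) {s : State} (hs : Ctx P s)
    {w : ℕ → ℕ → ℕ} (hw : ∀ u, ∀ i ≤ P.l, w u i < P.keys) (h : StageInv P w 0 s) :
    wp W cElim P.tElim (StageInv P w P.l) s := by
  have hV' := hW.nb_add
  rw [Par.tElim]
  refine wp.forVar (N := P.l) (fun i s' => StageInv P w i s') le_rfl (by omega) hs.l
    ⟨h.vec, h.alive⟩ ?_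
  intro i hi s' hs' hx hI
  have c' := hs.frame hs'
  refine wp.seq _ ((cClear_spec hW c').mono le_rfl fun s₁ f₁ h₁ => ?_) le_rfl
  have c₁ := c'.frame f₁
  have el := (f₁.reg rLevel (by decide)).trans hx
  refine (wp.forVar (N := P.nb) (τ' := P.tPlace) (fun m s' => LevelInv P w i m s') le_rfl
    (by omega) c₁.nb ⟨fun f hf x hx hne => ?_, fun f hf => ?_, fun x hx => ?_⟩ ?_).mono le_rfl ?_
  · rw [if_neg (by omega), State.put_arr, f₁.arr aVec (by decide)]; exact hI.vec f hf x hx hne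
  · rw [if_neg (show ¬f < 0 by omega), State.put_arr, f₁.arr aAlive (by decide)]
    exact hI.alive f hf
  · rw [State.put_arr, h₁ x hx]; rfl
  · intro m hm s₂ f₂ hu h₂
    refine (cPlace_spec hW (c₁.frame f₂) hw hi hm hu ((f₂.reg rLevel (by decide)).trans el)
      h₂).mono le_rfl fun s₃ _ h₃ => ⟨h₃.vec, h₃.alive, h₃.table⟩
  · intro s₂ _ h₂
    refine ⟨fun f hf x hx hne => ?_, fun f hf => ?_⟩
    · rw [State.put_arr, h₂.vec f hf x hx (elim_ne_nil_of_succ hne).1, if_pos ⟨hf, hne⟩]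
    · rw [State.put_arr, h₂.alive f hf, if_pos hf]

/-- Pick the last surviving vector. -/
def cPick : Cmd :=
  .seq (.assign rRes (.lit 0)) <|
  .for rU (.var rBatch) <|
    .ite (.get aAlive (.var rU))
      (.assign rRes (.get aVec (.var rU * (.var rL + .lit 1) + .var rL)))
      (.assign rX (.lit 0))

/-- The last row that is alive holds the combination `relation`; its word number `l` is read off. -/
theorem cPick_spec {W : ℕ} {P : Par} (hW : P.Fits W) {s : State} (hs : Ctx P s)
    {w : ℕ → ℕ → ℕ} (h : StageInv P w P.l s) :
    wp W cPick (P.nb * (40 + 22) + 22 + 4) (fun s' => s'.reg rRes =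
      xorSum (w · P.l) (relation w P.l P.nb)) s := by
  have hV' := hW.nb_add
  refine wp.seq (P.nb * (40 + 22) + 22) (wp.assign (τ := 3) le_rfl (by simp; omega) ?_) (by omega)
  refine wp.forVar (N := P.nb) (τ' := 40) (fun m s' => s'.reg rRes =
      xorSum (w · P.l) (lastList (elim w P.l) m)) le_rfl (by omega) (by simp [hs.nb])
      (by simp [lastList]) ?_
  intro m hm s' hs' hx hI
  have ea : s'.arr aAlive = s.arr aAlive := hs'.arr aAlive (by decide)
  have ev : s'.arr aVec = s.arr aVec := hs'.arr aVec (by decide)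
  have el := (hs'.reg rL (by decide)).trans (State.put_reg _ _ _ _)
  rw [if_neg (by norm_num), hs.l] at el
  have hr := hW.row hm le_rfl
  have hal := h.alive m hm
  refine wp.ite (τ' := 30) (by decide) (by simp) ?_ ?_
  · intro h0
    have hne : elim w P.l m ≠ [] := by
      intro h'; simp [hx, ea, hal, h'] at h0
    refine wp.assign (by decide) (by simp [hx, el]; omega) ?_
    simp only [State.put_reg]
    norm_num
    rw [lastList, if_pos hne, hx, el, ev, h.vec m hm P.l le_rfl hne]
  · intro h0
    have hnil : elim w P.l m = [] := by
      by_contra h'; simp [hx, ea, hal, h'] at h0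
    refine wp.assign (by decide) (by simp; omega) ?_
    simp only [State.put_reg]
    norm_num
    rw [lastList, if_neg (by simp [hnil]), hI]

/-- Process the batch with number `rB`. -/
def cBatch : Cmd :=
  .seq (.assign rBase (.var rB * .var rBatch)) <| .seq cFill <| .seq cElim cPick

/-- A bound for the running time of `cBatch`. -/
@[irreducible] def Par.tBatch (P : Par) : ℕ :=
  7 + (P.tFill + (P.tElim + (P.nb * (40 + 22) + 22 + 4) + 1) + 1) + 1

theorem batchWord_lt {P : Par} {X : ℕ → ℕ → ℕ} {Y : ℕ → ℕ} (hX : ∀ i j, X i j < 2)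
    (hY : ∀ i, Y i < 2) (hk : 2 ≤ P.k) (c : ℕ → ℕ) (q base u i : ℕ) :
    batchWord X Y c P.k P.l q base u i < P.keys := by
  rw [batchWord, Par.keys]
  split_ifs
  · refine packBits_lt (fun j => ?_) _
    split_ifs
    · norm_num
    · exact hX _ _
  · have h₁ := hX (base + u) q
    have h₂ := hY (base + u)
    have : 2 ^ 2 ≤ 2 ^ P.k := Nat.pow_le_pow_right (by norm_num) hk
    omega

theorem cBatch_spec {W : ℕ} {P : Par} (hW : P.Fits W) (hk : 2 ≤ P.k) {s : State} (hs : Ctx P s)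
    (hc : ∀ j < P.k, s.arr aComb j < P.D) (hB : s.reg rB < P.nf) :
    wp W cBatch P.tBatch (fun s' => s'.reg rRes = batchVal s.exX s.exY (s.arr aComb) P.k P.l
      (s.reg rQ) P.nb (s.reg rB * P.nb)) s := by
  have hT := hW.total
  have hbase : s.reg rB * P.nb + P.nb ≤ P.mB := by
    rw [Par.mB, ← Nat.succ_mul]; exact Nat.mul_le_mul_right _ hB
  rw [Par.tBatch]
  refine wp.seq _ (wp.assign (τ := 7) le_rfl (by simp [hs.nb]; omega) ?_) le_rfl
  simp only [Expr.eval_mul, Expr.eval_var, hs.nb]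
  set s₁ := s.put rBase (s.reg rB * P.nb) with hs₁
  have f₁ : Frame [rBase] [] s s₁ := (Frame.refl _ _ _).put _ (by simp)
  have c₁ := hs.frame f₁
  have eb : s₁.reg rBase = s.reg rB * P.nb := by simp [s₁]
  refine wp.seq _ ((cFill_spec hW c₁ hc (by rw [eb]; exact hbase)).mono le_rfl
    fun s₂ f₂ h₂ => ?_) le_rfl
  have c₂ := c₁.frame f₂
  set w := batchWord s₁.exX s₁.exY (s₁.arr aComb) P.k P.l (s₁.reg rQ) (s₁.reg rBase) with hw
  have hlt : ∀ u, ∀ i ≤ P.l, w u i < P.keys :=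
    fun u i _ => batchWord_lt c₁.exX c₁.exY hk _ _ _ _ _
  refine wp.seq _ ((cElim_spec hW c₂ hlt ⟨fun f hf x hx _ => ?_, fun f hf => ?_⟩).mono le_rfl
    fun s₃ f₃ h₃ => ?_) le_rfl
  · rw [(h₂ f hf).1 x hx]; simp [elim]
  · rw [(h₂ f hf).2]; simp [elim]
  · refine (cPick_spec hW (c₂.frame f₃) h₃).mono le_rfl fun s₄ _ h₄ => ?_
    rw [h₄, hw, eb]; rfl

/-- Count the batches in which the label of the combination is `0`, respectively `1`, among those in
which its coordinate `q` is `1`. -/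
def cScore : Cmd :=
  .seq (.assign rZero (.lit 0)) <| .seq (.assign rOne (.lit 0)) <|
  .for rB (.var rNumB) <| .seq cBatch <|
    .ite (.bin .eq (.var rRes) (.lit 1)) (.assign rZero (.var rZero + .lit 1)) <|
    .ite (.bin .eq (.var rRes) (.lit 3)) (.assign rOne (.var rOne + .lit 1)) <|
    .assign rX (.lit 0)

/-- A bound for the running time of `cScore`. -/
@[irreducible] def Par.tScore (P : Par) : ℕ := P.nf * (P.tBatch + 40 + 22) + 22 + 8

/-- The number of batches in which the combination has the value `v`. -/
def batchCount (P : Par) (X : ℕ → ℕ → ℕ) (Y c : ℕ → ℕ) (q v m : ℕ) : ℕ :=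
  Nat.count (fun B => batchVal X Y c P.k P.l q P.nb (B * P.nb) = v) m

theorem Par.nf_le_mB (P : Par) : P.nf ≤ P.mB := by
  rw [Par.mB]; exact Nat.le_mul_of_pos_right _ (by rw [Par.nb]; positivity)

/-- The values `1 = 1 + 2 * 0` and `3 = 1 + 2 * 1` stand for the coordinate one together with the
label zero, respectively one; batches with the coordinate zero abstain. -/
theorem cScore_spec {W : ℕ} {P : Par} (hW : P.Fits W) (hk : 2 ≤ P.k) {s : State} (hs : Ctx P s)
    (hc : ∀ j < P.k, s.arr aComb j < P.D) :
    wp W cScore P.tScore (fun s' =>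
      s'.reg rZero = batchCount P s.exX s.exY (s.arr aComb) (s.reg rQ) 1 P.nf ∧
      s'.reg rOne = batchCount P s.exX s.exY (s.arr aComb) (s.reg rQ) 3 P.nf) s := by
  have hT := hW.total
  have hnf := P.nf_le_mB
  have hcst := hW.consts
  rw [Par.tScore]
  refine wp.seq (P.nf * (P.tBatch + 40 + 22) + 22 + 4) (wp.assign (τ := 3) le_rfl
    (by simp; omega) ?_) (by omega)
  refine wp.seq (P.nf * (P.tBatch + 40 + 22) + 22) (wp.assign (τ := 3) le_rfl
    (by simp; omega) ?_) (by omega)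
  refine wp.forVar (N := P.nf) (τ' := P.tBatch + 40) (fun m s' =>
    s'.reg rZero = batchCount P s.exX s.exY (s.arr aComb) (s.reg rQ) 1 m ∧
      s'.reg rOne = batchCount P s.exX s.exY (s.arr aComb) (s.reg rQ) 3 m) le_rfl (by omega)
      (by simp [hs.nf]) (by simp [batchCount]) ?_
  intro m hm s' hs' hx hI
  have hs' : Frame (rOne :: rZero :: rB :: _) _ s s' := ((((Frame.refl _ _ s).put (x := rZero) 0
    (by simp)).put (x := rOne) 0 (by simp)).trans (hs'.mono (R' := rOne :: rZero :: rB :: _)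
      (fun x hx => List.mem_cons_of_mem _ (List.mem_cons_of_mem _ hx)) (List.Subset.refl _)))
  have c' := hs.frame hs'
  have ec := hs'.arr aComb (by decide)
  have eq := hs'.reg rQ (by decide)
  refine wp.seq 39 ((cBatch_spec hW hk c' (by rw [ec]; exact hc) (by rw [hx]; exact hm)).mono
    le_rfl fun s₁ f₁ h₁ => ?_) (by omega)
  rw [hs'.exX, hs'.exY, ec, eq, hx] at h₁
  have ez := (f₁.reg rZero (by decide)).trans hI.1
  have eo := (f₁.reg rOne (by decide)).trans hI.2
  have hz : ∀ v, batchCount P s.exX s.exY (s.arr aComb) (s.reg rQ) v m ≤ m :=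
    fun v => Nat.count_le _
  have hz₁ := hz 1
  have hz₃ := hz 3
  have hsucc : ∀ v, batchCount P s.exX s.exY (s.arr aComb) (s.reg rQ) v (m + 1) =
      batchCount P s.exX s.exY (s.arr aComb) (s.reg rQ) v m + if s₁.reg rRes = v then 1 else 0 :=
    fun v => by rw [h₁, batchCount, Nat.count_succ]; rfl
  simp only [hsucc]
  have hE : ∀ v : ℕ, (if s₁.reg rRes = v then 1 else 0) < 2 := fun v => by split_ifs <;> norm_num
  have hE₁ := hE 1
  have hE₃ := hE 3
  refine wp.ite (τ' := 30) (by decide) (WordOp.ok_eq (by omega) (by simp) (by simp; omega)) ?_ ?_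
  · intro h
    have h : s₁.reg rRes = 1 := WordOp.eval_eq_ne.mp h
    refine wp.assign (by decide) (by simp [ez]; omega) ?_
    simp [ez, eo, h]
  · intro h
    have h : s₁.reg rRes ≠ 1 := WordOp.eval_eq_zero.mp h
    refine wp.ite (τ' := 20) (by decide) (WordOp.ok_eq (by omega) (by simp) (by simp; omega)) ?_ ?_
    · intro h'
      have h' : s₁.reg rRes = 3 := WordOp.eval_eq_ne.mp h'
      refine wp.assign (by decide) (by simp [eo]; omega) ?_
      simp [ez, eo, h']
    · intro h'
      have h' : s₁.reg rRes ≠ 3 := WordOp.eval_eq_zero.mp h'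
      refine wp.assign (by decide) (by simp; omega) ?_
      simp [ez, eo, h, h']

/-! ### One trial -/

/-- The coordinates of the blocks `c 0, …, c (k - 1)`. -/
def coords (c : ℕ → ℕ) (k l : ℕ) : List ℕ :=
  (List.range k).flatMap fun j => (List.range l).map fun i => c j * l + i

/-- The coordinate `q` is declared to belong to the support of the secret. -/
def Chosen (P : Par) (X : ℕ → ℕ → ℕ) (Y c : ℕ → ℕ) (q : ℕ) : Prop :=
  batchCount P X Y c q 1 P.nf < batchCount P X Y c q 3 P.nf

instance (P : Par) (X : ℕ → ℕ → ℕ) (Y c : ℕ → ℕ) : DecidablePred (Chosen P X Y c) :=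
  fun _ => inferInstanceAs (Decidable (_ < _))

/-- The candidate for the support of the secret which is found within the blocks `c`. -/
def candidate (P : Par) (X : ℕ → ℕ → ℕ) (Y c : ℕ → ℕ) : List ℕ :=
  (coords c P.k P.l).filter fun q => Chosen P X Y c q

/-- The stack of selected coordinates contains the list `L`. -/
structure Stack (L : List ℕ) (s : State) : Prop where
  len : s.reg rSupp = L.length
  val : ∀ t < L.length, s.arr aSupp t = L.getD t 0

theorem Stack.push {L : List ℕ} {s : State} (h : Stack L s) (q : ℕ) :
    Stack (L ++ [q]) ((s.sto aSupp (s.reg rSupp) q).put rSupp (s.reg rSupp + 1)) := by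
  refine ⟨by simp [h.len], fun t ht => ?_⟩
  simp only [State.put_arr, State.sto_arr, true_and, h.len]
  rw [List.length_append, List.length_singleton] at ht
  rcases Nat.lt_succ_iff_lt_or_eq.mp ht with ht | rfl
  · rw [if_neg ht.ne, h.val t ht, List.getD_append _ _ _ _ ht]
  · simp

theorem Stack.of_frame {L R A : List ℕ} {s s' : State} (h : Stack L s) (hf : Frame R A s s')
    (hR : rSupp ∉ R := by decide) (hA : aSupp ∉ A := by decide) : Stack L s' :=
  ⟨by rw [hf.reg _ hR, h.len], by rw [hf.arr _ hA]; exact h.val⟩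

/-- Decide about one coordinate. -/
def cCoord : Cmd :=
  .seq (.assign rQ (.get aComb (.var rJ) * .var rL + .var rI)) <| .seq cScore <|
    .ite (.bin .lt (.var rZero) (.var rOne))
      (.seq (.store aSupp (.var rSupp) (.var rQ)) (.assign rSupp (.var rSupp + .lit 1)))
      (.assign rX (.lit 0))

/-- Collect the candidate within the blocks of the current combination. -/
def cSelect : Cmd :=
  .seq (.assign rSupp (.lit 0)) <| .for rJ (.var rK) <| .for rI (.var rL) cCoord

/-- A bound for the running time of `cSelect`. -/
@[irreducible] def Par.tSelect (P : Par) : ℕ :=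
  P.k * (P.l * (P.tScore + 60 + 22) + 22 + 22) + 22 + 4

theorem cCoord_spec {W : ℕ} {P : Par} (hW : P.Fits W) (hk : 2 ≤ P.k) {s : State} (hs : Ctx P s)
    (hc : ∀ j < P.k, s.arr aComb j < P.D) (hj : s.reg rJ < P.k) (hi : s.reg rI < P.l)
    {L : List ℕ} (hL : Stack L s) (hlen : L.length ≤ P.k * P.l) :
    wp W cCoord (P.tScore + 60) (Stack (L ++ [s.arr aComb (s.reg rJ) * P.l + s.reg rI].filter
      fun q => Chosen P s.exX s.exY (s.arr aComb) q)) s := by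
  have hC := hW.coord
  have hcst := hW.consts
  have hsupp := hW.supp
  have hq := lt_of_comb (hc _ hj) hi.le
  set q := s.arr aComb (s.reg rJ) * P.l + s.reg rI with hqd
  have hle : s.arr aComb (s.reg rJ) * P.l ≤ q := Nat.le_add_right _ _
  refine wp.seq (P.tScore + 40) (wp.assign (τ := 15) (by decide) (by simp [hs.l]; omega) ?_)
    (by omega)
  have hqv : (Expr.get aComb (.var rJ) * .var rL + .var rI).eval s = q := by simp [hs.l, q]
  rw [hqv]
  have f₁ : Frame [rQ] [] s (s.put rQ q) := (Frame.refl _ _ _).put _ (by simp)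
  have c₁ := hs.frame f₁
  refine wp.seq 35 ((cScore_spec hW hk c₁ hc).mono le_rfl fun s₂ f₂ h₂ => ?_) (by omega)
  simp only [State.put_reg, State.put_exX, State.put_exY, State.put_arr, if_true] at h₂
  have hL₂ := (hL.of_frame f₁).of_frame f₂
  have eq : s₂.reg rQ = q := (f₂.reg rQ (by decide)).trans (by simp)
  have hlen₂ := hL₂.len
  refine wp.ite (τ' := 20) (by decide) (WordOp.ok_lt (by omega) (by simp) (by simp)) ?_ ?_
  · intro h
    have h : s₂.reg rZero < s₂.reg rOne := WordOp.eval_lt_ne.mp h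
    rw [h₂.1, h₂.2] at h
    refine wp.seq 10 (wp.store (τ := 5) (by decide) (by simp) (by simp)
      (wp.assign (by decide) (by simp; omega) ?_)) (by decide)
    have := hL₂.push q
    simp only [Expr.eval_add, Expr.eval_var, Expr.eval_lit, State.sto_reg, eq]
    rw [List.filter_singleton,
      decide_eq_true (show Chosen P s.exX s.exY (s.arr aComb) q from h), cond_true]
    exact this
  · intro h
    have h : s₂.reg rOne ≤ s₂.reg rZero := WordOp.eval_lt_zero.mp h
    rw [h₂.1, h₂.2] at h
    refine wp.assign (by decide) (by simp; omega) ?_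
    rw [List.filter_singleton,
      decide_eq_false (show ¬Chosen P s.exX s.exY (s.arr aComb) q from not_lt.mpr h), cond_false,
      List.append_nil]
    exact ⟨by simpa using hL₂.len, hL₂.val⟩

theorem length_coords (c : ℕ → ℕ) (k l : ℕ) : (coords c k l).length = k * l := by
  simp [coords, List.length_flatMap]

theorem coords_succ (c : ℕ → ℕ) (k l : ℕ) : coords c (k + 1) l =
    coords c k l ++ (List.range l).map fun i => c k * l + i := by
  simp [coords, List.range_succ]

theorem cSelect_spec {W : ℕ} {P : Par} (hW : P.Fits W) (hk : 2 ≤ P.k) {s : State} (hs : Ctx P s)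
    (hc : ∀ j < P.k, s.arr aComb j < P.D) :
    wp W cSelect P.tSelect (Stack (candidate P s.exX s.exY (s.arr aComb))) s := by
  have hsupp := hW.supp
  have hC := hW.coord
  have hl : P.l + 1 < W := by nlinarith
  have hk' : P.k + 1 < W := by omega
  rw [Par.tSelect]
  refine wp.seq (P.k * (P.l * (P.tScore + 60 + 22) + 22 + 22) + 22) (wp.assign (τ := 3) le_rfl
    (by simp; omega) ?_) (by omega)
  have f₀ : Frame [rSupp] [] s (s.put rSupp ((Expr.lit 0).eval s)) :=
    (Frame.refl _ _ _).put _ (by simp)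
  refine wp.forVar (N := P.k) (fun m s' => Stack ((coords (s.arr aComb) m P.l).filter
    fun q => Chosen P s.exX s.exY (s.arr aComb) q) s') le_rfl hk' (hs.frame f₀).k
    ⟨by simp [coords], by simp [coords]⟩ ?_
  intro j hj s₁ f₁ hxj hI
  have c₁ := (hs.frame f₀).frame f₁
  have ec := f₁.arr aComb (by decide)
  have ex := f₁.exX
  have ey := f₁.exY
  simp only [State.put_arr, State.put_exX, State.put_exY] at ec ex ey
  refine (wp.forVar (N := P.l) (τ' := P.tScore + 60) (fun m s' => Stack (((coords (s.arr aComb) j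
      P.l) ++ (List.range m).map fun i => s.arr aComb j * P.l + i).filter
      fun q => Chosen P s.exX s.exY (s.arr aComb) q) s') le_rfl hl c₁.l
      ⟨by simpa using hI.len, by simpa using hI.val⟩ ?_).mono le_rfl fun s₂ f₂ h₂ => ?_
  · intro i hi s₂ f₂ hxi hJ
    have c₂ := c₁.frame f₂
    have ej := (f₂.reg rJ (by decide)).trans hxj
    have ec₂ := (f₂.arr aComb (by decide)).trans ec
    refine (cCoord_spec hW hk c₂ (by rw [ec₂]; exact hc) (by rw [ej]; exact hj)
      (by rw [hxi]; exact hi) hJ ?_).mono le_rfl fun s₃ f₃ h₃ => ?_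
    · refine (List.length_filter_le _ _).trans ?_
      rw [List.length_append, length_coords, List.length_map, List.length_range]
      have := Nat.mul_le_mul_right P.l (Nat.succ_le_of_lt hj)
      rw [Nat.succ_mul] at this
      omega
    · rw [ec₂, ej, hxi, f₂.exX, f₂.exY, ex, ey, ← List.filter_append, List.append_assoc] at h₃
      rw [List.range_succ, List.map_append]
      exact ⟨by simpa using h₃.len, h₃.val⟩
  · rw [coords_succ]
    exact ⟨by simpa using h₂.len, h₂.val⟩

/-- The tables for the verification have been computed. -/
structure Packed (P : Par) (s : State) : Prop where
  pack : ∀ q < P.n, ∀ c < P.kc, s.arr aPack (q * P.kc + c) =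
    packBits (fun t => s.exX (P.mB + c * P.b + t) q) P.b
  lab : ∀ c < P.kc, s.arr aLab c = packBits (fun t => s.exY (P.mB + c * P.b + t)) P.b
  pop : ∀ i < 2 ^ P.b, s.arr aPop i = popCount i

theorem Packed.of_frame {P : Par} {R A : List ℕ} {s s' : State} (h : Packed P s)
    (hf : Frame R A s s') (h₁ : aPack ∉ A := by decide) (h₂ : aLab ∉ A := by decide)
    (h₃ : aPop ∉ A := by decide) : Packed P s' := by
  refine ⟨?_, ?_, ?_⟩
  · rw [hf.arr _ h₁, hf.exX]; exact h.pack
  · rw [hf.arr _ h₂, hf.exY]; exact h.lab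
  · rw [hf.arr _ h₃]; exact h.pop

/-- The bit that tells whether the example `v` contradicts the candidate `L`. -/
def errBit (X : ℕ → ℕ → ℕ) (Y : ℕ → ℕ) (L : List ℕ) (v : ℕ) : ℕ := Y v ^^^ xorSum (X v) L

theorem errBit_lt {X : ℕ → ℕ → ℕ} {Y : ℕ → ℕ} (hX : ∀ i j, X i j < 2) (hY : ∀ i, Y i < 2)
    (L : List ℕ) (v : ℕ) : errBit X Y L v < 2 :=
  Nat.xor_lt_two_pow (n := 1) (hY v) (xorSum_lt (m := 1) (hX v) L)

/-- The number of verification examples which contradict the candidate `L`. -/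
def errCount (P : Par) (X : ℕ → ℕ → ℕ) (Y : ℕ → ℕ) (L : List ℕ) : ℕ :=
  ∑ v ∈ Finset.range (P.kc * P.b), errBit X Y L (P.mB + v)

/-- The candidate `L` passes the verification. -/
def Accepted (P : Par) (X : ℕ → ℕ → ℕ) (Y : ℕ → ℕ) (L : List ℕ) : Prop :=
  L.length ≤ P.k ∧ errCount P X Y L * P.den ≤ P.num * (P.kc * P.b)

/-- Count the verification examples that contradict the candidate. -/
def cErr : Cmd :=
  .seq (.assign rErr (.lit 0)) <|
  .for rC (.var rChunks) <|
    .seq (.assign rAcc (.get aLab (.var rC))) <|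
    .seq (.for rT (.var rSupp)
      (.assign rAcc (.bin .xor (.var rAcc)
        (.get aPack (.get aSupp (.var rT) * .var rChunks + .var rC))))) <|
    .assign rErr (.var rErr + .get aPop (.var rAcc))

/-- A bound for the running time of `cErr`. -/
@[irreducible] def Par.tErr (P : Par) : ℕ := P.kc * (P.k * (20 + 22) + 22 + 30 + 22) + 22 + 4

/-- The words of contradictions of `⌊log₂ n⌋` examples at a time are sums of packed words, and
their ones are counted by table lookup.  The running time does not depend on `n`. -/
theorem cErr_spec {W : ℕ} {P : Par} (hW : P.Fits W) {s : State} (hs : Ctx P s)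
    (hp : Packed P s) {L : List ℕ} (hL : Stack L s) (hlen : L.length ≤ P.k)
    (hn : ∀ q ∈ L, q < P.n) (hn0 : P.n ≠ 0) :
    wp W cErr P.tErr (fun s' => s'.reg rErr = errCount P s.exX s.exY L) s := by
  have hcst := hW.consts
  have hsupp := hW.supp
  have hpack := hW.pack
  have htot := hW.total
  have hlen' := hW.len
  have herr := hW.err
  have hkc : P.kc + 1 < W := by nlinarith
  have hb : 2 ^ P.b ≤ P.n := by rw [Par.b]; exact Nat.pow_log_le_self 2 hn0
  have hV : P.kc * P.b < W := by omega
  rw [Par.tErr]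
  refine wp.seq (P.kc * (P.k * (20 + 22) + 22 + 30 + 22) + 22) (wp.assign (τ := 3) le_rfl
    (by simp; omega) ?_) (by omega)
  have f₀ : Frame [rErr] [] s (s.put rErr ((Expr.lit 0).eval s)) :=
    (Frame.refl _ _ _).put _ (by simp)
  have hsum : ∀ m, ∑ v ∈ Finset.range ((m + 1) * P.b), errBit s.exX s.exY L (P.mB + v) =
      ∑ v ∈ Finset.range (m * P.b), errBit s.exX s.exY L (P.mB + v) +
      ∑ t ∈ Finset.range P.b, errBit s.exX s.exY L (P.mB + m * P.b + t) := fun m => by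
    rw [add_one_mul, Finset.sum_range_add]
    simp only [add_assoc]
  have hbit := errBit_lt hs.exX hs.exY L
  have hle : ∀ m, ∑ v ∈ Finset.range m, errBit s.exX s.exY L (P.mB + v) ≤ m := fun m => by
    refine (Finset.sum_le_card_nsmul _ _ 1 fun v _ => Nat.le_of_lt_succ (hbit _)).trans ?_
    simp
  refine wp.forVar (N := P.kc) (fun m s' => s'.reg rErr =
    ∑ v ∈ Finset.range (m * P.b), errBit s.exX s.exY L (P.mB + v)) le_rfl hkc
    (hs.frame f₀).kc (by simp) ?_
  intro m hm s₁ f₁ hx hI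
  have f₁ := (f₀.mono (R' := rErr :: _) (L' := _) (by simp) (by simp)).trans (f₁.mono
    (List.subset_cons_self rErr _) (List.Subset.refl _))
  have c₁ := hs.frame f₁
  have p₁ := hp.of_frame f₁
  have L₁ := hL.of_frame f₁
  have ex := f₁.exX
  have ey := f₁.exY
  refine wp.seq (P.k * (20 + 22) + 22 + 20) (wp.assign (τ := 5) (by decide) (by simp) ?_)
    (by omega)
  set s₂ := s₁.put rAcc ((Expr.get aLab (.var rC)).eval s₁) with hs₂
  have f₂ : Frame [rAcc] [] s₁ s₂ := (Frame.refl _ _ _).put _ (by simp)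
  have c₂ := c₁.frame f₂
  have L₂ := L₁.of_frame f₂
  have p₂ := p₁.of_frame f₂
  have hl2 : L.length * (20 + 22) ≤ P.k * (20 + 22) := Nat.mul_le_mul_right _ hlen
  have hXb : ∀ q t, s.exX (P.mB + m * P.b + t) q < 2 := fun _ _ => hs.exX _ _
  have hYb : ∀ t, s.exY (P.mB + m * P.b + t) < 2 := fun _ => hs.exY _
  refine wp.seq 18 ((wp.forVar (N := L.length) (τ' := 20) (fun t s' => s'.reg rAcc =
    packBits (fun t' => s.exY (P.mB + m * P.b + t') ^^^
      xorSum (s.exX (P.mB + m * P.b + t')) (L.take t)) P.b) le_rfl (by omega) L₂.len ?_ ?_).mono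
      (τ' := P.k * (20 + 22) + 22) (by omega) fun s₃ f₃ h₃ => ?_) (by omega)
  · simp only [List.take_zero, xorSum_nil, Nat.xor_zero]
    simp only [State.put_reg, s₂]
    norm_num
    rw [hx, p₁.lab m hm, ey]
  · intro t ht s₃ f₃ hxt hJ
    have c₃ := c₂.frame f₃
    have L₃ := L₂.of_frame f₃
    have p₃ := p₂.of_frame f₃
    have ec : s₃.reg rC = m := (f₃.reg rC (by decide)).trans ((f₂.reg rC (by decide)).trans hx)
    have hqt : L.getD t 0 = L[t] := List.getD_eq_getElem _ _ ht
    have hq : L[t] < P.n := hn _ (List.getElem_mem ht)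
    have hidx : L[t] * P.kc + m < W := by
      have := row_lt hq hm
      nlinarith
    have hpk := p₃.pack _ hq m hm
    rw [f₃.exX, f₂.exX, ex] at hpk
    have hsucc : packBits (fun t' => s.exY (P.mB + m * P.b + t') ^^^
        xorSum (s.exX (P.mB + m * P.b + t')) (L.take t)) P.b ^^^
        packBits (fun t' => s.exX (P.mB + m * P.b + t') L[t]) P.b =
        packBits (fun t' => s.exY (P.mB + m * P.b + t') ^^^
        xorSum (s.exX (P.mB + m * P.b + t')) (L.take (t + 1))) P.b := by
      rw [packBits_xor (fun j => Nat.xor_lt_two_pow (n := 1) (hYb j)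
        (xorSum_lt (m := 1) (fun q => hXb q j) _)) (hXb _)]
      congr 1
      funext j
      rw [List.take_succ_eq_append_getElem ht, xorSum_append]
      simp [Nat.xor_assoc]
    have hb₂ := packBits_lt (f := fun t' => s.exY (P.mB + m * P.b + t') ^^^
        xorSum (s.exX (P.mB + m * P.b + t')) (L.take (t + 1)))
        (fun j => Nat.xor_lt_two_pow (n := 1) (hYb j)
        (xorSum_lt (m := 1) (fun q => hXb q j) _)) P.b
    have hle₁ : L[t] * P.kc ≤ L[t] * P.kc + m := Nat.le_add_right _ _
    refine wp.assign (by decide) ?_ ?_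
    · simp [WordOp.eval, hxt, L₃.val t ht, ht, c₃.kc, ec, hpk, hJ, hsucc]
      omega
    · simp only [Expr.eval_bin, Expr.eval_var, Expr.eval_get, Expr.eval_add, Expr.eval_mul,
        WordOp.eval, hxt, L₃.val t ht, hqt, c₃.kc, ec, hpk, hJ, hsucc]
      simp
  · have ee : s₃.reg rErr = _ := (f₃.reg rErr (by decide)).trans
      ((f₂.reg rErr (by decide)).trans hI)
    have p₃ := p₂.of_frame f₃
    rw [List.take_length] at h₃
    have hbits : ∀ j, s.exY (P.mB + m * P.b + j) ^^^ xorSum (s.exX (P.mB + m * P.b + j)) L < 2 :=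
      fun j => hbit (P.mB + m * P.b + j)
    have hpop := p₃.pop _ (packBits_lt hbits P.b)
    rw [popCount_packBits hbits] at hpop
    have hgoal := hsum m
    have hm1 := hle ((m + 1) * P.b)
    have hm2 : (m + 1) * P.b ≤ P.kc * P.b := Nat.mul_le_mul_right _ hm
    have heq : ∑ j ∈ Finset.range P.b, (s.exY (P.mB + m * P.b + j) ^^^
      xorSum (s.exX (P.mB + m * P.b + j)) L) =
      ∑ t ∈ Finset.range P.b, errBit s.exX s.exY L (P.mB + m * P.b + t) := rfl
    refine wp.assign (by decide) ?_ ?_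
    · simp [ee, h₃, hpop]; omega
    · simp only [Expr.eval_add, Expr.eval_var, Expr.eval_get, ee, h₃, hpop, State.put_reg]
      norm_num
      rw [hgoal, heq]

/-- Write the candidate to the output if it passes the verification. -/
def cVerify (num den : ℕ) : Cmd :=
  .seq cErr <|
  .ite (.bin .lt (.lit num * (.var rChunks * .var rBits)) (.var rErr * .lit den))
    (.assign rX (.lit 0))
    (.for rT (.var rSupp) (.store aOut (.get aSupp (.var rT)) (.lit 1)))

theorem cVerify_spec {W : ℕ} {P : Par} (hW : P.Fits W) {s : State} (hs : Ctx P s)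
    (hp : Packed P s) {L : List ℕ} (hL : Stack L s) (hlen : L.length ≤ P.k)
    (hn : ∀ q ∈ L, q < P.n) (hn0 : P.n ≠ 0) :
    wp W (cVerify P.num P.den) (P.tErr + (P.k * (10 + 22) + 22 + 30) + 1) (fun s' =>
      ∀ j, s'.arr aOut j = if errCount P s.exX s.exY L * P.den ≤ P.num * (P.kc * P.b) ∧ j ∈ L
        then 1 else s.arr aOut j) s := by
  have hcst := hW.consts
  have hsupp := hW.supp
  have herr := hW.err
  have hl2 : L.length * (10 + 22) ≤ P.k * (10 + 22) := Nat.mul_le_mul_right _ hlen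
  refine wp.seq (P.k * (10 + 22) + 22 + 30) ((cErr_spec hW hs hp hL hlen hn hn0).mono le_rfl
    fun s₂ f₂ h₂ => ?_) (by omega)
  have c₂ := hs.frame f₂
  have L₂ := hL.of_frame f₂
  have eo₂ := f₂.arr aOut (by decide)
  have hE : errCount P s.exX s.exY L ≤ P.kc * P.b := by
    refine (Finset.sum_le_card_nsmul _ _ 1
      fun v _ => Nat.le_of_lt_succ (errBit_lt hs.exX hs.exY L _)).trans ?_
    simp
  generalize errCount P s.exX s.exY L = E at h₂ hE ⊢
  have hb₁ : E * P.den ≤ P.kc * P.b * P.den := Nat.mul_le_mul_right _ hE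
  have hb₂ : (P.kc * P.b + 1) * (P.den + P.num + 1) = P.kc * P.b * P.den +
    P.num * (P.kc * P.b) + P.kc * P.b + P.den + P.num + 1 := by ring
  rw [hb₂] at herr
  refine wp.ite (τ' := P.k * (10 + 22) + 22) (by simp [Expr.cost]; omega)
    (WordOp.ok_lt (by omega) ?_ ?_) ?_ ?_
  · simp [c₂.kc, c₂.b]; omega
  · simp only [Expr.ok_mul, Expr.ok_var, Expr.ok_lit, Expr.eval_var, Expr.eval_lit, h₂, true_and]
    omega
  · intro h'
    have h' := WordOp.eval_lt_ne.mp h'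
    simp only [Expr.eval_mul, Expr.eval_lit, Expr.eval_var, c₂.kc, c₂.b, h₂] at h'
    refine wp.assign (by simp [Expr.cost]) (by simp; omega) fun j => ?_
    rw [if_neg (fun h => absurd h.1 (not_le.mpr h')), State.put_arr, eo₂]
  · intro h'
    have h' := WordOp.eval_lt_zero.mp h'
    simp only [Expr.eval_mul, Expr.eval_lit, Expr.eval_var, c₂.kc, c₂.b, h₂] at h'
    refine (wp.forVar (N := L.length) (τ' := 10) (fun t s' => ∀ j, s'.arr aOut j =
      if j ∈ L.take t then 1 else s.arr aOut j) (τ := P.k * (10 + 22) + 22) (by omega) (by omega)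
      L₂.len ?_ ?_).mono le_rfl ?_
    · intro j; simp [eo₂]
    · intro t ht s₃ f₃ hxt hJ
      have L₃ := L₂.of_frame f₃
      have hqt : L.getD t 0 = L[t] := List.getD_eq_getElem _ _ ht
      have hv := L₃.val t ht
      rw [hqt] at hv
      refine wp.store (by decide) (by simp) (by simp; omega) fun j => ?_
      simp only [State.put_arr, State.sto_arr, true_and, Expr.eval_get, Expr.eval_var,
        Expr.eval_lit, hxt, hv, hJ j]
      have hm : j ∈ L.take (t + 1) ↔ j ∈ L.take t ∨ j = L[t] := by
        rw [List.take_succ_eq_append_getElem ht, List.mem_append, List.mem_singleton]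
      simp only [hm]
      by_cases h₁ : j = L[t] <;> by_cases h₂ : j ∈ L.take t <;> simp [h₁, h₂]
    · intro s₃ _ h₃ j
      rw [h₃ j, List.take_length]
      by_cases h₁ : j ∈ L <;> simp [h₁, h']

/-- One trial: find the candidate within the current blocks and verify it. -/
def cTrial (num den : ℕ) : Cmd :=
  .seq cSelect <| .ite (.bin .lt (.var rK) (.var rSupp)) (.assign rX (.lit 0)) (cVerify num den)

/-- A bound for the running time of `cTrial`. -/
@[irreducible] def Par.tTrial (P : Par) : ℕ :=
  P.tSelect + (P.tErr + (P.k * (10 + 22) + 22 + 30) + 10)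

open Classical in
theorem cTrial_spec {W : ℕ} {P : Par} (hW : P.Fits W) (hk : 2 ≤ P.k) {s : State} (hs : Ctx P s)
    (hc : ∀ j < P.k, s.arr aComb j < P.D) (hp : Packed P s)
    (hn : ∀ q ∈ candidate P s.exX s.exY (s.arr aComb), q < P.n) (hn0 : P.n ≠ 0) :
    wp W (cTrial P.num P.den) P.tTrial (fun s' => ∀ j, s'.arr aOut j =
      if Accepted P s.exX s.exY (candidate P s.exX s.exY (s.arr aComb)) ∧
        j ∈ candidate P s.exX s.exY (s.arr aComb) then 1 else s.arr aOut j) s := by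
  have hsupp := hW.supp
  have hsel := cSelect_spec hW hk hs hc
  generalize candidate P s.exX s.exY (s.arr aComb) = L at hsel hn ⊢
  rw [Par.tTrial]
  refine wp.seq (P.tErr + (P.k * (10 + 22) + 22 + 30) + 9) (hsel.mono
    le_rfl fun s₁ f₁ L₁ => ?_) (by omega)
  have c₁ := hs.frame f₁
  have p₁ := hp.of_frame f₁
  have eo := f₁.arr aOut (by decide)
  refine wp.ite (τ' := P.tErr + (P.k * (10 + 22) + 22 + 30) + 1) (by simp [Expr.cost]; omega)
    (WordOp.ok_lt (by omega) (by simp) (by simp)) ?_ ?_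
  · intro h
    have h : s₁.reg rK < s₁.reg rSupp := WordOp.eval_lt_ne.mp h
    rw [c₁.k, L₁.len] at h
    refine wp.assign (by simp [Expr.cost]; omega) (by simp; omega) fun j => ?_
    rw [if_neg (fun h' => absurd h'.1.1 (not_le.mpr h)), State.put_arr, eo]
  · intro h
    have h : s₁.reg rSupp ≤ s₁.reg rK := WordOp.eval_lt_zero.mp h
    rw [c₁.k, L₁.len] at h
    refine (cVerify_spec hW c₁ p₁ L₁ h hn hn0).mono le_rfl fun s₂ f₂ h₂ j => ?_
    rw [h₂ j, f₁.exX, f₁.exY, eo]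
    simp [Accepted, h]

/-! ### The loop over all combinations of blocks -/

/-- Replace the current combination by the next one, or stop. -/
def cNext : Cmd :=
  .seq (.assign rRun (.lit 0)) <|
  .seq (.for rX (.var rK) <|
    .ite (.bin .eq (.var rRun) (.var rX))
      (.ite (.bin .eq (.get aComb (.var rX) + .lit 1) (.get aComb (.var rX + .lit 1)))
        (.assign rRun (.var rX + .lit 1)) (.assign rT (.lit 0)))
      (.assign rT (.lit 0))) <|
  .ite (.bin .eq (.var rRun) (.var rK)) (.assign rGo (.lit 0)) <|
    .seq (.store aComb (.var rRun) (.get aComb (.var rRun) + .lit 1)) <|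
    .for rX (.var rRun) (.store aComb (.var rX) (.var rX))

/-- A bound for the running time of `cNext`. -/
@[irreducible] def Par.tNext (P : Par) : ℕ := P.k * (50 + 22) + P.k * (5 + 22) + 150

/-- The loop recomputes `runLength`; a run that reaches the sentinel ends the enumeration. -/
theorem cNext_spec {W : ℕ} {P : Par} (hW : P.Fits W) {s : State} (hs : Ctx P s) {c : ℕ → ℕ}
    (hc : IsComb P.k P.D c) (h : ∀ x ≤ P.k, s.arr aComb x = c x) :
    wp W cNext P.tNext (fun s' => (runLength c P.k = P.k → s'.reg rGo = 0) ∧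
      (runLength c P.k ≠ P.k → s'.reg rGo = s.reg rGo ∧
        ∀ x ≤ P.k, s'.arr aComb x = nextComb P.k c x)) s := by
  have hsupp := hW.supp
  have hcoord := hW.coord
  have hD : P.D + 1 < W + P.l := by nlinarith
  have hD : P.D + 1 < W ∨ P.l = 0 ∧ P.D + 1 ≤ W := by
    rcases Nat.eq_zero_or_pos P.l with h0 | h0
    · right; exact ⟨h0, by omega⟩
    · left; nlinarith
  have hcD : ∀ x < P.k, c x < P.D := fun x hx => by
    have := hc.lt hx le_rfl; rwa [hc.last] at this
  rw [Par.tNext]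
  refine wp.seq (P.k * (50 + 22) + P.k * (5 + 22) + 140) (wp.assign (τ := 3) le_rfl
    (by simp; omega) ?_) (by omega)
  have f₀ : Frame [rRun] [] s (s.put rRun ((Expr.lit 0).eval s)) :=
    (Frame.refl _ _ _).put _ (by simp)
  refine wp.seq (P.k * (5 + 22) + 110) ((wp.forVar (N := P.k) (τ' := 50) (fun m s' =>
    s'.reg rRun = runLength c m) le_rfl (by omega) (hs.frame f₀).k (by simp [runLength])
    ?_).mono le_rfl fun s₁ f₁ h₁ => ?_) (by omega)
  · intro m hm s₁ f₁ hx hI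
    have ec : s₁.arr aComb = s.arr aComb := f₁.arr aComb (by decide)
    have e₁ := h m hm.le
    have e₂ := h (m + 1) hm
    have b₁ := hcD m hm
    refine wp.ite (τ' := 40) (by decide) (WordOp.ok_eq (by omega) (by simp) (by simp)) ?_ ?_
    · intro h1
      have h1 : s₁.reg rRun = s₁.reg rX := WordOp.eval_eq_ne.mp h1
      rw [hI, hx] at h1
      refine wp.ite (τ' := 10) (by decide) (WordOp.ok_eq (by omega) ?_ ?_) ?_ ?_
      · simp [hx, ec, e₁]; omega
      · simp [hx]; omega
      · intro h2
        have h2 := WordOp.eval_eq_ne.mp h2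
        simp only [Expr.eval_add, Expr.eval_get, Expr.eval_var, Expr.eval_lit, hx, ec, e₁, e₂] at h2
        refine wp.assign (by decide) (by simp [hx]; omega) ?_
        rw [runLength, if_pos ⟨h1, h2⟩]; simp [hx]
      · intro h2
        have h2 := WordOp.eval_eq_zero.mp h2
        simp only [Expr.eval_add, Expr.eval_get, Expr.eval_var, Expr.eval_lit, hx, ec, e₁, e₂] at h2
        refine wp.assign (by decide) (by simp; omega) ?_
        rw [runLength, if_neg (fun h' => h2 h'.2)]; simp [hI]
    · intro h1
      have h1 : s₁.reg rRun ≠ s₁.reg rX := WordOp.eval_eq_zero.mp h1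
      rw [hI, hx] at h1
      refine wp.assign (by decide) (by simp; omega) ?_
      rw [runLength, if_neg (fun h' => h1 h'.1)]; simp [hI]
  · have c₁ := (hs.frame f₀).frame f₁
    have ec : s₁.arr aComb = s.arr aComb := f₁.arr aComb (by decide)
    have eg : s₁.reg rGo = s.reg rGo := (f₁.reg rGo (by decide)).trans (by simp)
    have hr := (runLength_spec c P.k).1
    generalize hi : runLength c P.k = i at *
    have hn : ∀ x, nextComb P.k c x = if x < i then x else if x = i then c x + 1 else c x :=
      fun x => by rw [nextComb, hi]
    refine wp.ite (τ' := P.k * (5 + 22) + 100) (by simp [Expr.cost]; omega)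
      (WordOp.ok_eq (by omega) (by simp) (by simp)) ?_ ?_
    · intro h2
      have h2 : s₁.reg rRun = s₁.reg rK := WordOp.eval_eq_ne.mp h2
      rw [h₁, c₁.k] at h2
      exact wp.assign (by simp [Expr.cost]) (by simp; omega) ⟨fun _ => by simp, fun h3 => absurd h2 h3⟩
    · intro h2
      have h2 : s₁.reg rRun ≠ s₁.reg rK := WordOp.eval_eq_zero.mp h2
      rw [h₁, c₁.k] at h2
      have hik : i < P.k := by omega
      have b₁ := hcD i hik
      have e₁ := h i hik.le
      have hmul : i * (5 + 22) ≤ P.k * (5 + 22) := Nat.mul_le_mul_right _ hr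
      refine wp.seq (P.k * (5 + 22) + 22) (wp.store (τ := 20) (by decide) (by simp)
        (by simp [h₁, ec, e₁]; omega) ?_) (by omega)
      simp only [Expr.eval_add, Expr.eval_get, Expr.eval_var, Expr.eval_lit, h₁, ec, e₁]
      refine (wp.forVar (N := i) (τ' := 5) (fun m s' => ∀ x ≤ P.k, s'.arr aComb x =
        if x < m then x else if x = i then c x + 1 else c x) (τ := P.k * (5 + 22) + 22) (by omega)
        (by omega) (by simp [h₁]) ?_ ?_).mono le_rfl fun s₃ f₃ h₃ => ?_
      · intro x hx
        simp only [State.put_arr, State.sto_arr, true_and, ec, h x hx]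
        simp only [Nat.not_lt_zero, if_false]
        split_ifs with h4
        · rw [h4]
        · rfl
      · intro m hm s₃ f₃ hx hI
        refine wp.store (by decide) (by simp) (by simp) fun x hxk => ?_
        simp only [State.put_arr, State.sto_arr, true_and, Expr.eval_var, hx, hI x hxk]
        by_cases h4 : x = m
        · simp [h4]
        · have : x < m + 1 ↔ x < m := by omega
          simp only [this, h4, if_false]
      · refine ⟨fun h4 => absurd h4 h2, fun _ => ⟨?_, fun x hx => by rw [h₃ x hx, hn]⟩⟩
        rw [f₃.reg rGo (by decide)]; exact eg

theorem coords_congr {c c' : ℕ → ℕ} {k l : ℕ} (h : ∀ j < k, c j = c' j) :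
    coords c k l = coords c' k l := by
  induction k with
  | zero => rfl
  | succ k ih => rw [coords_succ, coords_succ, ih fun j hj => h j (by omega), h k (by omega)]

/-- Only the first `k` entries of a combination matter. -/
theorem candidate_congr {P : Par} {X : ℕ → ℕ → ℕ} {Y c c' : ℕ → ℕ} (h : ∀ j < P.k, c j = c' j) :
    candidate P X Y c = candidate P X Y c' := by
  have h₁ : coords c P.k P.l = coords c' P.k P.l := coords_congr h
  have h₂ : ∀ q base, batchWord X Y c P.k P.l q base = batchWord X Y c' P.k P.l q base := by
    intro q base
    funext u i
    simp only [batchWord]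
    congr 1
    exact packBits_congr fun j hj => by rw [h j hj]
  have h₃ : ∀ q, batchVal X Y c P.k P.l q P.nb = batchVal X Y c' P.k P.l q P.nb := fun q => by
    funext base
    simp only [batchVal, h₂]
  have h₄ : ∀ q v, batchCount P X Y c q v P.nf = batchCount P X Y c' q v P.nf := fun q v => by
    rw [batchCount, batchCount, h₃]
  rw [candidate, candidate, h₁]
  refine List.filter_congr fun q _ => ?_
  exact decide_eq_decide.mpr (by rw [Chosen, Chosen, h₄, h₄])

/-- No candidate contains a coordinate at which all examples vanish. -/
theorem lt_of_mem_candidate {P : Par} {X : ℕ → ℕ → ℕ} {Y c : ℕ → ℕ}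
    (hX : ∀ u q, P.n ≤ q → X u q = 0) : ∀ q ∈ candidate P X Y c, q < P.n := by
  intro q hq
  by_contra hn
  have hq := (List.mem_filter.mp hq).2
  have h0 : ∀ B, batchVal X Y c P.k P.l q P.nb (B * P.nb) ≠ 3 := by
    intro B h
    have h₁ : (fun u => batchWord X Y c P.k P.l q (B * P.nb) u P.l) =
        fun u => 0 + 2 * Y (B * P.nb + u) := by
      funext u
      rw [batchWord, if_neg (lt_irrefl _), hX _ _ (not_lt.mp hn)]
    rw [batchVal, h₁, xorSum_pair (fun _ => by norm_num),
      xorSum_eq_mod (f := fun _ => 0) (fun _ => by norm_num)] at h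
    simp at h
    omega
  have h3 : batchCount P X Y c q 3 P.nf = 0 := by
    rw [batchCount, Nat.count_iff_forall_not]
    exact fun B _ => h0 B
  simp [Chosen, h3] at hq

/-- The output cells that are set by the trials with numbers below `m`. -/
def Written (P : Par) (X : ℕ → ℕ → ℕ) (Y : ℕ → ℕ) (m j : ℕ) : Prop :=
  ∃ t < m, Accepted P X Y (candidate P X Y (combSeq P.k P.D t)) ∧
    j ∈ candidate P X Y (combSeq P.k P.D t)

/-- Try all combinations of blocks. -/
def cMain (num den : ℕ) : Cmd :=
  .seq (.assign rGo (.lit 1)) <| .while (.var rGo) (.seq (cTrial num den) cNext)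

/-- A bound for the running time of `cMain`. -/
@[irreducible] def Par.tMain (P : Par) : ℕ :=
  P.D.choose P.k * (P.tTrial + P.tNext + 4) + 10

theorem regs_cTrial (num den : ℕ) : ∀ r ∈ (cTrial num den).regs, 9 < r ∧ r ≠ rGo :=
  (by decide : ∀ r ∈ (cTrial 0 0).regs, 9 < r ∧ r ≠ rGo)

theorem regs_cBody (num den : ℕ) : ∀ r ∈ (Cmd.seq (cTrial num den) cNext).regs, 9 < r :=
  (by decide : ∀ r ∈ (Cmd.seq (cTrial 0 0) cNext).regs, 9 < r)

theorem arrs_cBody (num den : ℕ) : aPack ∉ (Cmd.seq (cTrial num den) cNext).arrs ∧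
    aLab ∉ (Cmd.seq (cTrial num den) cNext).arrs ∧ aPop ∉ (Cmd.seq (cTrial num den) cNext).arrs ∧
    aComb ∉ (cTrial num den).arrs :=
  (by decide : aPack ∉ (Cmd.seq (cTrial 0 0) cNext).arrs ∧
    aLab ∉ (Cmd.seq (cTrial 0 0) cNext).arrs ∧ aPop ∉ (Cmd.seq (cTrial 0 0) cNext).arrs ∧
    aComb ∉ (cTrial 0 0).arrs)

open Classical in
/-- The trials run through `combSeq`, and each sets the output cells of its candidate if that
passes the verification. -/
theorem cMain_spec {W : ℕ} {P : Par} (hW : P.Fits W) (hk : 2 ≤ P.k) (hn0 : P.n ≠ 0) {s : State}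
    (hs : Ctx P s) (hp : Packed P s) (hX : ∀ u q, P.n ≤ q → s.exX u q = 0)
    (hc : ∀ x ≤ P.k, s.arr aComb x = combSeq P.k P.D 0 x) (ho : ∀ j, s.arr aOut j = 0) :
    wp W (cMain P.num P.den) P.tMain (fun s' => ∀ j, s'.arr aOut j =
      if Written P s.exX s.exY (P.D.choose P.k) j then 1 else 0) s := by
  have hcst := hW.consts
  have hkD : P.k ≤ P.D := by rw [Par.D]; exact Nat.le_add_left _ _
  have hN : 0 < P.D.choose P.k := Nat.choose_pos hkD
  have hcs := combSeq_spec hkD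
  rw [Par.tMain]
  generalize hNd : P.D.choose P.k = N at *
  refine wp.seq (N * (P.tTrial + P.tNext + 4) + 3) (wp.assign (τ := 3) le_rfl
    (by simp; omega) ?_) (by omega)
  have f₀ : Frame [rGo] [] s (s.put rGo ((Expr.lit 1).eval s)) :=
    (Frame.refl _ _ _).put _ (by simp)
  refine (wp.while (N := N) (τ' := P.tTrial + P.tNext + 1) (fun t s' =>
    s'.reg rGo = (if t < N then 1 else 0) ∧
    (t < N → ∀ x ≤ P.k, s'.arr aComb x = combSeq P.k P.D t x) ∧
    ∀ j, s'.arr aOut j = if Written P s.exX s.exY t j then 1 else 0)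
    ⟨by simp [hN], fun _ => by simpa using hc, fun j => by simp [ho, Written]⟩ le_rfl ?_ ?_).mono
    (by simp [Expr.cost, add_assoc]) fun s' _ h => h.2.2
  · rintro t ht s₁ f₁ ⟨hg, hcomb, hout⟩
    have hcomb := hcomb ht
    rw [if_pos ht] at hg
    have f₁' : Frame _ _ s s₁ := (f₀.mono (R' := rGo :: _) (L' := _) (by simp) (by simp)).trans
      (f₁.mono (List.subset_cons_self rGo _) (List.Subset.refl _))
    have c₁ := hs.frame f₁' fun r hr => by
      rcases List.mem_cons.mp hr with rfl | hr
      · norm_num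
      · exact regs_cBody _ _ r hr
    obtain ⟨a₁, a₂, a₃, a₄⟩ := arrs_cBody P.num P.den
    have p₁ := hp.of_frame f₁' a₁ a₂ a₃
    obtain ⟨hic, hrk⟩ := hcs t ht
    have hlt : ∀ j < P.k, s₁.arr aComb j < P.D := fun j hj => by
      rw [hcomb j hj.le]
      have := hic.lt hj le_rfl
      rwa [hic.last] at this
    have hcand : candidate P s.exX s.exY (s₁.arr aComb) =
        candidate P s.exX s.exY (combSeq P.k P.D t) := candidate_congr fun j hj => hcomb j hj.le
    have htr := cTrial_spec hW hk c₁ hlt p₁ (by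
      rw [f₁'.exX, f₁'.exY]; exact lt_of_mem_candidate hX) hn0
    rw [f₁'.exX, f₁'.exY, hcand] at htr
    refine ⟨by simp, by simp [hg], wp.seq P.tNext (htr.mono le_rfl fun s₂ f₂ h₂ => ?_) le_rfl⟩
    have c₂ := c₁.frame f₂ fun r hr => (regs_cTrial _ _ r hr).1
    have hcomb₂ : ∀ x ≤ P.k, s₂.arr aComb x = combSeq P.k P.D t x := by
      rw [f₂.arr aComb a₄]; exact hcomb
    refine (cNext_spec hW c₂ hic hcomb₂).mono le_rfl fun s₃ f₃ h₃ => ?_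
    have hrun := runLength_combSeq (k := P.k) (D := P.D) hkD (by rw [hNd]; exact ht)
    rw [hNd] at hrun
    have eo : s₃.arr aOut = s₂.arr aOut := f₃.arr aOut (by decide)
    have hw : ∀ j, s₃.arr aOut j = if Written P s.exX s.exY (t + 1) j then 1 else 0 := by
      intro j
      rw [eo, h₂ j, hout j]
      have hsucc : Written P s.exX s.exY (t + 1) j ↔ Written P s.exX s.exY t j ∨
          (Accepted P s.exX s.exY (candidate P s.exX s.exY (combSeq P.k P.D t)) ∧
            j ∈ candidate P s.exX s.exY (combSeq P.k P.D t)) := by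
        constructor
        · rintro ⟨t', ht', h⟩
          rcases Nat.lt_succ_iff_lt_or_eq.mp ht' with h' | rfl
          · exact Or.inl ⟨t', h', h⟩
          · exact Or.inr h
        · rintro (⟨t', ht', h⟩ | h)
          · exact ⟨t', by omega, h⟩
          · exact ⟨t, by omega, h⟩
      simp only [hsucc]
      by_cases h5 : Written P s.exX s.exY t j <;> simp [h5]
    by_cases hlast : t + 1 = N
    · refine ⟨?_, fun h => by omega, hw⟩
      rw [if_neg (by omega)]
      exact h₃.1 (hrun.mpr hlast)
    · obtain ⟨hg₃, hc₃⟩ := h₃.2 (fun h => hlast (hrun.mp h))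
      refine ⟨?_, fun _ => hc₃, hw⟩
      rw [if_pos (by omega), hg₃, f₂.reg rGo fun hr => (regs_cTrial _ _ _ hr).2 rfl, hg]
  · rintro s₁ _ ⟨hg, -⟩
    exact ⟨by simp, by simpa using hg⟩

/-! ### Preparation -/

/-- `x := ⌊log₂ r⌋`. -/
def cLog (x r : ℕ) : Cmd :=
  .seq (.assign x (.lit 0)) <|
  .for rT (.var r) <|
    .ite (.bin .lt (.var r) (.bin .shl (.lit 1) (.var x + .lit 1)))
      (.assign rX (.lit 0)) (.assign x (.var x + .lit 1))

theorem cLog_spec {W x r v : ℕ} {s : State} (hr : s.reg r = v) (hv : v ≠ 0) (hW : 2 * v + 4 < W)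
    (h₁ : r ∉ [rT, x, rX]) (h₂ : x ∉ [rT, rX]) :
    wp W (cLog x r) (v * (40 + 22) + 22 + 4) (fun s' => s'.reg x = Nat.log 2 v) s := by
  simp only [List.mem_cons, List.not_mem_nil, or_false, not_or] at h₁ h₂
  refine wp.seq (v * (40 + 22) + 22) (wp.assign (τ := 3) le_rfl (by simp; omega) ?_) (by omega)
  refine (wp.forVar (N := v) (τ' := 40) (fun m s' => 2 ^ s'.reg x ≤ v ∧
    (v < 2 ^ (s'.reg x + 1) ∨ s'.reg x = m) ∧ s'.reg x ≤ m) le_rfl (by omega)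
    (by simp [hr, h₁]) ?_ ?_ (by simp [Cmd.regs, h₁]) (by simp [Cmd.regs, Ne.symm h₂.1])).mono
    le_rfl fun s' _ h => ?_
  · simp [h₂]; omega
  · intro m hm s₁ f₁ hx ⟨i₁, i₂, i₃⟩
    have er : s₁.reg r = v := (f₁.reg r (by simp [Cmd.regs, h₁])).trans (by simp [hr, h₁])
    have hp : 2 ^ (s₁.reg x + 1) ≤ 2 * v := by rw [pow_succ]; omega
    refine wp.ite (τ' := 20) (by simp [Expr.cost]) (WordOp.ok_lt (by omega) (by simp) ?_) ?_ ?_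
    · simp [WordOp.eval, Nat.shiftLeft_eq]; omega
    · intro h
      have h := WordOp.eval_lt_ne.mp h
      simp only [Expr.eval_var, Expr.eval_bin, Expr.eval_lit, Expr.eval_add, WordOp.eval,
        Nat.shiftLeft_eq, one_mul, er] at h
      refine wp.assign (by simp [Expr.cost]) (by simp; omega) ?_
      simp only [State.put_reg, if_neg h₂.1, if_neg h₂.2]
      exact ⟨i₁, Or.inl h, by omega⟩
    · intro h
      have h := WordOp.eval_lt_zero.mp h
      simp only [Expr.eval_var, Expr.eval_bin, Expr.eval_lit, Expr.eval_add, WordOp.eval,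
        Nat.shiftLeft_eq, one_mul, er] at h
      refine wp.assign (by simp [Expr.cost]) (by simp; omega) ?_
      simp only [State.put_reg, if_neg h₂.1, if_true, Expr.eval_add, Expr.eval_var, Expr.eval_lit]
      refine ⟨h, Or.inr ?_, by omega⟩
      rcases i₂ with i₂ | i₂ <;> omega
  · obtain ⟨i₁, i₂, -⟩ := h
    refine (Nat.log_eq_of_pow_le_of_lt_pow i₁ ?_).symm
    rcases i₂ with i₂ | i₂
    · exact i₂
    · rw [i₂]
      exact (Nat.lt_succ_self v).trans Nat.lt_two_pow_self

/-- Compute the parameters. -/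
def cParams (α κ : ℕ) : Cmd :=
  .seq (cLog rL rK) <| .seq (cLog rBits rN) <|
  .seq (.assign rKeys (.bin .shl (.lit 1) (.var rK))) <|
  .seq (.assign rBatch (.bin .shl (.lit 1) (.lit 2 * .var rK))) <|
  .seq (.assign rNumB (.bin .shl (.lit 1) (.lit α * .var rK))) <|
  .seq (.assign rChunks (.lit κ * .var rK)) <|
  .seq (.assign rTrain (.var rNumB * .var rBatch)) <|
  .seq (.assign rBlocks (.var rN / .var rL + .var rK)) <|
  .assign rTotal (.var rTrain + .var rChunks * .var rBits)

/-- A bound for the running time of `cParams`. -/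
@[irreducible] def Par.tParams (P : Par) : ℕ := P.k * 62 + P.n * 62 + 200

/-- The logarithms and powers are computed once, in time linear in `n` and `k`. -/
theorem cParams_spec {W : ℕ} {P : Par} (hW : P.Fits W) (hk : 2 ≤ P.k) (hn0 : P.n ≠ 0) {s : State}
    (hsn : s.reg rN = P.n) (hsk : s.reg rK = P.k) (hX : ∀ i j, s.exX i j < 2)
    (hY : ∀ i, s.exY i < 2) :
    wp W (cParams P.α P.κ) P.tParams
      (fun s' => Ctx P s' ∧ s'.reg rTotal = P.mB + P.kc * P.b) s := by
  have hlen := hW.len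
  have hsupp := hW.supp
  have hkeys := hW.keys
  have hnb := hW.nb_add
  have hnf := P.nf_le_mB
  have htot := hW.total
  have hexp := hW.exps
  have hpack := hW.pack
  have hcoord := hW.coord
  have hcst := hW.consts
  have hlk : P.l ≠ 0 := by
    rw [Par.l]; exact (Nat.log_pos (by norm_num) hk).ne'
  have e1 : (P.α + P.κ + 2) * P.k = P.α * P.k + P.κ * P.k + 2 * P.k := by ring
  rw [e1] at hexp
  have hkc : P.κ * P.k = P.kc := by rw [Par.kc]
  have hmB : P.nf * P.nb = P.mB := by rw [Par.mB]
  have hD : P.D < W := by nlinarith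
  have hDd : P.n / P.l + P.k = P.D := by rw [Par.D]
  have hx : 2 * P.k < W := by omega
  rw [Par.tParams]
  refine wp.seq (P.n * 62 + 170) ((cLog_spec hsk (by omega) (by omega) (by decide)
    (by decide)).mono le_rfl fun s₁ f₁ h₁ => ?_) (by omega)
  have en := (f₁.reg rN (by decide)).trans hsn
  have ek := (f₁.reg rK (by decide)).trans hsk
  have ex := f₁.exX
  have ey := f₁.exY
  refine wp.seq 140 ((cLog_spec en hn0 (by omega) (by decide)
    (by decide)).mono le_rfl fun s₂ f₂ h₂ => ?_) (by omega)
  have en₂ := (f₂.reg rN (by decide)).trans en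
  have ek₂ := (f₂.reg rK (by decide)).trans ek
  have el₂ := (f₂.reg rL (by decide)).trans h₁
  have ex₂ := f₂.exX.trans ex
  have ey₂ := f₂.exY.trans ey
  have vkeys : 2 ^ P.k = P.keys := by rw [Par.keys]
  have vnb : 2 ^ (2 * P.k) = P.nb := by rw [Par.nb]
  have vnf : 2 ^ (P.α * P.k) = P.nf := by rw [Par.nf]
  have vl : Nat.log 2 P.k = P.l := by rw [Par.l]
  have vb : Nat.log 2 P.n = P.b := by rw [Par.b]
  rw [vl] at el₂
  rw [vb] at h₂
  refine wp.seq 130 (wp.assign (τ := 7) (by decide) (by simp [WordOp.eval, Nat.shiftLeft_eq, ek₂, vkeys]; omega) ?_)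
    (by omega)
  refine wp.seq 110 (wp.assign (τ := 12) (by decide) (by simp [WordOp.eval, Nat.shiftLeft_eq, ek₂, vnb]; omega) ?_)
    (by omega)
  refine wp.seq 90 (wp.assign (τ := 12) (by simp [Expr.cost]) (by simp [WordOp.eval, Nat.shiftLeft_eq, ek₂, vnf]; omega) ?_)
    (by omega)
  refine wp.seq 70 (wp.assign (τ := 12) (by simp [Expr.cost]) (by simp [ek₂]; omega) ?_)
    (by omega)
  refine wp.seq 50 (wp.assign (τ := 12) (by decide) (by
    simp [WordOp.eval, Nat.shiftLeft_eq, ek₂, vnf, vnb, hmB]; omega) ?_) (by omega)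
  refine wp.seq 30 (wp.assign (τ := 12) (by decide) (by
    simp [WordOp.eval, Nat.shiftLeft_eq, ek₂, en₂, el₂, hDd]; omega) ?_) (by omega)
  refine wp.assign (by decide) (by
    simp [WordOp.eval, Nat.shiftLeft_eq, ek₂, vnf, vnb, hmB, hkc, h₂]; omega) ?_
  refine ⟨?_, ?_⟩
  · constructor <;> simp [WordOp.eval, Nat.shiftLeft_eq, ek₂, en₂, el₂, vnf, vnb, vkeys, hmB, hkc,
      h₂, hDd, ex₂, ey₂, hX, hY]
  · simp [WordOp.eval, Nat.shiftLeft_eq, ek₂, vnf, vnb, hmB, hkc, h₂]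

/-- Pack the bits `e` into a word. -/
def cBits (e : Expr) : Cmd :=
  .seq (.assign rWord (.lit 0)) <|
  .for rT (.var rBits) (.assign rWord (.lit 2 * .var rWord + e))

theorem cBits_spec {W : ℕ} {P : Par} (hW : P.Fits W) (hn0 : P.n ≠ 0) {s : State} (hs : Ctx P s)
    {e : Expr} {f : ℕ → ℕ} (hf : ∀ t, f t < 2) (hcost : e.cost ≤ 30)
    (he : ∀ t < P.b, ∀ s', Frame [rT, rWord] [] s s' → s'.reg rT = t →
      e.Ok W s' ∧ e.eval s' = f t) :
    wp W (cBits e) (P.b * (50 + 22) + 22 + 4) (fun s' => s'.reg rWord = packBits f P.b) s := by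
  have hlen := hW.len
  have hb : 2 ^ P.b ≤ P.n := by rw [Par.b]; exact Nat.pow_log_le_self 2 hn0
  have hb' : P.b < 2 ^ P.b := Nat.lt_two_pow_self
  refine wp.seq (P.b * (50 + 22) + 22) (wp.assign (τ := 3) le_rfl (by simp; omega) ?_) (by omega)
  have f₀ : Frame [rWord] [] s (s.put rWord ((Expr.lit 0).eval s)) :=
    (Frame.refl _ _ _).put _ (by simp)
  refine wp.forVar (N := P.b) (τ' := 50) (fun m s' => s'.reg rWord = packBits f m) le_rfl (by omega)
    (hs.frame f₀).b (by simp [packBits]) ?_ (by simp [Cmd.regs]) (by simp [Cmd.regs])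
  intro m hm s₁ f₁ hx hI
  obtain ⟨ho, hv⟩ := he m hm s₁ ((f₀.mono (by simp) (by simp)).trans (f₁.mono (by
    simp [Cmd.regs]) (by simp [Cmd.arrs]))) hx
  have h₁ := packBits_lt hf m
  have h₂ : 2 ^ m ≤ 2 ^ P.b := Nat.pow_le_pow_right (by norm_num) hm.le
  have h₃ := hf m
  have ec : (Expr.lit 2 * Expr.var rWord + e).cost = 1 + 1 + 3 + e.cost + 3 := rfl
  refine wp.assign (by omega) ?_ ?_
  · simp only [Expr.ok_add, Expr.ok_mul, Expr.ok_lit, Expr.ok_var, ho, Expr.eval_lit, Expr.eval_var,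
      Expr.eval_mul, hI, hv, true_and]
    omega
  · simp [hI, hv, packBits]

/-- Pack the verification examples. -/
def cPack : Cmd :=
  .for rQ (.var rN) <| .for rC (.var rChunks) <|
    .seq (cBits (.bit (.var rTrain + .var rC * .var rBits + .var rT) (.var rQ)))
      (.store aPack (.var rQ * .var rChunks + .var rC) (.var rWord))

theorem cPack_spec {W : ℕ} {P : Par} (hW : P.Fits W) (hn0 : P.n ≠ 0) {s : State} (hs : Ctx P s) :
    wp W cPack (P.n * (P.kc * (P.b * (50 + 22) + 22 + 50 + 22) + 22 + 22) + 22)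
      (fun s' => ∀ q < P.n, ∀ c < P.kc, s'.arr aPack (q * P.kc + c) =
        packBits (fun t => s.exX (P.mB + c * P.b + t) q) P.b) s := by
  have hlen := hW.len
  have htot := hW.total
  have hpack := hW.pack
  have hkc : P.kc + 1 < W := by nlinarith
  refine wp.forVar (N := P.n) (fun m s' => ∀ q < m, ∀ c < P.kc, s'.arr aPack (q * P.kc + c) =
        packBits (fun t => s.exX (P.mB + c * P.b + t) q) P.b) le_rfl (by omega) hs.n (by simp) ?_
  intro q hq s₁ f₁ hx hI
  have c₁ := hs.frame f₁
  refine (wp.forVar (N := P.kc) (τ' := P.b * (50 + 22) + 22 + 50) (fun m s' =>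
    (∀ q' < q, ∀ c < P.kc, s'.arr aPack (q' * P.kc + c) =
        packBits (fun t => s.exX (P.mB + c * P.b + t) q') P.b) ∧
    ∀ c < m, s'.arr aPack (q * P.kc + c) =
        packBits (fun t => s.exX (P.mB + c * P.b + t) q) P.b) le_rfl hkc c₁.kc
        ⟨by simpa using hI, by simp⟩ ?_).mono (by exact le_rfl) fun s₂ _ h₂ => ?_
  · rintro c hc s₂ f₂ hxc ⟨hJ, hJ'⟩
    have c₂ := c₁.frame f₂
    have eq := (f₂.reg rQ (by decide)).trans hx
    have ex := f₂.exX.trans f₁.exX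
    have hrow := row_lt hq hc
    have hidx : q * P.kc + c < W := by nlinarith
    have hle : q * P.kc ≤ q * P.kc + c := Nat.le_add_right _ _
    refine wp.seq 30 ((cBits_spec hW hn0 c₂ (e := .bit (.var rTrain + .var rC * .var rBits + .var rT) (.var rQ))
      (f := fun t => s.exX (P.mB + c * P.b + t) q)
      (fun t => hs.exX _ _) (by decide) fun t ht s₃ f₃ hxt => ?_).mono le_rfl
      fun s₃ f₃ h₃ => ?_) (by omega)
    · have c₃ := c₂.frame f₃
      have ec := (f₃.reg rC (by decide)).trans hxc
      have eq₃ := (f₃.reg rQ (by decide)).trans eq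
      have hct := row_lt hc ht
      have hcb : c * P.b ≤ c * P.b + t := Nat.le_add_right _ _
      constructor
      · simp [c₃.mB, c₃.b, ec, hxt]; omega
      · simp [c₃.mB, c₃.b, ec, hxt, f₃.exX, ex, eq₃]
    · have c₃ := c₂.frame f₃
      have ec := (f₃.reg rC (by decide)).trans hxc
      have eq₃ := (f₃.reg rQ (by decide)).trans eq
      have ea : s₃.arr aPack = s₂.arr aPack := f₃.arr aPack (by decide)
      refine wp.store (by decide) (by simp [eq₃, c₃.kc, ec]; omega) (by simp) ?_
      simp only [Expr.eval_add, Expr.eval_mul, Expr.eval_var, eq₃, c₃.kc, ec, h₃, State.put_arr]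
      refine ⟨fun q' hq' c' hc' => ?_, fun c' hc' => ?_⟩
      · rw [State.sto_arr_row hc hc', if_neg (by omega), ea]
        exact hJ q' hq' c' hc'
      · rw [State.sto_arr_row hc (by omega)]
        split_ifs with h
        · rw [h.2]
        · rw [ea]; exact hJ' c' (by omega)
  · intro q' hq' c hc
    rw [State.put_arr]
    rcases Nat.lt_succ_iff_lt_or_eq.mp hq' with hq' | rfl
    · exact h₂.1 q' hq' c hc
    · exact h₂.2 c hc

/-- Pack the labels of the verification examples. -/
def cLabels : Cmd :=
  .for rC (.var rChunks) <|
    .seq (cBits (.lab (.var rTrain + .var rC * .var rBits + .var rT)))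
      (.store aLab (.var rC) (.var rWord))

theorem cLabels_spec {W : ℕ} {P : Par} (hW : P.Fits W) (hn0 : P.n ≠ 0) {s : State} (hs : Ctx P s) :
    wp W cLabels (P.kc * (P.b * (50 + 22) + 22 + 50 + 22) + 22)
      (fun s' => ∀ c < P.kc, s'.arr aLab c =
        packBits (fun t => s.exY (P.mB + c * P.b + t)) P.b) s := by
  have htot := hW.total
  have hpack := hW.pack
  have hkc : P.kc + 1 < W := by nlinarith
  refine wp.forVar (N := P.kc) (τ' := P.b * (50 + 22) + 22 + 50) (fun m s' =>
    ∀ c < m, s'.arr aLab c = packBits (fun t => s.exY (P.mB + c * P.b + t)) P.b) (by exact le_rfl) hkc hs.kc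
    (by simp) ?_
  intro c hc s₂ f₂ hxc hJ
  have c₂ := hs.frame f₂
  refine wp.seq 30 ((cBits_spec hW hn0 c₂ (e := .lab (.var rTrain + .var rC * .var rBits + .var rT))
    (f := fun t => s.exY (P.mB + c * P.b + t))
    (fun t => hs.exY _) (by decide) fun t ht s₃ f₃ hxt => ?_).mono le_rfl
    fun s₃ f₃ h₃ => ?_) (by omega)
  · have c₃ := c₂.frame f₃
    have ec := (f₃.reg rC (by decide)).trans hxc
    have hct := row_lt hc ht
    have hcb : c * P.b ≤ c * P.b + t := Nat.le_add_right _ _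
    constructor
    · simp [c₃.mB, c₃.b, ec, hxt]; omega
    · simp [c₃.mB, c₃.b, ec, hxt, f₃.exY, f₂.exY]
  · have ec := (f₃.reg rC (by decide)).trans hxc
    have ea : s₃.arr aLab = s₂.arr aLab := f₃.arr aLab (by decide)
    refine wp.store (by decide) (by simp) (by simp) fun c' hc' => ?_
    simp only [State.put_arr, State.sto_arr, true_and, Expr.eval_var, ec, h₃]
    split_ifs with h
    · rw [h]
    · rw [ea]; exact hJ c' (by omega)

/-- Compute the table of the numbers of ones. -/
def cPop : Cmd :=
  .seq (.assign rKey (.bin .shl (.lit 1) (.var rBits))) <|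
  .for rX (.var rKey)
    (.store aPop (.var rX) (.get aPop (.var rX / .lit 2) + .var rX % .lit 2))

/-- The entry `i` is obtained from the entry `i / 2`. -/
theorem cPop_spec {W : ℕ} {P : Par} (hW : P.Fits W) (hn0 : P.n ≠ 0) {s : State} (hs : Ctx P s)
    (h0 : s.arr aPop 0 = 0) :
    wp W cPop (P.n * (30 + 22) + 22 + 10) (fun s' => ∀ i < 2 ^ P.b, s'.arr aPop i = popCount i) s := by
  have hlen := hW.len
  have hb : 2 ^ P.b ≤ P.n := by rw [Par.b]; exact Nat.pow_log_le_self 2 hn0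
  have hmul : 2 ^ P.b * (30 + 22) ≤ P.n * (30 + 22) := Nat.mul_le_mul_right _ hb
  refine wp.seq (P.n * (30 + 22) + 22) (wp.assign (τ := 7) (by decide)
    (by simp [WordOp.eval, Nat.shiftLeft_eq, hs.b]; omega) ?_) (by omega)
  refine (wp.forVar (N := 2 ^ P.b) (τ' := 30) (fun m s' => s'.arr aPop 0 = 0 ∧
    ∀ i < m, s'.arr aPop i = popCount i) (τ := P.n * (30 + 22) + 22) (by omega) (by omega)
    (by simp [WordOp.eval, Nat.shiftLeft_eq, hs.b]) ⟨by simpa using h0, by simp⟩ ?_).mono le_rfl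
    fun _ _ h => h.2
  rintro m hm s₁ f₁ hx ⟨hI, hI'⟩
  have hv : s₁.arr aPop (m / 2) + m % 2 = popCount m := by
    rw [popCount_eq]
    rcases Nat.eq_zero_or_pos m with rfl | hm0
    · rw [Nat.zero_div, hI]; simp [popCount]
    · rw [hI' _ (by omega)]
  have hpc := popCount_le m
  refine wp.store (by decide) (by simp) ?_ ?_
  · simp [hx, hv]; omega
  · simp only [Expr.eval_add, Expr.eval_get, Expr.eval_div, Expr.eval_mod, Expr.eval_var,
      Expr.eval_lit, hx, hv, State.put_arr, State.sto_arr, true_and]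
    refine ⟨?_, fun i hi => ?_⟩
    · split_ifs with h
      · subst h; simp [popCount]
      · exact hI
    · split_ifs with h
      · rw [h]
      · exact hI' i (by omega)

/-- The first combination of blocks. -/
def cFirst : Cmd :=
  .seq (.for rX (.var rK) (.store aComb (.var rX) (.var rX)))
    (.store aComb (.var rK) (.var rBlocks))

theorem cFirst_spec {W : ℕ} {P : Par} (hW : P.Fits W) {s : State} (hs : Ctx P s) :
    wp W cFirst (P.k * (5 + 22) + 22 + 6)
      (fun s' => ∀ x ≤ P.k, s'.arr aComb x = combSeq P.k P.D 0 x) s := by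
  have hsupp := hW.supp
  refine wp.seq 5 ((wp.forVar (N := P.k) (τ' := 5) (fun m s' => ∀ x < m, s'.arr aComb x = x) le_rfl
    (by omega) hs.k (by simp) ?_).mono le_rfl fun s₁ f₁ h₁ => ?_) le_rfl
  · intro m hm s₁ f₁ hx hI
    refine wp.store (by decide) (by simp) (by simp) fun x hx' => ?_
    simp only [State.put_arr, State.sto_arr, true_and, Expr.eval_var, hx]
    split_ifs with h
    · exact h.symm
    · exact hI x (by omega)
  · have c₁ := hs.frame f₁
    refine wp.store (by decide) (by simp) (by simp) fun x hx => ?_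
    simp only [State.sto_arr, true_and, Expr.eval_var, c₁.k, c₁.D, combSeq]
    by_cases h : x = P.k
    · simp [h]
    · rw [if_neg h, if_pos (by omega), h₁ x (by omega)]

/-- Everything that happens after the examples have been drawn. -/
def cSolve (num den : ℕ) : Cmd :=
  .seq cPack <| .seq cLabels <| .seq cPop <| .seq cFirst <| cMain num den

/-- A bound for the running time of `cSolve`. -/
@[irreducible] def Par.tSolve (P : Par) : ℕ :=
  (P.n * (P.kc * (P.b * (50 + 22) + 22 + 50 + 22) + 22 + 22) + 22) +
    ((P.kc * (P.b * (50 + 22) + 22 + 50 + 22) + 22) + ((P.n * (30 + 22) + 22 + 10) +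
      ((P.k * (5 + 22) + 22 + 6) + P.tMain + 1) + 1) + 1) + 1

open Classical in
theorem cSolve_spec {W : ℕ} {P : Par} (hW : P.Fits W) (hk : 2 ≤ P.k) (hn0 : P.n ≠ 0) {s : State}
    (hs : Ctx P s) (hX : ∀ u q, P.n ≤ q → s.exX u q = 0)
    (ho : ∀ A j, s.arr A j = 0) :
    wp W (cSolve P.num P.den) P.tSolve (fun s' => ∀ j, s'.arr aOut j =
      if Written P s.exX s.exY (P.D.choose P.k) j then 1 else 0) s := by
  rw [Par.tSolve]
  refine wp.seq _ ((cPack_spec hW hn0 hs).mono le_rfl fun s₁ f₁ h₁ => ?_) le_rfl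
  have c₁ := hs.frame f₁
  refine wp.seq _ ((cLabels_spec hW hn0 c₁).mono le_rfl fun s₂ f₂ h₂ => ?_) le_rfl
  have c₂ := c₁.frame f₂
  refine wp.seq _ ((cPop_spec hW hn0 c₂ ?_).mono le_rfl fun s₃ f₃ h₃ => ?_) le_rfl
  · rw [f₂.arr aPop (by decide), f₁.arr aPop (by decide)]; exact ho _ _
  have c₃ := c₂.frame f₃
  refine wp.seq _ ((cFirst_spec hW c₃).mono le_rfl fun s₄ f₄ h₄ => ?_) le_rfl
  have c₄ := c₃.frame f₄
  have ex := f₄.exX.trans (f₃.exX.trans (f₂.exX.trans f₁.exX))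
  have ey := f₄.exY.trans (f₃.exY.trans (f₂.exY.trans f₁.exY))
  refine (cMain_spec hW hk hn0 c₄ ⟨?_, ?_, ?_⟩ (by rw [ex]; exact hX) h₄ ?_).mono le_rfl
    fun s₅ _ h₅ => by rwa [ex, ey] at h₅
  · rw [f₄.arr aPack (by decide), f₃.arr aPack (by decide), f₂.arr aPack (by decide), ex]
    exact h₁
  · rw [f₄.arr aLab (by decide), f₃.arr aLab (by decide), ey]
    rw [f₁.exY] at h₂
    exact h₂
  · rw [f₄.arr aPop (by decide)]
    exact h₃
  · rw [f₄.arr aOut (by decide), f₃.arr aOut (by decide), f₂.arr aOut (by decide),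
      f₁.arr aOut (by decide)]
    exact ho _

/-! ### Drawing the examples -/

section draws
variable {n : ℕ}

/-- The law of `M` independent examples. -/
def iid (p : PMF (Sample n)) : (M : ℕ) → PMF (Fin M → Sample n)
  | 0 => PMF.pure Fin.elim0
  | M + 1 => p.bind fun z => (iid p M).bind fun zs => PMF.pure (Fin.cons z zs)

/-- The sequentially drawn examples have the product law. -/
theorem iid_apply (p : PMF (Sample n)) : ∀ (M : ℕ) (z : Fin M → Sample n),
    iid p M z = ∏ i, p (z i)
  | 0, z => by
    rw [iid, Subsingleton.elim z Fin.elim0]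
    simp
  | M + 1, z => by
    classical
    rw [iid, PMF.bind_apply, Fin.prod_univ_succ, tsum_fintype, Finset.sum_eq_single (z 0)]
    · rw [PMF.bind_apply, tsum_fintype, Finset.sum_eq_single (Fin.tail z)]
      · rw [iid_apply, PMF.pure_apply, if_pos (Fin.cons_self_tail z).symm, mul_one]; rfl
      · intro w _ hw
        rw [PMF.pure_apply, if_neg, mul_zero]
        intro h
        exact hw (by rw [h, Fin.tail_cons])
      · simp
    · intro w _ hw
      rw [PMF.bind_apply, tsum_fintype, Finset.sum_eq_zero, mul_zero]
      intro v _
      rw [PMF.pure_apply, if_neg, mul_zero]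
      intro h
      exact hw (by rw [h, Fin.cons_zero])
    · simp

/-- The bits of the vectors of a list of examples, as the machine sees them. -/
def bitsX {M : ℕ} (z : Fin M → Sample n) (u j : ℕ) : ℕ :=
  if h : u < M then if hj : j < n then ((z ⟨u, h⟩).1 ⟨j, hj⟩).val else 0 else 0

/-- The labels of a list of examples, as the machine sees them. -/
def bitsY {M : ℕ} (z : Fin M → Sample n) (u : ℕ) : ℕ :=
  if h : u < M then (z ⟨u, h⟩).2.val else 0

/-- Draw as many examples as register `2 * rTotal` says, counting that register down. -/
def drawLoop : Prog :=
  .loop (2 * rTotal) (.seq .draw (.seq (.const 1 1) (.op .sub (2 * rTotal) (2 * rTotal) 1)))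

/-- The effect of drawing examples on the memory. -/
def drawAll (W : ℕ) : (M : ℕ) → State → (Fin M → Sample n) → State
  | 0, σ, _ => σ
  | M + 1, σ, z =>
    drawAll W M (((σ.push (z 0)).set W 1 1).set W (2 * rTotal) M) (Fin.tail z)

/-- Drawing in a loop commutes with the rest of the run: one may draw all examples beforehand.  One
iteration takes six steps, and the final test takes one. -/
theorem run_drawLoop {W : ℕ} (hW : 1 < W) (p : PMF (Sample n)) (K : List Prog) (T : ℕ) :
    ∀ (M : ℕ) (σ : State), σ.reg (2 * rTotal) = M → M < W →
      run W p (6 * M + 1 + T) (drawLoop :: K, σ) =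
        (iid p M).bind fun z => run W p T (K, drawAll W M σ z)
  | 0, σ, h, _ => by
    rw [iid, PMF.pure_bind, drawAll, show 6 * 0 + 1 + T = T + 1 by ring, run, drawLoop, step, h,
      PMF.pure_bind]
    rfl
  | M + 1, σ, h, hM => by
    have e : 6 * (M + 1) + 1 + T = (6 * M + 1 + T) + 1 + 1 + 1 + 1 + 1 + 1 := by ring
    rw [e, iid, PMF.bind_bind, run, drawLoop, step, h, if_pos (Nat.succ_ne_zero M), PMF.pure_bind,
      run, step, PMF.pure_bind, run, step, PMF.bind_bind]
    congr 1
    funext z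
    rw [PMF.bind_bind, PMF.pure_bind, run, step, PMF.pure_bind, run, step, PMF.pure_bind, run, step,
      PMF.pure_bind]
    have hv : WordOp.sub.eval (((σ.push z).set W 1 1).reg (2 * rTotal))
        (((σ.push z).set W 1 1).reg 1) = M := by
      simp [WordOp.eval, State.set, State.push, Nat.mod_eq_of_lt hW] at h ⊢
      omega
    rw [hv]
    refine (run_drawLoop hW p K T M _ ?_ (by omega)).trans ?_
    · simp [State.set, Nat.mod_eq_of_lt (show M < W by omega)]
    · simp only [PMF.pure_bind]
      rfl

theorem Bounded.push {W : ℕ} (hW : 1 < W) {σ : State} (h : Bounded W σ) (z : Sample n) :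
    Bounded W (σ.push z) := by
  have hz : ∀ a : ZMod 2, a.val < W := fun a => (ZMod.val_lt a).trans_le hW
  refine ⟨h.reg, h.arr, fun i j => ?_, fun i => ?_⟩
  · simp only [State.push, Function.update_apply]
    split_ifs
    · dsimp only
      split_ifs
      · exact hz _
      · omega
    · exact h.exX i j
  · simp only [State.push, Function.update_apply]
    split_ifs
    · exact hz _
    · exact h.exY i

theorem Bounded.drawAll {W : ℕ} (hW : 1 < W) : ∀ (M : ℕ) {σ : State} (_ : Bounded W σ)
    (z : Fin M → Sample n), Bounded W (drawAll W M σ z)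
  | 0, _, h, _ => h
  | M + 1, _, h, z => Bounded.drawAll hW M (((h.push hW (z 0)).set _ _).set _ _) (Fin.tail z)

theorem drawAll_spec (W : ℕ) : ∀ (M : ℕ) (σ : State) (z : Fin M → Sample n),
    (drawAll W M σ z).arr = σ.arr ∧ (drawAll W M σ z).drawn = σ.drawn + M ∧
    (∀ r, r ≠ rTotal → (drawAll W M σ z).reg (2 * r) = σ.reg (2 * r)) ∧
    (∀ u j, (drawAll W M σ z).exX u j =
      if σ.drawn ≤ u ∧ u < σ.drawn + M then bitsX z (u - σ.drawn) j else σ.exX u j) ∧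
    ∀ u, (drawAll W M σ z).exY u =
      if σ.drawn ≤ u ∧ u < σ.drawn + M then bitsY z (u - σ.drawn) else σ.exY u
  | 0, σ, z => by
    simp [drawAll]
  | M + 1, σ, z => by
    obtain ⟨h₁, h₂, h₃, h₄, h₅⟩ :=
      drawAll_spec W M (((σ.push (z 0)).set W 1 1).set W (2 * rTotal) M) (Fin.tail z)
    have hd : (((σ.push (z 0)).set W 1 1).set W (2 * rTotal) M).drawn = σ.drawn + 1 := rfl
    rw [hd] at h₂ h₄ h₅
    have ex : (((σ.push (z 0)).set W 1 1).set W (2 * rTotal) M).exX = Function.update σ.exX σ.drawn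
      (fun j => if h : j < n then ((z 0).1 ⟨j, h⟩).val else 0) := rfl
    have ey : (((σ.push (z 0)).set W 1 1).set W (2 * rTotal) M).exY =
      Function.update σ.exY σ.drawn (z 0).2.val := rfl
    rw [ex] at h₄
    rw [ey] at h₅
    refine ⟨h₁, by rw [drawAll, h₂]; ring, fun r hr => ?_, fun u j => ?_, fun u => ?_⟩
    · rw [drawAll, h₃ r hr]
      simp only [State.set, State.push, Function.update_apply]
      rw [if_neg (by omega), if_neg (by omega)]
    · rw [drawAll, h₄]
      by_cases hu : u = σ.drawn
      · subst hu
        simp [bitsX]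
      · obtain ⟨v, rfl⟩ | hlt : (∃ v, u = σ.drawn + 1 + v) ∨ u < σ.drawn := by
          rcases Nat.lt_or_ge u σ.drawn with h | h
          · exact Or.inr h
          · exact Or.inl ⟨u - (σ.drawn + 1), by omega⟩
        · rw [show σ.drawn + 1 + v - (σ.drawn + 1) = v by omega,
            show σ.drawn + 1 + v - σ.drawn = v + 1 by omega]
          by_cases hv : v < M
          · rw [if_pos (by omega), if_pos (by omega)]
            simp [bitsX, hv, Fin.tail]
          · rw [if_neg (by omega), if_neg (by omega), Function.update_of_ne hu]
        · rw [if_neg (by omega), if_neg (by omega), Function.update_of_ne hu]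
    · rw [drawAll, h₅]
      by_cases hu : u = σ.drawn
      · subst hu
        simp [bitsY]
      · obtain ⟨v, rfl⟩ | hlt : (∃ v, u = σ.drawn + 1 + v) ∨ u < σ.drawn := by
          rcases Nat.lt_or_ge u σ.drawn with h | h
          · exact Or.inr h
          · exact Or.inl ⟨u - (σ.drawn + 1), by omega⟩
        · rw [show σ.drawn + 1 + v - (σ.drawn + 1) = v by omega,
            show σ.drawn + 1 + v - σ.drawn = v + 1 by omega]
          by_cases hv : v < M
          · rw [if_pos (by omega), if_pos (by omega)]
            simp [bitsY, hv, Fin.tail]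
          · rw [if_neg (by omega), if_neg (by omega), Function.update_of_ne hu]
        · rw [if_neg (by omega), if_neg (by omega), Function.update_of_ne hu]

theorem bitsX_lt {M : ℕ} (z : Fin M → Sample n) (u j : ℕ) : bitsX z u j < 2 := by
  unfold bitsX
  split_ifs
  · exact ZMod.val_lt _
  · norm_num
  · norm_num

theorem bitsY_lt {M : ℕ} (z : Fin M → Sample n) (u : ℕ) : bitsY z u < 2 := by
  unfold bitsY
  split_ifs
  · exact ZMod.val_lt _
  · norm_num

theorem run_halted (W : ℕ) (p : PMF (Sample n)) (σ : State) :
    ∀ T, run W p T ([], σ) = PMF.pure ([], σ)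
  | 0 => rfl
  | T + 1 => by rw [run, step, PMF.pure_bind, run_halted W p σ T]

end draws

/-! ### The whole program -/

/-- The program which solves the problem.  The variable with number `1` lives in register `2`, so
the input `k` is moved there first. -/
def solver (α κ num den : ℕ) : Prog :=
  .seq (.op .or 2 1 1) <| .seq (cParams α κ).compile <| .seq drawLoop (cSolve num den).compile

/-- The number of examples that the program draws. -/
def Par.samples (P : Par) : ℕ := P.mB + P.kc * P.b

/-- A bound for the running time of the program. -/
def Par.time (P : Par) : ℕ := P.tParams + 6 * P.samples + P.tSolve + 5

open Classical in
/-- The program is correct with the required probability if the function `Written` of independent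
examples recovers the secret; the bounds for time and examples hold for all outcomes. -/
theorem solves_solver {P : Par} {w : ℕ} (hW : P.Fits (2 ^ w)) (hk : 2 ≤ P.k) (hn0 : P.n ≠ 0)
    {η : ℝ≥0} (hη : η ≤ 1)
    (h : ∀ secret : Fin P.n → ZMod 2, hammingNorm secret ≤ P.k → 9 / 10 ≤
      (iid (sampleLaw η hη secret) P.samples).toOuterMeasure
        {z | ∀ j : Fin P.n, Written P (bitsX z) (bitsY z) (P.D.choose P.k) j ↔ secret j = 1}) :
    Solves (solver P.α P.κ P.num P.den) w P.n P.k η hη P.time P.samples := by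
  have hkW := hW.len
  have hWW : 1 < 2 ^ w := by omega
  have htot := hW.total
  have hsupp := hW.supp
  intro secret hs
  set p := sampleLaw η hη secret
  -- the memory after the input has been moved
  set σ₀ : State := (init (solver P.α P.κ P.num P.den) P.n P.k).2 with hσ₀
  have hb₀ : Bounded (2 ^ w) σ₀ := by
    refine ⟨fun r => ?_, fun _ _ => by simp [hσ₀, init], fun _ _ => by simp [hσ₀, init],
      fun _ => by simp [hσ₀, init]⟩
    simp only [hσ₀, init]
    split_ifs <;> omega
  set σ₁ := σ₀.set (2 ^ w) 2 P.k with hσ₁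
  have hb₁ : Bounded (2 ^ w) σ₁ := hb₀.set _ _
  set s₁ : State := { σ₁ with reg := fun r => σ₁.reg (2 * r) } with hs₁
  have hsim₁ : Sim (2 ^ w) σ₁ s₁ := ⟨hb₁, fun _ => rfl, rfl, rfl, rfl, rfl⟩
  have hz : (∀ A j, s₁.arr A j = 0) ∧ (∀ i j, s₁.exX i j = 0) ∧ (∀ i, s₁.exY i = 0) ∧
      s₁.drawn = 0 ∧ s₁.reg rN = P.n ∧ s₁.reg rK = P.k := by
    refine ⟨fun _ _ => rfl, fun _ _ => rfl, fun _ => rfl, rfl, rfl, ?_⟩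
    simp only [hs₁, hσ₁, State.set]
    rw [Function.update_self, Nat.mod_eq_of_lt (by omega)]
  obtain ⟨za, zx, zy, zd, zn, zk⟩ := hz
  obtain ⟨t₂, s₂, ht₂, hx₂, hc₂, hr₂⟩ := cParams_spec hW hk hn0 zn zk (by simp [zx]) (by simp [zy])
  have f₂ := hx₂.frame
  obtain ⟨σ₂, r₂, hsim₂⟩ := hx₂.compile hsim₁
    [.seq drawLoop (cSolve P.num P.den).compile]
  have hM : P.samples < 2 ^ w := by rw [Par.samples]; omega
  have e₂ : σ₂.reg (2 * rTotal) = P.samples := by rw [hsim₂.reg, hr₂, Par.samples]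
  -- the solver on the memory that holds the examples
  have key : ∀ z : Fin P.samples → Sample P.n, ∃ t σ, t ≤ P.tSolve ∧
      Reach (2 ^ w) t ([(cSolve P.num P.den).compile], drawAll (2 ^ w) P.samples σ₂ z) ([], σ) ∧
      σ.drawn = P.samples ∧ ∀ j, σ.arr aOut j =
        if Written P (bitsX z) (bitsY z) (P.D.choose P.k) j then 1 else 0 := by
    intro z
    obtain ⟨da, dd, dr, dx, dy⟩ := drawAll_spec (2 ^ w) P.samples σ₂ z
    set σ₃ := drawAll (2 ^ w) P.samples σ₂ z
    have hd₂ : σ₂.drawn = 0 := by rw [hsim₂.drawn, f₂.drawn, zd]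
    rw [hd₂] at dx dy dd
    have hX₂ : ∀ u j, σ₂.exX u j = 0 := fun u j => by rw [hsim₂.exX, f₂.exX, zx]
    have hY₂ : ∀ u, σ₂.exY u = 0 := fun u => by rw [hsim₂.exY, f₂.exY, zy]
    have ex : σ₃.exX = bitsX z := by
      funext u j
      rw [dx, Nat.sub_zero, hX₂]
      split_ifs with hu
      · rfl
      · rw [bitsX, dif_neg (by omega)]
    have ey : σ₃.exY = bitsY z := by
      funext u
      rw [dy, Nat.sub_zero, hY₂]
      split_ifs with hu
      · rfl
      · rw [bitsY, dif_neg (by omega)]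
    set s₃ : State := { σ₃ with reg := fun r => σ₃.reg (2 * r) } with hs₃
    have hsim₃ : Sim (2 ^ w) σ₃ s₃ :=
      ⟨hsim₂.bdd.drawAll hWW _ _, fun _ => rfl, rfl, rfl, rfl, rfl⟩
    have hreg : ∀ r, r ≠ rTotal → s₃.reg r = s₂.reg r := fun r hr => by
      rw [← hsim₂.reg, ← dr r hr]
    have hc₃ : Ctx P s₃ := by
      constructor
      all_goals first
        | (rw [hreg _ (by decide)]; first
            | exact hc₂.n | exact hc₂.k | exact hc₂.l | exact hc₂.b | exact hc₂.keys | exact hc₂.nb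
            | exact hc₂.nf | exact hc₂.kc | exact hc₂.mB | exact hc₂.D)
        | skip
      · intro u j; change σ₃.exX u j < 2; rw [ex]; exact bitsX_lt _ _ _
      · intro u; change σ₃.exY u < 2; rw [ey]; exact bitsY_lt _ _
    obtain ⟨t, s₄, ht, hx, ho⟩ := cSolve_spec hW hk hn0 hc₃ (fun u q hq => by
      change σ₃.exX u q = 0
      rw [ex, bitsX]
      split_ifs
      · omega
      · rfl
      · rfl) (fun A j => by
        change σ₃.arr A j = 0
        rw [da, hsim₂.arr, f₂.arr A (by simp [cParams, cLog, Cmd.for, Cmd.arrs]), za])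
    obtain ⟨σ₄, r₄, hsim₄⟩ := hx.compile hsim₃ []
    refine ⟨t, σ₄, ht, r₄, ?_, fun j => ?_⟩
    · rw [hsim₄.drawn, hx.frame.drawn]
      change σ₃.drawn = _
      rw [dd, zero_add]
    · rw [hsim₄.arr, ho j]
      change (if Written P σ₃.exX σ₃.exY _ j then 1 else 0) = _
      rw [ex, ey]
  choose t σ ht hr hd ho using key
  have hrun : run (2 ^ w) p P.time (init (solver P.α P.κ P.num P.den) P.n P.k) =
      (iid p P.samples).map fun z => ([], σ z) := by
    have r₁ : Reach (2 ^ w) 1 (.op .or 2 1 1 :: [.seq (cParams P.α P.κ).compile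
        (.seq drawLoop (cSolve P.num P.den).compile)], σ₀)
        ([.seq (cParams P.α P.κ).compile
        (.seq drawLoop (cSolve P.num P.den).compile)], σ₁) :=
      Reach.of_step fun _ => by
        simp [step, hσ₀, hσ₁, init, WordOp.eval]
    have r := ((((Reach.seq _ _ [] σ₀).trans r₁).trans (Reach.seq _ _ _ _)).trans r₂).trans
      (Reach.seq _ _ _ _)
    have := r P.n p (6 * P.samples + 1 + (P.tSolve + (P.tParams - t₂)))
    have et : 1 + 1 + 1 + t₂ + 1 + (6 * P.samples + 1 + (P.tSolve + (P.tParams - t₂))) =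
      P.time := by rw [Par.time]; omega
    rw [et] at this
    refine this.trans ?_
    rw [run_drawLoop hWW p _ _ _ _ e₂ hM, ← PMF.bind_pure_comp]
    congr 1
    funext z
    have := hr z P.n p ((P.tSolve - t z) + (P.tParams - t₂))
    rw [← add_assoc, Nat.add_sub_cancel' (ht z)] at this
    exact this.trans (run_halted _ _ _ _)
  rw [hrun]
  refine ⟨fun c hc => ?_, ?_⟩
  · rw [PMF.support_map] at hc
    obtain ⟨z, -, rfl⟩ := hc
    exact ⟨rfl, (hd z).le⟩
  · rw [PMF.toOuterMeasure_map_apply]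
    refine (h secret hs).trans (MeasureTheory.measure_mono fun z hz => ⟨rfl, fun j => ?_⟩)
    have h2 : ∀ a : ZMod 2, (if a = 1 then 1 else 0) = a.val := by decide
    change (σ z).arr aOut j = _
    rw [ho, ← h2 (secret j)]
    exact if_congr (hz j) rfl rfl

/-! ### Products of finite probability spaces -/

section product_space
variable {S ι κ A B : Type*} [Fintype S] [Fintype ι] [Fintype κ] [Fintype A] [Fintype B]
  [DecidableEq ι] [DecidableEq κ] [DecidableEq A] [DecidableEq B]

/-- The mean of `f` when the coordinates of its argument are independent with weights `p`. -/
def mean (p : S → ℝ) (f : (ι → S) → ℝ) : ℝ := ∑ z, (∏ i, p (z i)) * f z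

open Classical in
/-- The probability of the event `E` when the coordinates are independent with weights `p`. -/
def prob (p : S → ℝ) (E : (ι → S) → Prop) : ℝ := mean p fun z => if E z then 1 else 0

theorem mean_mono {p : S → ℝ} (hp : ∀ s, 0 ≤ p s) {f g : (ι → S) → ℝ} (h : ∀ z, f z ≤ g z) :
    mean p f ≤ mean p g :=
  Finset.sum_le_sum fun z _ => mul_le_mul_of_nonneg_left (h z) (Finset.prod_nonneg fun _ _ => hp _)

theorem mean_const {p : S → ℝ} (h1 : ∑ s, p s = 1) (a : ℝ) :
    mean p (fun _ : ι → S => a) = a := by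
  have : ∑ z : ι → S, ∏ i, p (z i) = 1 := by
    rw [← Fintype.piFinset_univ, ← Finset.prod_univ_sum, h1, Finset.prod_const_one]
  rw [mean, ← Finset.sum_mul, this, one_mul]

theorem mean_add (p : S → ℝ) (f g : (ι → S) → ℝ) :
    mean p (fun z => f z + g z) = mean p f + mean p g := by
  simp only [mean, mul_add, Finset.sum_add_distrib]

theorem mean_const_mul (p : S → ℝ) (a : ℝ) (f : (ι → S) → ℝ) :
    mean p (fun z => a * f z) = a * mean p f := by
  simp only [mean, Finset.mul_sum]
  exact Finset.sum_congr rfl fun z _ => by ring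

/-- Only the coordinates on which a function depends matter. -/
theorem mean_comp {p : S → ℝ} (h1 : ∑ s, p s = 1) {e : κ → ι} (he : e.Injective)
    (f : (κ → S) → ℝ) : mean p (fun z : ι → S => f fun x => z (e x)) = mean p f := by
  classical
  have e₁ : mean p (fun z : ι → S => f fun x => z (e x)) =
      ∑ w : ({i // i ∈ Set.range e} → S) × ({i // ¬ i ∈ Set.range e} → S),
        (∏ i, p (w.1 i)) * f (fun x => w.1 ⟨e x, x, rfl⟩) * ∏ i, p (w.2 i) := by
    rw [mean]
    refine Fintype.sum_equiv (Equiv.piEquivPiSubtypeProd (fun i => i ∈ Set.range e) fun _ : ι => S)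
      _ _ fun z => ?_
    rw [← Fintype.prod_subtype_mul_prod_subtype (fun i => i ∈ Set.range e)]
    simp only [Equiv.piEquivPiSubtypeProd_apply]
    convert mul_right_comm _ _ _
  have e₂ : ∑ w : {i // ¬ i ∈ Set.range e} → S, ∏ i, p (w i) = 1 := by
    rw [← Fintype.piFinset_univ, ← Finset.prod_univ_sum, h1, Finset.prod_const_one]
  rw [e₁, Fintype.sum_prod_type]
  simp only [← Finset.mul_sum, e₂, mul_one]
  rw [mean]
  refine (Fintype.sum_equiv ((Equiv.ofInjective e he).arrowCongr (Equiv.refl S)) _ _ fun z => ?_).symm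
  congr 1
  · exact Fintype.prod_equiv (Equiv.ofInjective e he) _ _ fun i => by simp
  · congr 1
    funext x
    have : (⟨e x, x, rfl⟩ : {i // i ∈ Set.range e}) = Equiv.ofInjective e he x := rfl
    rw [this]
    simp

/-- Functions of disjoint blocks of coordinates are independent. -/
theorem mean_prod_blocks (p : S → ℝ) (g : (B → S) → ℝ) :
    mean p (fun z : A × B → S => ∏ a, g fun b => z (a, b)) = mean p g ^ Fintype.card A := by
  have : mean p g ^ Fintype.card A = ∏ _a : A, mean p g := by
    rw [Finset.prod_const, Finset.card_univ]
  rw [this]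
  simp only [mean]
  rw [Finset.prod_univ_sum, Fintype.piFinset_univ]
  refine Fintype.sum_equiv (Equiv.curry A B S) _ _ fun z => ?_
  rw [Finset.prod_mul_distrib, Fintype.prod_prod_type]
  rfl

/-- Chernoff's bound for a function of disjoint blocks of coordinates. -/
theorem prob_sum_blocks_le {p : S → ℝ} (hp : ∀ s, 0 ≤ p s) (h1 : ∑ s, p s = 1) {e : A × B → ι}
    (he : e.Injective) {f : (B → S) → ℝ} (hf : ∀ x, |f x| ≤ 1) {μ : ℝ} (hμ0 : 0 ≤ μ)
    (hμ : μ ≤ mean p f) :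
    prob p (fun z : ι → S => ∑ a, f (fun b => z (e (a, b))) ≤ 0) ≤
      Real.exp (-(Fintype.card A * (μ ^ 2 / 4))) := by
  classical
  have hμ1 : μ ≤ 1 := hμ.trans ((mean_mono hp fun x => (abs_le.mp (hf x)).2).trans_eq
    (mean_const h1 1))
  -- the exponential moment with parameter `μ / 2`, which minimizes `1 + t ^ 2 - t * μ`
  have hexp : mean p (fun x => Real.exp (-(μ / 2) * f x)) ≤ Real.exp (-(μ ^ 2 / 4)) := by
    have h : ∀ x, Real.exp (-(μ / 2) * f x) ≤ (1 + μ ^ 2 / 4) + -(μ / 2) * f x := fun x => by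
      have hx := hf x
      have hsq : f x ^ 2 ≤ 1 := by rw [← sq_abs]; nlinarith [abs_nonneg (f x)]
      have hle : |-(μ / 2) * f x| ≤ 1 := by
        rw [abs_mul, abs_neg, abs_of_nonneg (by linarith)]
        nlinarith [abs_nonneg (f x)]
      have := (abs_le.mp (Real.abs_exp_sub_one_sub_id_le hle)).2
      nlinarith [mul_le_mul_of_nonneg_left hsq (sq_nonneg (μ / 2))]
    refine (mean_mono hp h).trans ?_
    rw [mean_add, mean_const h1, mean_const_mul]
    have := Real.add_one_le_exp (-(μ ^ 2 / 4))
    nlinarith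
  have hnn : 0 ≤ mean p (fun x => Real.exp (-(μ / 2) * f x)) :=
    (mean_const h1 (0 : ℝ)).symm.le.trans (mean_mono hp fun x => (Real.exp_pos _).le)
  calc prob p (fun z : ι → S => ∑ a, f (fun b => z (e (a, b))) ≤ 0)
      ≤ mean p (fun z : ι → S => ∏ a, Real.exp (-(μ / 2) * f fun b => z (e (a, b)))) := by
        refine mean_mono hp fun z => ?_
        rw [← Real.exp_sum, ← Finset.mul_sum]
        split_ifs with h
        · exact Real.one_le_exp (by nlinarith)
        · exact (Real.exp_pos _).le
    _ = mean p (fun x => Real.exp (-(μ / 2) * f x)) ^ Fintype.card A := by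
        rw [← mean_prod_blocks, ← mean_comp h1 he]
    _ ≤ Real.exp (-(μ ^ 2 / 4)) ^ Fintype.card A := pow_le_pow_left₀ hnn hexp _
    _ = Real.exp (-(Fintype.card A * (μ ^ 2 / 4))) := by
        rw [← Real.exp_nat_mul]; congr 1; ring

theorem prob_le_sum {T : Type*} (s : Finset T) {p : S → ℝ} (hp : ∀ s, 0 ≤ p s)
    {E : (ι → S) → Prop} {F : T → (ι → S) → Prop} (h : ∀ z, E z → ∃ t ∈ s, F t z) :
    prob p E ≤ ∑ t ∈ s, prob p (F t) := by
  classical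
  simp only [prob, mean]
  rw [Finset.sum_comm]
  refine Finset.sum_le_sum fun z _ => ?_
  rw [← Finset.mul_sum]
  refine mul_le_mul_of_nonneg_left ?_ (Finset.prod_nonneg fun i _ => hp _)
  split_ifs with hz
  · obtain ⟨t, ht, hF⟩ := h z hz
    refine le_trans ?_ (Finset.single_le_sum (fun t _ => ?_) ht)
    · rw [if_pos hF]
    · split_ifs <;> norm_num
  · exact Finset.sum_nonneg fun t _ => by split_ifs <;> norm_num

theorem prob_not {p : S → ℝ} (h1 : ∑ s, p s = 1) (E : (ι → S) → Prop) :
    prob p E = 1 - prob p fun z => ¬E z := by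
  have h : prob p E + (prob p fun z => ¬E z) = 1 := by
    rw [prob, prob, ← mean_add]
    refine (congrArg (mean p) (funext fun z => ?_)).trans (mean_const (ι := ι) h1 (1 : ℝ))
    by_cases hz : E z <;> simp [hz]
  linarith

end product_space

/-! ### The signal of one batch -/

/-- The nontrivial character of `ZMod 2`. -/
def sgn (a : ZMod 2) : ℝ := if a = 1 then -1 else 1

theorem zmod_two_cases (a : ZMod 2) : a = 0 ∨ a = 1 := by revert a; decide

@[simp] theorem sgn_zero : sgn 0 = 1 := by simp [sgn]

@[simp] theorem sgn_one : sgn 1 = -1 := by simp [sgn]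

theorem sgn_add (a b : ZMod 2) : sgn (a + b) = sgn a * sgn b := by
  have h : (1 : ZMod 2) + 1 = 0 := by decide
  rcases zmod_two_cases a with rfl | rfl <;> rcases zmod_two_cases b with rfl | rfl <;> simp [h]

theorem sgn_sum {ι : Type*} (s : Finset ι) (f : ι → ZMod 2) :
    sgn (∑ i ∈ s, f i) = ∏ i ∈ s, sgn (f i) := by
  classical
  induction s using Finset.induction_on with
  | empty => simp
  | insert a s ha ih => rw [Finset.sum_insert ha, Finset.prod_insert ha, sgn_add, ih]

theorem sgn_mul_self (a : ZMod 2) : sgn a * sgn a = 1 := by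
  rcases zmod_two_cases a with rfl | rfl <;> simp

theorem sgn_add_one (a : ZMod 2) : sgn (a + 1) = -sgn a := by simp [sgn_add]

theorem abs_sgn (a : ZMod 2) : |sgn a| = 1 := by
  rcases zmod_two_cases a with rfl | rfl <;> simp

section weight
variable {n : ℕ}

/-- The probability of a noise bit. -/
def noiseWeight (η : ℝ) (e : ZMod 2) : ℝ := if e = 1 then η else 1 - η

/-- The probability of an example. -/
def weight (η : ℝ) (s : Fin n → ZMod 2) (z : Sample n) : ℝ :=
  (1 / 2) ^ n * noiseWeight η (z.2 + z.1 ⬝ᵥ s)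

/-- The law of an example in the problem has the density `weight`. -/
theorem toReal_sampleLaw (η : ℝ≥0) (hη : η ≤ 1) (s : Fin n → ZMod 2) (z : Sample n) :
    (sampleLaw η hη s z).toReal = weight η s z := by
  obtain ⟨x, y⟩ := z
  have hsub : ∀ a b c : ZMod 2, a = b + c ↔ c = a + b := by decide
  have h₁ : sampleLaw η hη s (x, y) = ((2 : ℝ≥0∞) ^ n)⁻¹ * noiseLaw η hη (y + x ⬝ᵥ s) := by
    rw [sampleLaw, PMF.bind_apply, tsum_fintype, Finset.sum_eq_single x]
    · rw [PMF.uniformOfFintype_apply, PMF.bind_apply, tsum_fintype,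
        Finset.sum_eq_single (y + x ⬝ᵥ s)]
      · rw [PMF.pure_apply, if_pos, mul_one]
        · simp [ZMod.card]
        · rw [Prod.mk.injEq]
          exact ⟨rfl, (hsub _ _ _).mpr rfl⟩
      · intro e _ he
        rw [PMF.pure_apply, if_neg, mul_zero]
        rw [Prod.mk.injEq]
        rintro ⟨-, h⟩
        exact he ((hsub _ _ _).mp h)
      · simp
    · intro x' _ hx
      rw [PMF.bind_apply, tsum_fintype, Finset.sum_eq_zero, mul_zero]
      intro e _
      rw [PMF.pure_apply, if_neg, mul_zero]
      rw [Prod.mk.injEq]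
      rintro ⟨h, -⟩
      exact hx h.symm
    · simp
  rw [h₁, ENNReal.toReal_mul, weight]
  congr 1
  · simp
  · rw [noiseLaw, PMF.ofFintype_apply, noiseWeight]
    split_ifs
    · simp
    · rw [ENNReal.coe_toReal, NNReal.coe_sub hη, NNReal.coe_one]

theorem noiseWeight_nonneg {η : ℝ} (h0 : 0 ≤ η) (h1 : η ≤ 1) (e : ZMod 2) :
    0 ≤ noiseWeight η e := by
  rw [noiseWeight]; split_ifs <;> linarith

theorem weight_nonneg {η : ℝ} (h0 : 0 ≤ η) (h1 : η ≤ 1) (s : Fin n → ZMod 2) (z : Sample n) :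
    0 ≤ weight η s z :=
  mul_nonneg (by positivity) (noiseWeight_nonneg h0 h1 _)

/-- The character of a multiple of a noisy bit. -/
theorem sum_noiseWeight (η : ℝ) (c a : ZMod 2) :
    ∑ y, noiseWeight η (y + a) * sgn (c * y) = sgn (c * a) * if c = 1 then 1 - 2 * η else 1 := by
  have h : (1 : ZMod 2) + 1 = 0 := by decide
  have hs : ∀ f : ZMod 2 → ℝ, ∑ y, f y = f 0 + f 1 := fun f => Fin.sum_univ_two f
  rw [hs]
  rcases zmod_two_cases c with rfl | rfl <;> rcases zmod_two_cases a with rfl | rfl <;>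
    simp [noiseWeight, h] <;> ring

theorem half_pow_mul_card (n : ℕ) : (1 / 2 : ℝ) ^ n * Fintype.card (Fin n → ZMod 2) = 1 := by
  simp [ZMod.card]

theorem sum_weight (η : ℝ) (s : Fin n → ZMod 2) : ∑ z, weight η s z = 1 := by
  have h := fun x : Fin n → ZMod 2 => sum_noiseWeight η 0 (x ⬝ᵥ s)
  simp only [zero_mul, sgn_zero, mul_one, zero_ne_one, if_false] at h
  rw [Fintype.sum_prod_type]
  simp only [weight, ← Finset.mul_sum, h]
  rw [Finset.sum_const, Finset.card_univ, nsmul_eq_mul, mul_one]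
  convert half_pow_mul_card n using 1

/-- Averaging over the labels: for the fixed vectors `x u`, the labels `y u` are independent noisy
bits. -/
theorem mean_weight {N : ℕ} (η : ℝ) (s : Fin n → ZMod 2)
    (f : (Fin N → Fin n → ZMod 2) → ℝ) (c : (Fin N → Fin n → ZMod 2) → Fin N → ZMod 2) :
    mean (weight η s) (fun z : Fin N → Sample n =>
      f (fun u => (z u).1) * ∏ u, sgn (c (fun u => (z u).1) u * (z u).2)) =
    ((1 / 2) ^ n) ^ N * ∑ x, f x * ∏ u, (sgn (c x u * (x u ⬝ᵥ s)) *
      if c x u = 1 then 1 - 2 * η else 1) := by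
  have e₁ : mean (weight η s) (fun z : Fin N → Sample n =>
      f (fun u => (z u).1) * ∏ u, sgn (c (fun u => (z u).1) u * (z u).2)) =
      ∑ w : (Fin N → Fin n → ZMod 2) × (Fin N → ZMod 2), ((1 / 2) ^ n) ^ N * (f w.1 *
        ∏ u, (noiseWeight η (w.2 u + w.1 u ⬝ᵥ s) * sgn (c w.1 u * w.2 u))) := by
    rw [mean]
    refine Fintype.sum_equiv (Equiv.arrowProdEquivProdArrow (Fin N) (fun _ => Fin n → ZMod 2)
      fun _ => ZMod 2) _ _ fun z => ?_
    simp only [weight, Finset.prod_mul_distrib, Finset.prod_const, Finset.card_univ,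
      Fintype.card_fin, Equiv.arrowProdEquivProdArrow_apply]
    ring
  rw [e₁, Fintype.sum_prod_type, Finset.mul_sum]
  refine Finset.sum_congr rfl fun x _ => ?_
  dsimp only
  rw [← Finset.mul_sum, ← Finset.mul_sum]
  congr 2
  rw [← Finset.prod_congr rfl fun u _ => sum_noiseWeight η (c x u) (x u ⬝ᵥ s),
    Finset.prod_univ_sum, Fintype.piFinset_univ]

/-- The combination `c x` of the vectors is zero on the support of the secret `s` except possibly at
the coordinate `q`, and it is chosen without looking at the coordinate `q`; it involves at most `r`
examples, and at least one.  Then the label of the combination is the value `s q` with a bias, on the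
event that the coordinate `q` of the combination is one, and this event has probability `1 / 2`. -/
theorem half_le_mean_signal {N r : ℕ} {η : ℝ} (h0 : 0 ≤ η) (h1 : η ≤ 1 / 2)
    (s : Fin n → ZMod 2) (q : Fin n) (c : (Fin N → Fin n → ZMod 2) → Fin N → ZMod 2)
    (hc : ∀ x x', (∀ u, ∀ j ≠ q, x u j = x' u j) → c x = c x') (hne : ∀ x, ∃ u, c x u = 1)
    (hr : ∀ x, (Finset.univ.filter fun u => c x u = 1).card ≤ r)
    (hz : ∀ x, ∀ j ≠ q, s j = 1 → ∑ u, c x u * x u j = 0) :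
    (1 - 2 * η) ^ r / 2 ≤ mean (weight η s) (fun z : Fin N → Sample n =>
      (sgn (s q) * if ∑ u, c (fun u => (z u).1) u * (z u).1 q = 1 then 1 else 0) *
        ∏ u, sgn (c (fun u => (z u).1) u * (z u).2)) := by
  have hm := mean_weight (N := N) η s
    (fun x => sgn (s q) * if ∑ u, c x u * x u q = 1 then 1 else 0) c
  rw [hm]
  have hρ0 : 0 ≤ 1 - 2 * η := by linarith
  have hρ1 : 1 - 2 * η ≤ 1 := by linarith
  -- for fixed vectors whose combination has the coordinate `q` equal to one, the label of the
  -- combination is `s q` with at least the bias `(1 - 2 * η) ^ r`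
  have hx : ∀ x : Fin N → Fin n → ZMod 2,
      (if ∑ u, c x u * x u q = 1 then (1 - 2 * η) ^ r else 0) ≤
      (sgn (s q) * if ∑ u, c x u * x u q = 1 then 1 else 0) *
      ∏ u, (sgn (c x u * (x u ⬝ᵥ s)) * if c x u = 1 then 1 - 2 * η else 1) := by
    intro x
    split_ifs with h
    · rw [Finset.prod_mul_distrib, ← sgn_sum, Finset.prod_ite, Finset.prod_const,
        Finset.prod_const_one, mul_one, mul_one]
      have : ∑ u, c x u * (x u ⬝ᵥ s) = s q := by
        simp only [dotProduct, Finset.mul_sum]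
        rw [Finset.sum_comm, Finset.sum_eq_single q]
        · simp only [← mul_assoc]
          rw [← Finset.sum_mul, h, one_mul]
        · intro j _ hj
          simp only [← mul_assoc]
          rw [← Finset.sum_mul]
          rcases zmod_two_cases (s j) with h' | h'
          · rw [h', mul_zero]
          · rw [hz x j hj h', zero_mul]
        · simp
      rw [this, ← mul_assoc, sgn_mul_self, one_mul]
      exact pow_le_pow_of_le_one hρ0 hρ1 (hr x)
    · simp
  -- flipping the coordinate `q` of a vector which occurs in the combination is an involution that
  -- keeps the combination and flips its coordinate `q`
  choose v hv using hne
  have hv' : ∃ v : (Fin N → Fin n → ZMod 2) → Fin N, (∀ x, c x (v x) = 1) ∧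
      ∀ x x', c x = c x' → v x = v x' := by
    classical
    refine ⟨fun x => if h : ∃ u, c x u = 1 then h.choose else v x, fun x => ?_, fun x x' h => ?_⟩
    · have : ∃ u, c x u = 1 := ⟨v x, hv x⟩
      simp only [dif_pos this]
      exact this.choose_spec
    · have h₁ : ∃ u, c x u = 1 := ⟨v x, hv x⟩
      have h₂ : ∃ u, c x' u = 1 := ⟨v x', hv x'⟩
      simp only [dif_pos h₁, dif_pos h₂]
      congr
      rw [h]
  obtain ⟨v, hv, hvc⟩ := hv'
  set fl : Fin N → (Fin N → Fin n → ZMod 2) → (Fin N → Fin n → ZMod 2) := fun u x =>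
    Function.update x u (Function.update (x u) q (x u q + 1)) with hfl
  set flip : (Fin N → Fin n → ZMod 2) → (Fin N → Fin n → ZMod 2) := fun x => fl (v x) x with hflip
  have hfc : ∀ x, c (flip x) = c x := fun x => hc _ _ fun u j hj => by
    by_cases hu : u = v x
    · subst hu; simp [hflip, hfl, hj]
    · simp [hflip, hfl, hu]
  have h2 : ∀ a : ZMod 2, a + 1 + 1 = a := by decide
  have hff : Function.Involutive flip := fun x => by
    have e : flip (flip x) = fl (v (flip x)) (fl (v x) x) := rfl
    rw [e, hvc _ _ (hfc x), hfl]
    simp [h2]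
  have hfs : ∀ x, ∑ u, c (flip x) u * flip x u q = ∑ u, c x u * x u q + 1 := fun x => by
    rw [hfc]
    have h' : ∀ u, c x u * flip x u q = c x u * x u q + if u = v x then 1 else 0 := fun u => by
      by_cases hu : u = v x
      · subst hu; simp [hflip, hfl, hv, mul_add]
      · simp [hflip, hfl, hu]
    simp only [h', Finset.sum_add_distrib]
    simp
  have hhalf : (((1 / 2 : ℝ) ^ n) ^ N) *
      ∑ x : Fin N → Fin n → ZMod 2, (if ∑ u, c x u * x u q = 1 then (1 : ℝ) else 0) = 1 / 2 := by
    have e₁ : ∑ x : Fin N → Fin n → ZMod 2, (if ∑ u, c x u * x u q = 1 then (1 : ℝ) else 0) =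
        ∑ x : Fin N → Fin n → ZMod 2, (if ∑ u, c x u * x u q = 1 then (0 : ℝ) else 1) := by
      refine Fintype.sum_equiv hff.toPerm _ _ fun x => ?_
      rw [Function.Involutive.coe_toPerm, hfs]
      rcases zmod_two_cases (∑ u, c x u * x u q) with h | h <;> rw [h]
      · simp
      · rw [if_pos rfl, if_neg (by decide)]
    have e₂ : ∑ x : Fin N → Fin n → ZMod 2, (if ∑ u, c x u * x u q = 1 then (1 : ℝ) else 0) +
        ∑ x : Fin N → Fin n → ZMod 2, (if ∑ u, c x u * x u q = 1 then (0 : ℝ) else 1) =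
        (2 ^ n) ^ N := by
      rw [← Finset.sum_add_distrib]
      have : ∀ x : Fin N → Fin n → ZMod 2, (if ∑ u, c x u * x u q = 1 then (1 : ℝ) else 0) +
        (if ∑ u, c x u * x u q = 1 then (0 : ℝ) else 1) = 1 := fun x => by split_ifs <;> norm_num
      simp [this, ZMod.card]
    have e₃ : (((1 / 2 : ℝ) ^ n) ^ N) * (2 ^ n) ^ N = 1 := by
      rw [← mul_pow, ← mul_pow]; norm_num
    rw [← e₁, ← two_mul] at e₂
    rw [← e₂] at e₃
    linarith
  calc (1 - 2 * η) ^ r / 2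
      = (((1 / 2 : ℝ) ^ n) ^ N) * ∑ x : Fin N → Fin n → ZMod 2,
          (if ∑ u, c x u * x u q = 1 then (1 - 2 * η) ^ r else 0) := by
        have : ∀ x : Fin N → Fin n → ZMod 2,
          (if ∑ u, c x u * x u q = 1 then (1 - 2 * η) ^ r else 0) =
          (1 - 2 * η) ^ r * if ∑ u, c x u * x u q = 1 then (1 : ℝ) else 0 := fun x => by simp
        simp only [this]
        rw [← Finset.mul_sum, mul_left_comm, hhalf]
        ring
    _ ≤ _ := mul_le_mul_of_nonneg_left (Finset.sum_le_sum fun x _ => hx x) (by positivity)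

/-- The probability that the example is not consistent with `w` is one half unless `w` is the
secret. -/
theorem sum_weight_mul_sgn (η : ℝ) (s w : Fin n → ZMod 2) :
    ∑ z, weight η s z * sgn (z.2 + z.1 ⬝ᵥ w) = if w = s then 1 - 2 * η else 0 := by
  have e₁ : ∀ x : Fin n → ZMod 2, ∑ y, weight η s (x, y) * sgn (y + x ⬝ᵥ w) =
      (1 / 2) ^ n * (1 - 2 * η) * sgn (x ⬝ᵥ (s + w)) := fun x => by
    have h := sum_noiseWeight η 1 (x ⬝ᵥ s)
    simp only [one_mul, if_true] at h
    simp only [weight, sgn_add, dotProduct_add]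
    have : ∀ y, (1 / 2) ^ n * noiseWeight η (y + x ⬝ᵥ s) * (sgn y * sgn (x ⬝ᵥ w)) =
      (1 / 2) ^ n * sgn (x ⬝ᵥ w) * (noiseWeight η (y + x ⬝ᵥ s) * sgn y) := fun y => by ring
    simp only [this]
    rw [← Finset.mul_sum, h]
    ring
  rw [Fintype.sum_prod_type]
  simp only [e₁]
  rw [← Finset.mul_sum]
  have h2 : ∀ a b : ZMod 2, a + b = 0 ↔ b = a := by decide
  split_ifs with h
  · have : s + w = 0 := by funext j; rw [h]; exact (h2 _ _).mpr rfl
    simp only [this, dotProduct_zero, sgn_zero, Finset.sum_const, Finset.card_univ, nsmul_eq_mul,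
      mul_one]
    have := half_pow_mul_card n
    rw [mul_right_comm, this, one_mul]
  · obtain ⟨j, hj⟩ : ∃ j, (s + w) j ≠ 0 := by
      by_contra hcon
      push Not at hcon
      exact h (funext fun j => (h2 _ _).mp (hcon j))
    have hj : (s + w) j = 1 := (zmod_two_cases _).resolve_left hj
    have h₃ : ∑ x, sgn (x ⬝ᵥ (s + w)) = ∑ x, -sgn (x ⬝ᵥ (s + w)) := by
      refine Fintype.sum_equiv (Equiv.addRight (Pi.single j 1)) _ _ fun x => ?_
      rw [Equiv.coe_addRight, add_dotProduct, single_one_dotProduct, hj, sgn_add_one, neg_neg]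
    rw [Finset.sum_neg_distrib] at h₃
    rw [show ∑ x, sgn (x ⬝ᵥ (s + w)) = 0 by linarith, mul_zero]

end weight

/-! ### The value of a batch -/

section batch
variable {n : ℕ}

theorem xorSum_natCast {N : ℕ} {f : ℕ → ℕ} (hf : ∀ u, f u < 2) {L : List ℕ} (hL : ∀ u ∈ L, u < N) :
    (xorSum f L : ZMod 2) = ∑ u : Fin N, (L.count (u : ℕ) : ZMod 2) * (f u : ZMod 2) := by
  rw [xorSum_eq_mod hf, ZMod.natCast_mod, Finset.sum_list_map_count]
  have hsub : L.toFinset ⊆ Finset.range N := fun u hu =>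
    Finset.mem_range.mpr (hL u (List.mem_toFinset.mp hu))
  rw [Finset.sum_subset hsub fun u _ hu => by
    rw [List.count_eq_zero_of_not_mem fun h => hu (List.mem_toFinset.mpr h), zero_smul]]
  simp only [smul_eq_mul, Nat.cast_sum, Nat.cast_mul]
  rw [Finset.sum_range (fun u => ((L.count u : ZMod 2)) * (f u : ZMod 2))]

/-- The vote of a batch: the character of the label if the coordinate in question is one. -/
def vote (v : ℕ) : ℝ := if v = 1 then 1 else if v = 3 then -1 else 0

theorem abs_vote_le (v : ℕ) : |vote v| ≤ 1 := by
  rw [vote]; split_ifs <;> simp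

theorem vote_pair {a b : ℕ} (ha : a < 2) (hb : b < 2) :
    vote (a + 2 * b) = (if (a : ZMod 2) = 1 then 1 else 0) * sgn b := by
  interval_cases a <;> interval_cases b <;> simp [vote]

theorem bitsX_natCast {N : ℕ} (z : Fin N → Sample n) (u : Fin N) (j : Fin n) :
    (bitsX z u j : ZMod 2) = (z u).1 j := by
  simp [bitsX]

theorem bitsY_natCast {N : ℕ} (z : Fin N → Sample n) (u : Fin N) :
    (bitsY z u : ZMod 2) = (z u).2 := by
  simp [bitsY]

/-- The combination that is found in a batch does not depend on the labels. -/
theorem relation_batchWord (X : ℕ → ℕ → ℕ) (Y Y' c : ℕ → ℕ) (k l q base N : ℕ) :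
    relation (batchWord X Y c k l q base) l N = relation (batchWord X Y' c k l q base) l N :=
  relation_congr fun u _ i hi => by rw [batchWord, batchWord, if_pos hi, if_pos hi]

/-- The blocks `c` of length `l` contain the support of the secret. -/
def Covers (k l : ℕ) (c : ℕ → ℕ) (s : Fin n → ZMod 2) : Prop :=
  ∀ j : Fin n, s j = 1 → ∃ a < k, ∃ i < l, c a * l + i = j

theorem batchVal_eq {N k l q : ℕ} {X : ℕ → ℕ → ℕ} {Y c : ℕ → ℕ} (hX : ∀ i j, X i j < 2) :
    batchVal X Y c k l q N 0 = xorSum (X · q) (relation (batchWord X Y c k l q 0) l N) +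
      2 * xorSum Y (relation (batchWord X Y c k l q 0) l N) := by
  rw [batchVal, ← xorSum_pair fun u => hX u q]
  refine xorSum_congr fun u _ => ?_
  rw [batchWord, if_neg (lt_irrefl l), zero_add]

/-- In expectation a batch votes for the true value of the coordinate `q` of the secret. -/
theorem half_le_mean_vote {N k l : ℕ} {η : ℝ} (h0 : 0 ≤ η) (h1 : η ≤ 1 / 2) {s : Fin n → ZMod 2}
    {c : ℕ → ℕ} (hc : Covers k l c s) (q : Fin n) (hN : l * 2 ^ k < N) :
    (1 - 2 * η) ^ (2 ^ l) / 2 ≤ mean (weight η s) fun z : Fin N → Sample n =>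
      sgn (s q) * vote (batchVal (bitsX z) (bitsY z) c k l q N 0) := by
  set W : (Fin N → Fin n → ZMod 2) → ℕ → ℕ → ℕ := fun x =>
    batchWord (bitsX fun u => ((x u, 0) : Sample n)) (fun _ => 0) c k l q 0 with hW
  set L : (Fin N → Fin n → ZMod 2) → List ℕ := fun x => relation (W x) l N with hL
  have hword : ∀ (x : Fin N → Fin n → ZMod 2) (u i : ℕ), i < l → W x u i =
      packBits (fun j => if c j * l + i = q then 0 else
        bitsX (fun u => ((x u, 0) : Sample n)) u (c j * l + i)) k := fun x u i hi => by
    simp only [hW, batchWord, if_pos hi, zero_add]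
  have hmask : ∀ (x : Fin N → Fin n → ZMod 2) (u i j : ℕ), (if c j * l + i = q then 0 else
        bitsX (fun u => ((x u, 0) : Sample n)) u (c j * l + i)) < 2 := fun x u i j => by
    split_ifs
    · norm_num
    · exact bitsX_lt _ _ _
  have hspec := fun x => relation_spec (w := W x) (m := k) (l := l) (N := N)
    (fun u i hi => by rw [hword x u i hi]; exact packBits_lt (hmask x u i) k) hN
  refine (half_le_mean_signal h0 h1 s q (fun x u => ((L x).count (u : ℕ) : ZMod 2)) ?_ ?_ ?_
    ?_).trans_eq ?_
  · intro x x' hxx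
    have : L x = L x' := relation_congr fun u hu i hi => by
      rw [hword x u i hi, hword x' u i hi]
      refine packBits_congr fun j _ => ?_
      split_ifs with hq
      · rfl
      · simp only [bitsX, dif_pos hu]
        split_ifs with hn
        · rw [hxx ⟨u, hu⟩ ⟨_, hn⟩ fun h => hq (congrArg Fin.val h)]
        · rfl
    simp only [this]
  · intro x
    obtain ⟨u, hu, hcu, -⟩ := hspec x
    exact ⟨⟨u, hu⟩, by simp only [hL, hcu, Nat.cast_one]⟩
  · intro x
    obtain ⟨-, -, -, -, hlen, -⟩ := hspec x
    rw [← hlen]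
    refine le_trans ?_ (List.toFinset_card_le _)
    refine Finset.card_le_card_of_injOn (fun u : Fin N => (u : ℕ)) (fun u hu => ?_)
      (fun u _ v _ h => Fin.ext h)
    simp only [Finset.coe_filter, Finset.mem_univ, true_and, Set.mem_ofPred_eq] at hu
    refine Finset.mem_coe.mpr (List.mem_toFinset.mpr ?_)
    by_contra hm
    rw [List.count_eq_zero_of_not_mem hm] at hu
    simp at hu
  · intro x j hjq hsj
    obtain ⟨-, -, -, hmem, -, hzero⟩ := hspec x
    obtain ⟨a, ha, i, hi, hai⟩ := hc j hsj
    have h := hzero i hi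
    have e : xorSum (fun u => W x u i) (relation (W x) l N) =
        xorSum (fun u => packBits (fun j => if c j * l + i = q then 0 else
          bitsX (fun u => ((x u, 0) : Sample n)) u (c j * l + i)) k) (relation (W x) l N) :=
      xorSum_congr fun u _ => hword x u i hi
    rw [e, xorSum_packBits fun u => hmask x u i] at h
    have h := packBits_eq_zero h a ha
    have hne : ¬ c a * l + i = q := fun h' => hjq (Fin.ext (hai.symm.trans h'))
    simp only [hai, if_neg (hai ▸ hne)] at h
    have h' := xorSum_natCast (fun u => bitsX_lt (fun u => ((x u, 0) : Sample n)) u j) hmem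
    rw [h, Nat.cast_zero] at h'
    rw [h']
    exact Finset.sum_congr rfl fun u _ => by rw [bitsX_natCast]
  · congr 1
    funext z
    have hrel : relation (batchWord (bitsX z) (bitsY z) c k l q 0) l N = L fun u => (z u).1 :=
      relation_batchWord _ _ _ _ _ _ _ _ _
    obtain ⟨-, -, -, hmem, -, -⟩ := hspec fun u => (z u).1
    rw [batchVal_eq (bitsX_lt z), hrel, vote_pair, xorSum_natCast (fun u => bitsX_lt z u q) hmem,
      xorSum_natCast (bitsY_lt z) hmem, sgn_sum]
    · simp only [bitsX_natCast, bitsY_natCast]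
      rw [mul_assoc]
    · exact xorSum_lt (m := 1) (fun u => bitsX_lt z u q) _
    · exact xorSum_lt (m := 1) (bitsY_lt z) _

/-- The value of a batch depends only on the examples in the batch. -/
theorem batchVal_bits {M N k l q base : ℕ} {c : ℕ → ℕ} (hM : base + N ≤ M) (hN : l * 2 ^ k < N)
    (z : Fin M → Sample n) : batchVal (bitsX z) (bitsY z) c k l q N base =
      batchVal (bitsX fun u : Fin N => z ⟨base + u, by omega⟩)
        (bitsY fun u : Fin N => z ⟨base + u, by omega⟩) c k l q N 0 := by
  have h : ∀ u < N, ∀ i, batchWord (bitsX z) (bitsY z) c k l q base u i =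
      batchWord (bitsX fun u : Fin N => z ⟨base + u, by omega⟩)
        (bitsY fun u : Fin N => z ⟨base + u, by omega⟩) c k l q 0 u i := fun u hu i => by
    simp only [batchWord, bitsX, bitsY, zero_add, dif_pos hu, dif_pos (show base + u < M by omega)]
  rw [batchVal, batchVal, relation_congr fun u hu i _ => h u hu i]
  refine xorSum_congr fun u hu => h u ?_ l
  have hw := relation_spec (w := batchWord (bitsX fun u : Fin N => z ⟨base + u, by omega⟩)
        (bitsY fun u : Fin N => z ⟨base + u, by omega⟩) c k l q 0) (m := k) (l := l) (N := N)
    (fun u i hi => by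
      rw [batchWord, if_pos hi]
      refine packBits_lt (fun j => ?_) k
      split_ifs
      · norm_num
      · exact bitsX_lt _ _ _) hN
  obtain ⟨-, -, -, hmem, -⟩ := hw
  exact hmem u hu

end batch

/-! ### The probability of failure -/

section failure

/-- The indicator vector of a list of coordinates. -/
def indicator (n : ℕ) (L : List ℕ) : Fin n → ZMod 2 := fun j => if (j : ℕ) ∈ L then 1 else 0

theorem coords_nodup {k l D : ℕ} {c : ℕ → ℕ} (hl : 0 < l) (hc : IsComb k D c) :
    (coords c k l).Nodup := by
  have hdiv : ∀ a i, i < l → (c a * l + i) / l = c a := fun a i hi => by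
    rw [add_comm, Nat.add_mul_div_right _ _ hl, Nat.div_eq_of_lt hi, zero_add]
  rw [coords, List.nodup_flatMap]
  refine ⟨fun a _ => List.Nodup.map (fun i j h => by simpa using h) List.nodup_range, ?_⟩
  refine List.Nodup.pairwise_of_forall_ne List.nodup_range fun a ha b hb hab => ?_
  rw [Function.onFun, List.disjoint_left]
  intro x hx hx'
  obtain ⟨i, hi, rfl⟩ := List.mem_map.mp hx
  obtain ⟨j, hj, hij⟩ := List.mem_map.mp hx'
  have h := hdiv b j (List.mem_range.mp hj)
  rw [hij, hdiv a i (List.mem_range.mp hi)] at h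
  exact hab (hc.injOn (by simpa using ha) (by simpa using hb) h)

theorem mem_coords {c : ℕ → ℕ} {k l x : ℕ} :
    x ∈ coords c k l ↔ ∃ a < k, ∃ i < l, c a * l + i = x := by
  simp [coords]

/-- One of the combinations covers the support of a sparse secret. -/
theorem exists_covers {P : Par} (hk : 2 ≤ P.k) {s : Fin P.n → ZMod 2} (hs : hammingNorm s ≤ P.k) :
    ∃ t < P.D.choose P.k, Covers P.k P.l (combSeq P.k P.D t) s := by
  have hl : 0 < P.l := by rw [Par.l]; exact Nat.log_pos (by norm_num) hk
  have hD : P.D = P.n / P.l + P.k := by rw [Par.D]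
  have hkD : P.k ≤ P.D := hD ▸ Nat.le_add_left _ _
  -- the blocks that meet the support, extended to exactly `k` blocks below
  set S : Finset ℕ := (Finset.univ.filter fun j => s j ≠ 0).image fun j : Fin P.n => (j : ℕ) / P.l
  have hS : S ⊆ Finset.range P.D := by
    intro x hx
    obtain ⟨j, -, rfl⟩ := Finset.mem_image.mp hx
    have : (j : ℕ) / P.l ≤ P.n / P.l := Nat.div_le_div_right j.2.le
    rw [Finset.mem_range, hD]
    exact (Nat.lt_add_of_pos_right (by omega)).trans_le (Nat.add_le_add_right this _)
  have hSk : S.card ≤ P.k := Finset.card_image_le.trans hs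
  obtain ⟨U, hSU, hUD, hU⟩ := Finset.exists_subsuperset_card_eq hS hSk
    (by rw [Finset.card_range]; exact hkD)
  obtain ⟨t, ht, himg⟩ := exists_combSeq hkD hUD hU
  refine ⟨t, ht, fun j hj => ?_⟩
  have hjS : (j : ℕ) / P.l ∈ U := hSU (Finset.mem_image.mpr ⟨j, by simp [hj], rfl⟩)
  rw [← himg] at hjS
  obtain ⟨a, ha, hca⟩ := Finset.mem_image.mp hjS
  exact ⟨a, Finset.mem_range.mp ha, (j : ℕ) % P.l, Nat.mod_lt _ hl, by
    rw [hca]; exact Nat.div_add_mod' _ _⟩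

variable {P : Par}

/-- The number of verification examples that contradict the vector `w`. -/
def contradictions (z : Fin P.samples → Sample P.n) (w : Fin P.n → ZMod 2) : ℝ :=
  ∑ v : Fin (P.kc * P.b), (1 - sgn ((z ⟨P.mB + v, by rw [Par.samples]; omega⟩).2 +
    (z ⟨P.mB + v, by rw [Par.samples]; omega⟩).1 ⬝ᵥ w)) / 2

theorem errCount_eq (z : Fin P.samples → Sample P.n) {L : List ℕ} (hL : L.Nodup)
    (hn : ∀ q ∈ L, q < P.n) :
    (errCount P (bitsX z) (bitsY z) L : ℝ) = contradictions z (indicator P.n L) := by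
  rw [errCount, Nat.cast_sum, Finset.sum_range (fun v =>
    ((errBit (bitsX z) (bitsY z) L (P.mB + v) : ℕ) : ℝ)), contradictions]
  refine Finset.sum_congr rfl fun v _ => ?_
  have hbit : ∀ a : ℕ, a < 2 → (a : ℝ) = (1 - sgn (a : ZMod 2)) / 2 := fun a ha => by
    interval_cases a <;> norm_num
  have hxor : ∀ a b : ℕ, a < 2 → b < 2 → ((a ^^^ b : ℕ) : ZMod 2) = a + b := by
    intro a b ha hb
    interval_cases a <;> interval_cases b <;> decide
  have hv : P.mB + v < P.samples := by rw [Par.samples]; omega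
  rw [hbit _ (errBit_lt (bitsX_lt z) (bitsY_lt z) L _), errBit,
    hxor _ _ (bitsY_lt z _) (xorSum_lt (m := 1) (bitsX_lt z _) L),
    xorSum_natCast (bitsX_lt z _) hn]
  have hy := bitsY_natCast z ⟨_, hv⟩
  dsimp only at hy
  rw [hy, dotProduct]
  congr 4
  refine Finset.sum_congr rfl fun j _ => ?_
  have hx := bitsX_natCast z ⟨_, hv⟩ j
  dsimp only at hx
  rw [hx, mul_comm, indicator]
  congr 1
  split_ifs with h
  · rw [List.count_eq_one_of_mem hL h, Nat.cast_one]
  · rw [List.count_eq_zero_of_not_mem h, Nat.cast_zero]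

/-- If the votes identify the secret within the blocks of a covering combination, the secret passes
the verification and no other sparse vector does, then the output is the secret. -/
theorem written_iff (hk : 2 ≤ P.k) (hden : 0 < P.den) {s : Fin P.n → ZMod 2}
    (hs : hammingNorm s ≤ P.k) {t₀ : ℕ} (ht₀ : t₀ < P.D.choose P.k)
    (hc : Covers P.k P.l (combSeq P.k P.D t₀) s) {z : Fin P.samples → Sample P.n}
    (hA : ∀ q : Fin P.n, (q : ℕ) ∈ coords (combSeq P.k P.D t₀) P.k P.l →
      (Chosen P (bitsX z) (bitsY z) (combSeq P.k P.D t₀) q ↔ s q = 1))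
    (hB : contradictions z s ≤ P.num / P.den * (P.kc * P.b : ℕ))
    (hC : ∀ g : Fin P.k → Fin (P.n + 1), indicator P.n (List.ofFn fun i => (g i : ℕ)) ≠ s →
      P.num / P.den * (P.kc * P.b : ℕ) <
        contradictions z (indicator P.n (List.ofFn fun i => (g i : ℕ)))) (j : Fin P.n) :
    Written P (bitsX z) (bitsY z) (P.D.choose P.k) j ↔ s j = 1 := by
  have hl : 0 < P.l := by rw [Par.l]; exact Nat.log_pos (by norm_num) hk
  have hkD : P.k ≤ P.D := by rw [Par.D]; exact Nat.le_add_left _ _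
  have hX : ∀ u q, P.n ≤ q → bitsX z u q = 0 := fun u q hq => by
    rw [bitsX]
    split_ifs
    · omega
    · rfl
    · rfl
  have hnd : ∀ t < P.D.choose P.k,
      (candidate P (bitsX z) (bitsY z) (combSeq P.k P.D t)).Nodup := fun t ht =>
    (coords_nodup hl (combSeq_spec hkD t ht).1).filter _
  have hacc : ∀ t < P.D.choose P.k,
      (errCount P (bitsX z) (bitsY z) (candidate P (bitsX z) (bitsY z) (combSeq P.k P.D t)) *
        P.den ≤ P.num * (P.kc * P.b) ↔ contradictions z (indicator P.n
        (candidate P (bitsX z) (bitsY z) (combSeq P.k P.D t))) ≤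
        P.num / P.den * (P.kc * P.b : ℕ)) := fun t ht => by
    rw [← errCount_eq z (hnd t ht) (lt_of_mem_candidate hX), div_mul_eq_mul_div,
      le_div_iff₀ (by exact_mod_cast hden)]
    exact_mod_cast Iff.rfl
  constructor
  · rintro ⟨t, ht, ⟨hlen, herr⟩, hj⟩
    set L := candidate P (bitsX z) (bitsY z) (combSeq P.k P.D t) with hL
    have hLn : ∀ q ∈ L, q < P.n := lt_of_mem_candidate hX
    -- lists that are shorter than `k` are padded with the coordinate `n`, which has no effect
    have hg : ∀ i : Fin P.k, L.getD i P.n < P.n + 1 := fun i => by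
      by_cases h : (i : ℕ) < L.length
      · rw [List.getD_eq_getElem _ _ h]
        exact (hLn _ (List.getElem_mem h)).trans (Nat.lt_succ_self _)
      · rw [List.getD_eq_default _ _ (not_lt.mp h)]
        exact Nat.lt_succ_self _
    have hind : indicator P.n (List.ofFn fun i => ((⟨L.getD i P.n, hg i⟩ : Fin (P.n + 1)) : ℕ)) =
        indicator P.n L := by
      funext q
      have : (q : ℕ) ∈ List.ofFn (fun i : Fin P.k => L.getD i P.n) ↔ (q : ℕ) ∈ L := by
        rw [List.mem_ofFn]
        constructor
        · rintro ⟨i, hi⟩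
          by_cases h : (i : ℕ) < L.length
          · rw [← hi, List.getD_eq_getElem _ _ h]
            exact List.getElem_mem h
          · rw [List.getD_eq_default _ _ (not_lt.mp h)] at hi
            have := q.2
            omega
        · intro hq
          obtain ⟨i, hi, hiq⟩ := List.mem_iff_getElem.mp hq
          exact ⟨⟨i, hi.trans_le hlen⟩, by
            dsimp only
            rw [List.getD_eq_getElem _ _ hi, hiq]⟩
      simp only [indicator, this]
    by_contra hsj
    have hne : indicator P.n L ≠ s := fun h => hsj (by rw [← h, indicator, if_pos hj])
    have := hC (fun i => ⟨L.getD i P.n, hg i⟩) (by rwa [hind])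
    rw [hind] at this
    exact absurd ((hacc t ht).mp herr) (not_le.mpr this)
  · intro hj
    set L := candidate P (bitsX z) (bitsY z) (combSeq P.k P.D t₀) with hL
    have hLn : ∀ q ∈ L, q < P.n := lt_of_mem_candidate hX
    have hmem : ∀ q : Fin P.n, (q : ℕ) ∈ L ↔ s q = 1 := fun q => by
      rw [hL, candidate, List.mem_filter, decide_eq_true_iff]
      constructor
      · rintro ⟨h₁, h₂⟩; exact (hA q h₁).mp h₂
      · intro h
        have := mem_coords.mpr (hc q h)
        exact ⟨this, (hA q this).mpr h⟩
    have hind : indicator P.n L = s := by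
      funext q
      rw [indicator]
      split_ifs with h
      · exact ((hmem q).mp h).symm
      · exact ((zmod_two_cases _).resolve_right fun h' => h ((hmem q).mpr h')).symm
    refine ⟨t₀, ht₀, ⟨?_, (hacc t₀ ht₀).mpr (by rw [← hL, hind]; exact hB)⟩, (hmem j).mpr hj⟩
    rw [← List.toFinset_card_of_nodup (hnd t₀ ht₀)]
    refine le_trans ?_ hs
    rw [hammingNorm]
    refine Finset.card_le_card_of_surjOn (fun q : Fin P.n => (q : ℕ)) fun q hq => ?_
    have hq : q ∈ L := List.mem_toFinset.mp hq
    refine ⟨⟨q, hLn q hq⟩, ?_, rfl⟩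
    have := (hmem ⟨q, hLn q hq⟩).mp hq
    simp [this]

end failure

section union_bound
variable {P : Par}

/-- The votes for the coordinate `q` are wrong only if they add up to a nonpositive multiple of the
true sign. -/
theorem chosen_iff_of_pos {X : ℕ → ℕ → ℕ} {Y c : ℕ → ℕ} {q : ℕ} {a : ZMod 2}
    (h : 0 < ∑ B : Fin P.nf, sgn a * vote (batchVal X Y c P.k P.l q P.nb ((B : ℕ) * P.nb))) :
    Chosen P X Y c q ↔ a = 1 := by
  have hsum : ∀ m, ∑ B ∈ Finset.range m, vote (batchVal X Y c P.k P.l q P.nb (B * P.nb)) =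
      (batchCount P X Y c q 1 m : ℝ) - batchCount P X Y c q 3 m := by
    intro m
    induction m with
    | zero => simp [batchCount]
    | succ m ih =>
      rw [Finset.sum_range_succ, ih]
      simp only [batchCount, Nat.count_succ, vote]
      by_cases h1 : batchVal X Y c P.k P.l q P.nb (m * P.nb) = 1
      · simp [h1]; ring
      · by_cases h3 : batchVal X Y c P.k P.l q P.nb (m * P.nb) = 3
        · simp [h3]; ring
        · simp [h1, h3]
  rw [← Finset.mul_sum, ← Finset.sum_range fun B => vote (batchVal X Y c P.k P.l q P.nb (B * P.nb)),
    hsum] at h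
  rw [Chosen]
  rcases zmod_two_cases a with rfl | rfl
  · rw [sgn_zero, one_mul, sub_pos, Nat.cast_lt] at h
    exact ⟨fun h' => absurd h' (by omega), fun h' => absurd h' (by decide)⟩
  · rw [sgn_one, neg_one_mul, neg_sub, sub_pos, Nat.cast_lt] at h
    exact ⟨fun _ => rfl, fun _ => h⟩

theorem Par.l_mul_lt_nb (P : Par) : P.l * 2 ^ P.k < P.nb := by
  have h₁ : P.l ≤ P.k := by rw [Par.l]; exact Nat.log_le_self _ _
  rw [Par.nb, two_mul, pow_add]
  exact Nat.mul_lt_mul_of_pos_right (h₁.trans_lt Nat.lt_two_pow_self) (by positivity)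

/-- Voting about one coordinate fails with exponentially small probability. -/
theorem prob_vote_le {η : ℝ} (h0 : 0 ≤ η) (h1 : η ≤ 1 / 2) {s : Fin P.n → ZMod 2} {c : ℕ → ℕ}
    (hc : Covers P.k P.l c s) (q : Fin P.n) :
    prob (weight η s) (fun z : Fin P.samples → Sample P.n =>
      ¬(Chosen P (bitsX z) (bitsY z) c q ↔ s q = 1)) ≤
      Real.exp (-(P.nf * (((1 - 2 * η) ^ (2 ^ P.l) / 2) ^ 2 / 4))) := by
  have hw := weight_nonneg h0 (h1.trans (by norm_num)) s
  have hlt : ∀ x : Fin P.nf × Fin P.nb, (x.1 : ℕ) * P.nb + x.2 < P.samples := fun x => by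
    have h₁ := x.2.2
    have h₂ : ((x.1 : ℕ) + 1) * P.nb ≤ P.nf * P.nb := Nat.mul_le_mul_right _ x.1.2
    rw [add_one_mul] at h₂
    rw [Par.samples, Par.mB]
    omega
  set e : Fin P.nf × Fin P.nb → Fin P.samples := fun x => ⟨x.1 * P.nb + x.2, hlt x⟩ with he
  have hinj : e.Injective := by
    intro x y hxy
    have h := congrArg Fin.val hxy
    simp only [he] at h
    have hpos : 0 < P.nb := by rw [Par.nb]; positivity
    have hd : ∀ x : Fin P.nf × Fin P.nb, ((x.1 : ℕ) * P.nb + x.2) / P.nb = x.1 ∧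
        ((x.1 : ℕ) * P.nb + x.2) % P.nb = x.2 := fun x => by
      rw [add_comm, Nat.add_mul_div_right _ _ hpos, Nat.div_eq_of_lt x.2.2, zero_add,
        Nat.add_mul_mod_self_right, Nat.mod_eq_of_lt x.2.2]
      exact ⟨rfl, rfl⟩
    have h₁ := hd x
    rw [h, (hd y).1, (hd y).2] at h₁
    exact Prod.ext (Fin.ext h₁.1.symm) (Fin.ext h₁.2.symm)
  set f : (Fin P.nb → Sample P.n) → ℝ := fun x =>
    sgn (s q) * vote (batchVal (bitsX x) (bitsY x) c P.k P.l q P.nb 0) with hf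
  have hfb : ∀ x, |f x| ≤ 1 := fun x => by
    rw [hf]
    simp only [abs_mul, abs_sgn, one_mul]
    exact abs_vote_le _
  have hρ : 0 ≤ (1 - 2 * η) ^ (2 ^ P.l) / 2 := div_nonneg (pow_nonneg (by linarith) _) (by norm_num)
  have := prob_sum_blocks_le hw (sum_weight η s) hinj hfb hρ
    (half_le_mean_vote h0 h1 hc q P.l_mul_lt_nb)
  rw [Fintype.card_fin] at this
  refine le_trans (mean_mono hw fun z => ?_) this
  have hz : ¬(Chosen P (bitsX z) (bitsY z) c q ↔ s q = 1) →
      ∑ a, f (fun b => z (e (a, b))) ≤ 0 := by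
    intro h
    by_contra hpos
    refine h (chosen_iff_of_pos (lt_of_lt_of_eq (not_le.mp hpos) (Finset.sum_congr rfl
      fun B _ => ?_)))
    have hB : (B : ℕ) * P.nb + P.nb ≤ P.samples := by
      have h₂ : ((B : ℕ) + 1) * P.nb ≤ P.nf * P.nb := Nat.mul_le_mul_right _ B.2
      rw [add_one_mul] at h₂
      rw [Par.samples, Par.mB]
      omega
    rw [batchVal_bits hB P.l_mul_lt_nb]
  split_ifs with h₁ h₂ h₂
  · exact le_rfl
  · exact absurd (hz h₁) h₂
  · exact zero_le_one
  · exact le_rfl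

/-- A vector whose rate of contradictions has a mean which is separated from `θ` is on the wrong side
of `θ` with exponentially small probability; here `ε` is a sign. -/
theorem prob_contradictions_le {η : ℝ} (h0 : 0 ≤ η) (h1 : η ≤ 1) {s w : Fin P.n → ZMod 2}
    {θ ε μ : ℝ} (hε : ε = 1 ∨ ε = -1) (hθ0 : 0 ≤ θ) (hθ1 : θ ≤ 1) (hμ0 : 0 ≤ μ)
    (hμ : μ ≤ ε * (θ - (1 - if w = s then 1 - 2 * η else 0) / 2)) :
    prob (weight η s) (fun z : Fin P.samples → Sample P.n =>
      ε * (θ * (P.kc * P.b : ℕ) - contradictions z w) ≤ 0) ≤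
      Real.exp (-((P.kc * P.b : ℕ) * (μ ^ 2 / 4))) := by
  have hw := weight_nonneg h0 h1 s
  set e : Fin (P.kc * P.b) × Unit → Fin P.samples := fun x =>
    ⟨P.mB + x.1, by rw [Par.samples]; omega⟩ with he
  have hinj : e.Injective := by
    intro x y hxy
    have h := congrArg Fin.val hxy
    simp only [he] at h
    exact Prod.ext (Fin.ext (by omega)) rfl
  set f : (Unit → Sample P.n) → ℝ := fun x =>
    ε * (θ - (1 - sgn ((x ()).2 + (x ()).1 ⬝ᵥ w)) / 2) with hf
  have hfb : ∀ x, |f x| ≤ 1 := fun x => by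
    rw [hf]
    dsimp only
    rw [abs_mul, show |ε| = 1 by rcases hε with rfl | rfl <;> simp, one_mul, abs_le]
    rcases zmod_two_cases ((x ()).2 + (x ()).1 ⬝ᵥ w) with h | h <;> rw [h] <;> simp <;>
      constructor <;> linarith
  have hmean : mean (weight η s) f = ε * (θ - (1 - if w = s then 1 - 2 * η else 0) / 2) := by
    have e₁ : mean (weight η s) f = ∑ z, weight η s z *
        (ε * (θ - (1 - sgn (z.2 + z.1 ⬝ᵥ w)) / 2)) := by
      rw [mean]
      refine Fintype.sum_equiv (Equiv.funUnique Unit (Sample P.n)) _ _ fun z => ?_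
      rw [Finset.univ_unique, Finset.prod_singleton]
      rfl
    have e₂ : ∀ z : Sample P.n, weight η s z * (ε * (θ - (1 - sgn (z.2 + z.1 ⬝ᵥ w)) / 2)) =
        ε * (θ - 1 / 2) * weight η s z + ε / 2 * (weight η s z * sgn (z.2 + z.1 ⬝ᵥ w)) :=
      fun z => by ring
    rw [e₁]
    simp only [e₂]
    rw [Finset.sum_add_distrib, ← Finset.mul_sum, ← Finset.mul_sum, sum_weight,
      sum_weight_mul_sgn]
    ring
  have := prob_sum_blocks_le hw (sum_weight η s) hinj hfb hμ0 (hμ.trans_eq hmean.symm)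
  rw [Fintype.card_fin] at this
  refine le_of_eq_of_le ?_ this
  congr 1
  funext z
  simp only [hf, he, contradictions]
  rw [← Finset.mul_sum, Finset.sum_sub_distrib, Finset.sum_const, Finset.card_univ,
    Fintype.card_fin, nsmul_eq_mul, mul_comm θ]

theorem prob_or_le {S ι : Type*} [Fintype S] [Fintype ι] [DecidableEq ι] {p : S → ℝ}
    (hp : ∀ s, 0 ≤ p s) (E F : (ι → S) → Prop) :
    prob p (fun z => E z ∨ F z) ≤ prob p E + prob p F := by
  rw [prob, prob, prob, ← mean_add]
  refine mean_mono hp fun z => ?_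
  by_cases hE : E z <;> by_cases hF : F z <;> simp [hE, hF]

/-- The probability that the algorithm fails. -/
theorem prob_failure_le (hk : 2 ≤ P.k) (hden : 0 < P.den) {η : ℝ} (h0 : 0 ≤ η) (h1 : η ≤ 1 / 2)
    {μ : ℝ} (hμ0 : 0 ≤ μ) (hμ₁ : μ ≤ P.num / P.den - η) (hμ₂ : μ ≤ 1 / 2 - P.num / P.den)
    {s : Fin P.n → ZMod 2} (hs : hammingNorm s ≤ P.k) :
    prob (weight η s) (fun z : Fin P.samples → Sample P.n =>
      ¬∀ j : Fin P.n, Written P (bitsX z) (bitsY z) (P.D.choose P.k) j ↔ s j = 1) ≤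
      P.k * P.l * Real.exp (-(P.nf * (((1 - 2 * η) ^ (2 ^ P.l) / 2) ^ 2 / 4))) +
      (1 + (P.n + 1) ^ P.k) * Real.exp (-((P.kc * P.b : ℕ) * (μ ^ 2 / 4))) := by
  classical
  obtain ⟨t₀, ht₀, hc⟩ := exists_covers hk hs
  set c := combSeq P.k P.D t₀ with hcdef
  have hw := weight_nonneg h0 (h1.trans (by norm_num)) s
  have hθ0 : (0 : ℝ) ≤ P.num / P.den := by positivity
  have hθ1 : (P.num / P.den : ℝ) ≤ 1 := by linarith
  set EA : (Fin P.samples → Sample P.n) → Prop := fun z => ∃ q : Fin P.n,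
    (q : ℕ) ∈ coords c P.k P.l ∧ ¬(Chosen P (bitsX z) (bitsY z) c q ↔ s q = 1) with hEA
  set EB : (Fin P.samples → Sample P.n) → Prop := fun z =>
    1 * (P.num / P.den * (P.kc * P.b : ℕ) - contradictions z s) ≤ 0 with hEB
  set vec : (Fin P.k → Fin (P.n + 1)) → Fin P.n → ZMod 2 := fun g =>
    indicator P.n (List.ofFn fun i => (g i : ℕ)) with hvec
  set EC : (Fin P.samples → Sample P.n) → Prop := fun z => ∃ g, vec g ≠ s ∧
    -1 * (P.num / P.den * (P.kc * P.b : ℕ) - contradictions z (vec g)) ≤ 0 with hEC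
  have hsub : ∀ z : Fin P.samples → Sample P.n,
      (¬∀ j : Fin P.n, Written P (bitsX z) (bitsY z) (P.D.choose P.k) j ↔ s j = 1) →
      EA z ∨ EB z ∨ EC z := by
    intro z hz
    by_contra hcon
    push Not at hcon
    obtain ⟨hA, hB, hC⟩ := hcon
    refine hz (written_iff hk hden hs ht₀ hc (fun q hq => ?_) ?_ fun g hg => ?_)
    · by_contra h
      exact hA ⟨q, hq, h⟩
    · have := not_le.mp hB
      linarith
    · by_contra h
      exact hC ⟨g, hg, by linarith⟩
  have hA : prob (weight η s) EA ≤
      P.k * P.l * Real.exp (-(P.nf * (((1 - 2 * η) ^ (2 ^ P.l) / 2) ^ 2 / 4))) := by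
    set T := Finset.univ.filter fun q : Fin P.n => (q : ℕ) ∈ coords c P.k P.l
    have hT : (T.card : ℝ) ≤ P.k * P.l := by
      have : T.card ≤ P.k * P.l := by
        rw [← length_coords c]
        refine le_trans ?_ (List.toFinset_card_le _)
        exact Finset.card_le_card_of_injOn (fun q : Fin P.n => (q : ℕ))
          (fun q hq => by simpa [T] using hq) (fun u _ v _ h => Fin.ext h)
      exact_mod_cast this
    refine (prob_le_sum (F := fun (q : Fin P.n) z =>
      ¬(Chosen P (bitsX z) (bitsY z) c q ↔ s q = 1)) T hw fun z hz => ?_).trans ?_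
    · obtain ⟨q, hq, h⟩ := hz
      exact ⟨q, by simp [T, hq], h⟩
    · refine (Finset.sum_le_card_nsmul _ _ _ fun q _ => prob_vote_le h0 h1 hc q).trans ?_
      rw [nsmul_eq_mul]
      exact mul_le_mul_of_nonneg_right hT (Real.exp_pos _).le
  have hB : prob (weight η s) EB ≤ Real.exp (-((P.kc * P.b : ℕ) * (μ ^ 2 / 4))) :=
    prob_contradictions_le h0 (h1.trans (by norm_num)) (Or.inl rfl) hθ0 hθ1 hμ0
      (by rw [if_pos rfl]; linarith)
  have hC : prob (weight η s) EC ≤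
      (P.n + 1) ^ P.k * Real.exp (-((P.kc * P.b : ℕ) * (μ ^ 2 / 4))) := by
    refine (prob_le_sum (F := fun g z =>
      -1 * (P.num / P.den * (P.kc * P.b : ℕ) - contradictions z (vec g)) ≤ 0)
      (Finset.univ.filter fun g => vec g ≠ s) hw fun z hz => ?_).trans ?_
    · obtain ⟨g, hg, h⟩ := hz
      exact ⟨g, by simp [hg], h⟩
    · refine (Finset.sum_le_card_nsmul _ _ _ fun g hg => prob_contradictions_le h0
        (h1.trans (by norm_num)) (Or.inr rfl) hθ0 hθ1 hμ0 (?_ : μ ≤ _)).trans ?_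
      · rw [if_neg (Finset.mem_filter.mp hg).2]
        linarith
      · rw [nsmul_eq_mul]
        refine mul_le_mul_of_nonneg_right ?_ (Real.exp_pos _).le
        have : (Finset.univ.filter fun g => vec g ≠ s).card ≤ (P.n + 1) ^ P.k := by
          refine (Finset.card_filter_le _ _).trans ?_
          simp
        exact_mod_cast this
  refine (mean_mono hw fun z => ?_).trans ((prob_or_le hw EA _).trans
    (add_le_add hA ((prob_or_le hw EB EC).trans ((add_le_add hB hC).trans_eq ?_))))
  · split_ifs with h₁ h₂ h₂
    · exact le_rfl
    · exact absurd (hsub z h₁) h₂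
    · exact zero_le_one
    · exact le_rfl
  · ring

end union_bound

/-! ### Choice of the constants -/

open Classical in
/-- The passage from the law of the machine's examples to finite sums of real weights. -/
theorem toOuterMeasure_iid {n : ℕ} {η : ℝ≥0} (hη : η ≤ 1) (s : Fin n → ZMod 2) {M : ℕ}
    (E : (Fin M → Sample n) → Prop) :
    (iid (sampleLaw η hη s) M).toOuterMeasure {z | E z} = ENNReal.ofReal (prob (weight η s) E) := by
  rw [PMF.toOuterMeasure_apply_fintype, prob, mean, ENNReal.ofReal_sum_of_nonneg]
  · refine Finset.sum_congr rfl fun z _ => ?_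
    by_cases hz : E z
    · rw [Set.indicator_of_mem (show z ∈ {z | E z} from hz), iid_apply, if_pos hz, mul_one,
        ENNReal.ofReal_prod_of_nonneg fun i _ =>
          weight_nonneg η.coe_nonneg (by exact_mod_cast hη) s (z i)]
      refine Finset.prod_congr rfl fun i _ => ?_
      rw [← toReal_sampleLaw η hη, ENNReal.ofReal_toReal (PMF.apply_ne_top _ _)]
    · rw [Set.indicator_of_notMem (show z ∉ {z | E z} from hz), if_neg hz, mul_zero,
        ENNReal.ofReal_zero]
  · intro z _
    refine mul_nonneg (Finset.prod_nonneg fun i _ =>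
      weight_nonneg η.coe_nonneg (by exact_mod_cast hη) s _) ?_
    split_ifs <;> norm_num

/-- The failure probability is small if there are enough batches and enough verification
examples. -/
theorem failure_le_tenth {P : Par} (hk : 2 ≤ P.k) (hn : 2 ≤ P.n) {η μ : ℝ} (h0 : 0 ≤ η)
    (h1 : η < 1 / 2) (hα : 256 ≤ 2 ^ P.α * (1 - 2 * η) ^ 2) (hκ : 7 ≤ P.κ * (μ ^ 2 / 4)) :
    P.k * P.l * Real.exp (-(P.nf * (((1 - 2 * η) ^ (2 ^ P.l) / 2) ^ 2 / 4))) +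
      (1 + ((P.n : ℝ) + 1) ^ P.k) * Real.exp (-((P.kc * P.b : ℕ) * (μ ^ 2 / 4))) ≤ 1 / 10 := by
  have hρ0 : 0 < 1 - 2 * η := by linarith
  have hρ1 : 1 - 2 * η ≤ 1 := by linarith
  have hk0 : P.k ≠ 0 := by omega
  have hl : 2 ^ P.l ≤ P.k := by rw [Par.l]; exact Nat.pow_log_le_self 2 hk0
  have hlk : P.l ≤ P.k := by rw [Par.l]; exact Nat.log_le_self _ _
  have hb1 : 1 ≤ P.b := by rw [Par.b]; exact Nat.log_pos (by norm_num) hn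
  have hnb : P.n + 1 ≤ 2 ^ (P.b + 1) := by
    rw [Par.b]; exact Nat.lt_pow_succ_log_self (by norm_num) _
  have hA : P.k * P.l * Real.exp (-(P.nf * (((1 - 2 * η) ^ (2 ^ P.l) / 2) ^ 2 / 4))) ≤ 1 / 20 := by
    set x : ℝ := P.nf * (((1 - 2 * η) ^ (2 ^ P.l) / 2) ^ 2 / 4) with hx
    have hnf : (P.nf : ℝ) = (2 ^ P.α) ^ P.k := by rw [Par.nf]; push_cast; rw [pow_mul]
    have hx1 : (256 : ℝ) ^ P.k / 16 ≤ x := by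
      have h₁ : (1 - 2 * η) ^ P.k ≤ (1 - 2 * η) ^ (2 ^ P.l) :=
        pow_le_pow_of_le_one hρ0.le hρ1 hl
      have h₂ : ((1 - 2 * η) ^ P.k) ^ 2 ≤ ((1 - 2 * η) ^ (2 ^ P.l)) ^ 2 :=
        pow_le_pow_left₀ (by positivity) h₁ 2
      have h₃ : (256 : ℝ) ^ P.k ≤ (2 ^ P.α * (1 - 2 * η) ^ 2) ^ P.k :=
        pow_le_pow_left₀ (by norm_num) hα _
      rw [mul_pow, ← pow_mul (1 - 2 * η), mul_comm 2 P.k, pow_mul (1 - 2 * η)] at h₃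
      have h₄ := mul_le_mul_of_nonneg_left h₂ (show (0 : ℝ) ≤ (2 ^ P.α) ^ P.k by positivity)
      rw [hx, hnf]
      linarith
    have hpos : (0 : ℝ) < 256 ^ P.k := by positivity
    have hexp : Real.exp (-x) ≤ 16 / 256 ^ P.k := by
      rw [Real.exp_neg, inv_le_comm₀ (Real.exp_pos _) (by positivity), inv_div]
      exact (hx1.trans (by linarith)).trans (Real.add_one_le_exp x)
    have hkl : (P.k : ℝ) * P.l ≤ 4 ^ P.k := by
      have h₁ : P.k * P.l ≤ 4 ^ P.k := by
        have h₂ : P.k ≤ 2 ^ P.k := Nat.lt_two_pow_self.le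
        calc P.k * P.l ≤ 2 ^ P.k * 2 ^ P.k := Nat.mul_le_mul h₂ (hlk.trans h₂)
          _ = 4 ^ P.k := by rw [← mul_pow]; norm_num
      exact_mod_cast h₁
    have h64 : (4096 : ℝ) ≤ 64 ^ P.k := by
      calc (4096 : ℝ) = 64 ^ 2 := by norm_num
        _ ≤ 64 ^ P.k := pow_le_pow_right₀ (by norm_num) hk
    calc P.k * P.l * Real.exp (-x) ≤ 4 ^ P.k * (16 / 256 ^ P.k) :=
          mul_le_mul hkl hexp (Real.exp_pos _).le (by positivity)
      _ = 16 / 64 ^ P.k := by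
          rw [show (256 : ℝ) = 4 * 64 by norm_num, mul_pow]
          field_simp
      _ ≤ 1 / 20 := by
          rw [div_le_iff₀ (by positivity)]
          linarith
  have hB : (1 + ((P.n : ℝ) + 1) ^ P.k) * Real.exp (-((P.kc * P.b : ℕ) * (μ ^ 2 / 4))) ≤ 1 / 20 := by
    have hkb : 2 ≤ P.k * P.b := by nlinarith
    have h₁ : ((P.n : ℝ) + 1) ^ P.k ≤ 2 ^ (2 * (P.k * P.b)) := by
      have : (P.n + 1) ^ P.k ≤ 2 ^ (2 * (P.k * P.b)) :=
        calc (P.n + 1) ^ P.k ≤ (2 ^ (P.b + 1)) ^ P.k := Nat.pow_le_pow_left hnb _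
          _ ≤ (2 ^ (2 * P.b)) ^ P.k :=
            Nat.pow_le_pow_left (Nat.pow_le_pow_right (by norm_num) (by omega)) _
          _ = 2 ^ (2 * (P.k * P.b)) := by rw [← pow_mul]; congr 1; ring
      exact_mod_cast this
    have h₂ : (1 : ℝ) + (P.n + 1) ^ P.k ≤ 2 * 2 ^ (2 * (P.k * P.b)) := by
      have : (1 : ℝ) ≤ 2 ^ (2 * (P.k * P.b)) := one_le_pow₀ (by norm_num)
      linarith
    have h₃ : Real.exp (-((P.kc * P.b : ℕ) * (μ ^ 2 / 4))) ≤ 1 / 2 ^ (7 * (P.k * P.b)) := by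
      have hm : ((7 * (P.k * P.b) : ℕ) : ℝ) ≤ (P.kc * P.b : ℕ) * (μ ^ 2 / 4) := by
        rw [Par.kc]
        push_cast
        have := mul_le_mul_of_nonneg_left hκ (show (0 : ℝ) ≤ P.k * P.b by positivity)
        linarith
      have h2e : (2 : ℝ) ≤ Real.exp 1 := by have := Real.add_one_le_exp 1; linarith
      rw [Real.exp_neg, inv_eq_one_div]
      refine one_div_le_one_div_of_le (by positivity) ?_
      calc (2 : ℝ) ^ (7 * (P.k * P.b)) ≤ Real.exp 1 ^ (7 * (P.k * P.b)) :=
            pow_le_pow_left₀ (by norm_num) h2e _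
        _ = Real.exp ((7 * (P.k * P.b) : ℕ) : ℝ) := by rw [← Real.exp_nat_mul, mul_one]
        _ ≤ _ := Real.exp_le_exp.mpr hm
    calc _ ≤ 2 * 2 ^ (2 * (P.k * P.b)) * (1 / 2 ^ (7 * (P.k * P.b))) :=
          mul_le_mul h₂ h₃ (Real.exp_pos _).le (by positivity)
      _ = 2 / 2 ^ (5 * (P.k * P.b)) := by
          rw [show 7 * (P.k * P.b) = 2 * (P.k * P.b) + 5 * (P.k * P.b) by ring, pow_add]
          field_simp
      _ ≤ 2 / 2 ^ 10 := by
          refine div_le_div_of_nonneg_left (by norm_num) (by norm_num) ?_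
          exact pow_le_pow_right₀ (by norm_num) (by omega)
      _ ≤ 1 / 20 := by norm_num
  linarith

/-- The constants of the algorithm suit the noise rate `η`. -/
structure Suits (α κ num den : ℕ) (η : ℝ) : Prop where
  den_pos : 0 < den
  batches : 256 ≤ 2 ^ α * (1 - 2 * η) ^ 2
  checks : ∃ μ : ℝ, 0 ≤ μ ∧ μ ≤ num / den - η ∧ μ ≤ 1 / 2 - num / den ∧ 7 ≤ κ * (μ ^ 2 / 4)

/-- The admissible error rate is a rational number strictly between `η` and `1 / 2`. -/
theorem exists_suits {η : ℝ} (h0 : 0 ≤ η) (h1 : η < 1 / 2) : ∃ α κ num den, Suits α κ num den η := by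
  obtain ⟨q, hq₁, hq₂⟩ := exists_rat_btwn h1
  have hq0 : (0 : ℚ) < q := by exact_mod_cast h0.trans_lt hq₁
  have hq : ((q.num.toNat : ℝ) / q.den) = q := by
    have : ((q.num.toNat : ℤ) : ℝ) = q.num := by rw [Int.toNat_of_nonneg (Rat.num_pos.mpr hq0).le]
    rw [Int.cast_natCast] at this
    rw [this, ← Rat.cast_def]
  have hμ : 0 < min ((q : ℝ) - η) (1 / 2 - q) := lt_min (by linarith) (by linarith)
  set μ := min ((q : ℝ) - η) (1 / 2 - q)
  have hρ : 0 < (1 - 2 * η) ^ 2 := pow_pos (by linarith) 2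
  obtain ⟨α, hα⟩ := pow_unbounded_of_one_lt (256 / (1 - 2 * η) ^ 2) (by norm_num : (1 : ℝ) < 2)
  obtain ⟨κ, hκ⟩ := exists_nat_gt (7 / (μ ^ 2 / 4))
  refine ⟨α, κ, q.num.toNat, q.den, q.den_pos, ?_, μ, hμ.le, ?_, ?_, ?_⟩
  · exact ((div_lt_iff₀ hρ).mp hα).le
  · rw [hq]; exact min_le_left _ _
  · rw [hq]; exact min_le_right _ _
  · exact ((div_lt_iff₀ (by positivity)).mp hκ).le

/-- With suitable constants the program solves the problem. -/
theorem solves_of_suits {P : Par} {w : ℕ} (hW : P.Fits (2 ^ w)) (hk : 2 ≤ P.k) (hn : 2 ≤ P.n)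
    {η : ℝ≥0} (h1 : (η : ℝ) < 1 / 2) (hη : η ≤ 1) (hs : Suits P.α P.κ P.num P.den η) :
    Solves (solver P.α P.κ P.num P.den) w P.n P.k η hη P.time P.samples := by
  obtain ⟨hden, hα, μ, hμ0, hμ₁, hμ₂, hκ⟩ := hs
  refine solves_solver hW hk (by omega) hη fun s hs => ?_
  have hp := (prob_failure_le hk hden η.coe_nonneg h1.le hμ0 hμ₁ hμ₂ hs).trans
    (failure_le_tenth hk hn η.coe_nonneg h1 hα hκ)
  have hnot := prob_not (ι := Fin P.samples) (sum_weight (η : ℝ) s) fun z =>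
    ∀ j : Fin P.n, Written P (bitsX z) (bitsY z) (P.D.choose P.k) j ↔ s j = 1
  rw [toOuterMeasure_iid hη s fun z => ∀ j : Fin P.n,
    Written P (bitsX z) (bitsY z) (P.D.choose P.k) j ↔ s j = 1, hnot]
  have h9 : (9 / 10 : ℝ≥0∞) = ENNReal.ofReal (9 / 10) := by
    rw [ENNReal.ofReal_div_of_pos (by norm_num)]
    simp
  rw [h9]
  exact ENNReal.ofReal_le_ofReal (by linarith)

/-! ### Size of the words and running time -/

section bounds
variable {P : Par}

/-- With `N` above `n` and `2 ^ k`, all numbers that occur are bounded by a polynomial in `N`. -/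
theorem Par.fits_of_le {N Q W : ℕ} (hN : 16 ≤ N) (hn : P.n < N) (hk : 2 ^ P.k ≤ N)
    (hc : P.α + P.κ + P.num + P.den + 4 ≤ Q) (hα : N ^ P.α ≤ Q) (hW : Q * Q * N ^ 5 ≤ W) :
    P.Fits W := by
  have hkN : P.k < N := Nat.lt_two_pow_self.trans_le hk
  have hl : P.l ≤ P.k := by rw [Par.l]; exact Nat.log_le_self _ _
  have hb : P.b ≤ P.n := by rw [Par.b]; exact Nat.log_le_self _ _
  have hD : P.D ≤ 2 * N := by
    have := Nat.div_le_self P.n P.l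
    rw [Par.D]; exact (Nat.add_le_add this le_rfl).trans (by omega)
  have hnb : P.nb ≤ N * N := by
    rw [Par.nb, two_mul, pow_add]; exact Nat.mul_le_mul hk hk
  have hmB : P.mB ≤ Q * (N * N) := by
    rw [Par.mB]
    refine Nat.mul_le_mul (le_trans ?_ hα) hnb
    rw [Par.nf, mul_comm, pow_mul]
    exact Nat.pow_le_pow_left hk _
  have hkc : P.kc ≤ Q * N := by
    rw [Par.kc]; exact Nat.mul_le_mul (by omega) hkN.le
  have hQ : 4 ≤ Q := by omega
  have hkcb : P.kc * P.b ≤ Q * N * N := Nat.mul_le_mul hkc (by omega)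
  have hQN : 16 * (Q * Q) * (N * N * N) * 16 ≤ W := by
    refine le_trans ?_ hW
    calc 16 * (Q * Q) * (N * N * N) * 16 = Q * Q * (16 * 16 * (N * N * N)) := by ring
      _ ≤ Q * Q * (N * N * (N * N * N)) := by gcongr
      _ = Q * Q * N ^ 5 := by ring
  obtain ⟨q, rfl⟩ : ∃ q, Q = q + 1 := ⟨Q - 1, by omega⟩
  obtain ⟨m, rfl⟩ : ∃ m, N = m + 1 := ⟨N - 1, by omega⟩
  have key : ∀ {a b x y : ℕ}, a ≤ x → b ≤ y →
      x * y < 16 * ((q + 1) * (q + 1)) * ((m + 1) * (m + 1) * (m + 1)) * 16 → a * b < W :=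
    fun ha hb h => (Nat.mul_le_mul ha hb).trans_lt (h.trans_le hQN)
  have key' : ∀ {a x : ℕ}, a ≤ x →
      x < 16 * ((q + 1) * (q + 1)) * ((m + 1) * (m + 1) * (m + 1)) * 16 → a < W :=
    fun ha h => ha.trans_lt (h.trans_le hQN)
  constructor
  · refine key (x := (m + 1) * (m + 1) + 1) (y := m + 3) (by omega) (by omega) ?_
    ring_nf; omega
  · refine key (x := 2 * (m + 1) + 1) (y := m + 2) (by omega) (by omega) ?_
    ring_nf; omega
  · refine key' (x := (q + 1) * ((m + 1) * (m + 1)) + (q + 1) * (m + 1) * (m + 1) + 2)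
      (by omega) ?_
    ring_nf; omega
  · refine key' (x := 2 * (m + 1) + 2) (by rw [Par.keys]; omega) ?_
    ring_nf; omega
  · refine key (x := m + 3) (y := (q + 1) * (m + 1) + 1) (by omega) (by omega) ?_
    ring_nf; omega
  · refine key' (x := 2 * (m + 1) + 4) (by omega) ?_
    ring_nf; omega
  · have : P.k * P.l ≤ (m + 1) * (m + 1) := Nat.mul_le_mul hkN.le (by omega)
    refine key' (x := (m + 1) * (m + 1) + m + 1 + 2) (by omega) ?_
    ring_nf; omega
  · refine key (x := (q + 1) * (m + 1) * (m + 1) + 1) (y := q + 1) (by omega) (by omega) ?_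
    ring_nf; omega
  · have : (P.α + P.κ + 2) * P.k ≤ (q + 1) * (m + 1) := Nat.mul_le_mul (by omega) hkN.le
    refine key' (x := (q + 1) * (m + 1) + 4) (by omega) ?_
    ring_nf; omega
  · refine key' (x := q + 1) (by omega) ?_
    ring_nf; omega

/-- A multiple of `k + log n` is a sufficient word length. -/
theorem Par.fits (hn : 2 ≤ P.n) (hk : 2 ≤ P.k) :
    P.Fits (2 ^ ((4 * (P.α + P.κ + P.num + P.den) + 20) * (P.k + P.n.size))) := by
  set c := P.α + P.κ + P.num + P.den with hc
  set X := P.k + P.n.size with hX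
  have hs : P.n < 2 ^ P.n.size := Nat.lt_size_self _
  have hs2 : 2 ≤ P.n.size := by
    have : 1 < P.n.size := Nat.lt_size.mpr (by simpa using hn)
    exact this
  have hN : 16 ≤ 2 ^ X := by
    calc 16 = 2 ^ 4 := by norm_num
      _ ≤ 2 ^ X := Nat.pow_le_pow_right (by norm_num) (by omega)
  refine Par.fits_of_le (N := 2 ^ X) (Q := (2 ^ X) ^ (c + 2)) hN
    (hs.trans_le (Nat.pow_le_pow_right (by norm_num) (by omega)))
    (Nat.pow_le_pow_right (by norm_num) (by omega)) ?_
    (Nat.pow_le_pow_right (by omega) (by omega)) ?_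
  · have h₁ : c < 2 ^ c := Nat.lt_two_pow_self
    have h₂ : 2 ^ c ≤ (2 ^ X) ^ c := Nat.pow_le_pow_left (by omega) c
    have h₃ : (2 ^ X) ^ (c + 2) = (2 ^ X) ^ c * (2 ^ X * 2 ^ X) := by ring
    have h₄ : 5 ≤ 2 ^ X * 2 ^ X := by nlinarith
    rw [h₃]
    nlinarith [Nat.mul_le_mul_left ((2 ^ X) ^ c) h₄]
  · rw [← pow_add, ← pow_add, ← pow_mul, mul_comm _ X]
    refine Nat.pow_le_pow_right (by norm_num) (Nat.mul_le_mul_left _ (by omega))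

end bounds

section time
variable {P : Par}

/-- The running time of one trial. -/
theorem Par.trial_le {E F K : ℕ} (hE : E = 2 ^ P.k) (hF : P.nf ≤ F) (hF1 : 1 ≤ F)
    (hK : P.κ < K) : P.tTrial + P.tNext + 4 ≤ 4096 * (F * K * E ^ 6) := by
  have hk : P.k ≤ E := hE ▸ Nat.lt_two_pow_self.le
  have hl : P.l ≤ E := le_trans (by rw [Par.l]; exact Nat.log_le_self _ _) hk
  have hE1 : 1 ≤ E := hE ▸ Nat.one_le_two_pow
  have hkeys : P.keys ≤ E := by rw [Par.keys, hE]
  have hnb : P.nb ≤ E * E := by rw [Par.nb, hE, two_mul, pow_add]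
  have hkc : P.kc ≤ K * E := by rw [Par.kc]; exact Nat.mul_le_mul hK.le hk
  have hK1 : 1 ≤ K := by omega
  have hword : P.tWord ≤ 122 * E := by rw [Par.tWord]; omega
  have hfill : P.tFill ≤ 310 * E ^ 4 := by
    have h : P.tFill ≤ (E * E) * (E * (122 * E + 40 + 22) + 22 + 60 + 22) + 22 := by
      rw [Par.tFill]; gcongr
    refine h.trans ?_
    clear * - hE1
    obtain ⟨e, rfl⟩ := Nat.exists_eq_add_of_le hE1
    ring_nf; omega
  have hplace : P.tPlace ≤ 310 * E := by rw [Par.tPlace]; omega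
  have helim : P.tElim ≤ 480 * E ^ 4 := by
    have h : P.tElim ≤ E * ((E * (5 + 22) + 22) + ((E * E) * (310 * E + 22) + 22) + 1 + 22) + 22 := by
      rw [Par.tElim]; gcongr
    refine h.trans ?_
    clear * - hE1
    obtain ⟨e, rfl⟩ := Nat.exists_eq_add_of_le hE1
    ring_nf; omega
  have hbatch : P.tBatch ≤ 900 * E ^ 4 := by
    have h : P.tBatch ≤ 7 + (310 * E ^ 4 + (480 * E ^ 4 + ((E * E) * (40 + 22) + 22 + 4) + 1) + 1)
        + 1 := by
      rw [Par.tBatch]; gcongr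
    refine h.trans ?_
    clear * - hE1
    obtain ⟨e, rfl⟩ := Nat.exists_eq_add_of_le hE1
    ring_nf; omega
  have hscore : P.tScore ≤ 1000 * (F * E ^ 4) := by
    have h : P.tScore ≤ F * (900 * E ^ 4 + 40 + 22) + 22 + 8 := by
      rw [Par.tScore]; gcongr
    refine h.trans ?_
    clear * - hE1 hF1
    obtain ⟨e, rfl⟩ := Nat.exists_eq_add_of_le hE1
    obtain ⟨f, rfl⟩ := Nat.exists_eq_add_of_le hF1
    ring_nf; omega
  have hselect : P.tSelect ≤ 1200 * (F * E ^ 6) := by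
    have h : P.tSelect ≤ E * (E * (1000 * (F * E ^ 4) + 60 + 22) + 22 + 22) + 22 + 4 := by
      rw [Par.tSelect]; gcongr
    refine h.trans ?_
    clear * - hE1 hF1
    obtain ⟨e, rfl⟩ := Nat.exists_eq_add_of_le hE1
    obtain ⟨f, rfl⟩ := Nat.exists_eq_add_of_le hF1
    ring_nf; omega
  have herr : P.tErr ≤ 200 * (K * E ^ 2) := by
    have h : P.tErr ≤ (K * E) * (E * (20 + 22) + 22 + 30 + 22) + 22 + 4 := by
      rw [Par.tErr]; gcongr
    refine h.trans ?_
    clear * - hE1 hK1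
    obtain ⟨e, rfl⟩ := Nat.exists_eq_add_of_le hE1
    obtain ⟨f, rfl⟩ := Nat.exists_eq_add_of_le hK1
    ring_nf; omega
  have h : P.tTrial + P.tNext + 4 ≤ (1200 * (F * E ^ 6) + (200 * (K * E ^ 2) +
      (E * (10 + 22) + 22 + 30) + 10)) + (E * (50 + 22) + E * (5 + 22) + 150) + 4 := by
    rw [Par.tTrial, Par.tNext]; gcongr
  have h₁ : F * E ^ 6 ≤ F * K * E ^ 6 :=
    Nat.mul_le_mul_right _ (Nat.le_mul_of_pos_right _ hK1)
  have h₂ : K * E ^ 2 ≤ F * K * E ^ 6 :=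
    Nat.mul_le_mul (Nat.le_mul_of_pos_left _ hF1) (Nat.pow_le_pow_right hE1 (by norm_num))
  have h₃ : E ≤ F * K * E ^ 6 := by
    calc E = 1 * 1 * E ^ 1 := by ring
      _ ≤ F * K * E ^ 6 :=
        Nat.mul_le_mul (Nat.mul_le_mul hF1 hK1) (Nat.pow_le_pow_right hE1 (by norm_num))
  omega

/-- The total running time: the dependence on `n` is in the number of combinations of blocks, and in
quadratic terms from the preparation. -/
theorem Par.time_le {E F K : ℕ} (hE : E = 2 ^ P.k) (hF : P.nf ≤ F) (hF1 : 1 ≤ F)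
    (hK : P.κ < K) (hn : 1 ≤ P.n) :
    P.time ≤ 4096 * (F * K * E ^ 6) * (P.D.choose P.k + P.n ^ 2) := by
  have htrial := Par.trial_le hE hF hF1 hK
  have hk : P.k ≤ E := hE ▸ Nat.lt_two_pow_self.le
  have hE1 : 1 ≤ E := hE ▸ Nat.one_le_two_pow
  have hb : P.b ≤ P.n := by rw [Par.b]; exact Nat.log_le_self _ _
  have hkc : P.kc ≤ K * E := by rw [Par.kc]; exact Nat.mul_le_mul hK.le hk
  have hK1 : 1 ≤ K := by omega
  have hmB : P.mB ≤ F * (E * E) := by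
    rw [Par.mB]
    exact Nat.mul_le_mul hF (by rw [Par.nb, hE, two_mul, pow_add])
  have hmain : P.tMain ≤ P.D.choose P.k * (4096 * (F * K * E ^ 6)) + 10 := by
    rw [Par.tMain]; gcongr
  have hrest : P.time ≤ (E * 62 + P.n * 62 + 200) + 6 * (F * (E * E) + K * E * P.n) +
      ((P.n * (K * E * (P.n * (50 + 22) + 22 + 50 + 22) + 22 + 22) + 22) +
      ((K * E * (P.n * (50 + 22) + 22 + 50 + 22) + 22) + ((P.n * (30 + 22) + 22 + 10) +
      ((E * (5 + 22) + 22 + 6) + P.tMain + 1) + 1) + 1) + 1) + 5 := by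
    rw [Par.time, Par.tParams, Par.tSolve, Par.samples]; gcongr
  have hpoly : (E * 62 + P.n * 62 + 200) + 6 * (F * (E * E) + K * E * P.n) +
      ((P.n * (K * E * (P.n * (50 + 22) + 22 + 50 + 22) + 22 + 22) + 22) +
      ((K * E * (P.n * (50 + 22) + 22 + 50 + 22) + 22) + ((P.n * (30 + 22) + 22 + 10) +
      ((E * (5 + 22) + 22 + 6) + 10 + 1) + 1) + 1) + 1) + 5 ≤
      2000 * (F * K * E ^ 2 * P.n ^ 2) := by
    generalize P.n = n at hn ⊢
    clear * - hE1 hF1 hK1 hn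
    obtain ⟨e, rfl⟩ := Nat.exists_eq_add_of_le hE1
    obtain ⟨f, rfl⟩ := Nat.exists_eq_add_of_le hF1
    obtain ⟨g, rfl⟩ := Nat.exists_eq_add_of_le hK1
    obtain ⟨m, rfl⟩ := Nat.exists_eq_add_of_le hn
    ring_nf; omega
  have hpow : F * K * E ^ 2 * P.n ^ 2 ≤ F * K * E ^ 6 * P.n ^ 2 :=
    Nat.mul_le_mul_right _ (Nat.mul_le_mul_left _ (Nat.pow_le_pow_right hE1 (by norm_num)))
  have e : 4096 * (F * K * E ^ 6) * (P.D.choose P.k + P.n ^ 2) =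
      P.D.choose P.k * (4096 * (F * K * E ^ 6)) + 4096 * (F * K * E ^ 6 * P.n ^ 2) := by ring
  rw [e]
  omega

theorem two_le_of_lt_div_log {n k : ℕ} (hk : 2 ≤ k) (h : (k : ℝ) < n / Real.log n) : 2 ≤ n := by
  by_contra hn
  have hn : n < 2 := not_le.mp hn
  have hk' : (2 : ℝ) ≤ k := by exact_mod_cast hk
  interval_cases n <;> simp at h <;> linarith

/-- For `n ≥ 3` this holds because `log n > 1`; for `n = 2` the hypothesis is `k < 2.88…`, which
still forces `k ≤ n`. -/
theorem le_of_lt_div_log {n k : ℕ} (hk : 2 ≤ k) (h : (k : ℝ) < n / Real.log n) : k ≤ n := by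
  have hn := two_le_of_lt_div_log hk h
  rcases Nat.lt_or_ge n 3 with h3 | h3
  · obtain rfl : n = 2 := by omega
    by_contra hk2
    have hk3 : (3 : ℝ) ≤ k := by exact_mod_cast (show 3 ≤ k by omega)
    have hl := Real.log_two_gt_d9
    push_cast at h
    rw [lt_div_iff₀ (by linarith)] at h
    nlinarith
  · have h3' : (3 : ℝ) ≤ n := by exact_mod_cast h3
    have hlog : 1 < Real.log n := by
      rw [Real.lt_log_iff_exp_lt (by linarith)]
      have := Real.exp_one_lt_d9
      linarith
    have : (n : ℝ) / Real.log n ≤ n := div_le_self (by linarith) hlog.le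
    exact_mod_cast (h.trans_le this).le

/-- The base of the time bound is at least one, up to the constant. -/
theorem one_le_ratio {n k : ℕ} (hk : 2 ≤ k) (h : (k : ℝ) < n / Real.log n) :
    1 ≤ (n : ℝ) / (k * Real.log k) := by
  have hn : (2 : ℝ) ≤ n := by exact_mod_cast two_le_of_lt_div_log hk h
  have hk' : (2 : ℝ) ≤ k := by exact_mod_cast hk
  have hkn : (k : ℝ) ≤ n := by exact_mod_cast le_of_lt_div_log hk h
  have hlk : 0 < Real.log k := Real.log_pos (by linarith)
  have hlog : Real.log k ≤ Real.log n := Real.log_le_log (by linarith) hkn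
  rw [lt_div_iff₀ (by linarith)] at h
  rw [le_div_iff₀ (by positivity), one_mul]
  nlinarith

theorem log_le_two_mul_log {k : ℕ} (hk : 2 ≤ k) : Real.log k ≤ 2 * (Nat.log 2 k : ℕ) := by
  have h1 : 1 ≤ Nat.log 2 k := Nat.log_pos (by norm_num) hk
  have h2 : k ≤ 2 ^ (Nat.log 2 k + 1) := (Nat.lt_pow_succ_log_self (by norm_num) k).le
  have h3 : (k : ℝ) ≤ 2 ^ (Nat.log 2 k + 1) := by exact_mod_cast h2
  have h4 := Real.log_le_log (by positivity) h3
  rw [Real.log_pow] at h4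
  have hl := Real.log_two_lt_d9
  have h1' : (1 : ℝ) ≤ (Nat.log 2 k : ℕ) := by exact_mod_cast h1
  push_cast at h4
  nlinarith

/-- The number of combinations of blocks. -/
theorem Par.choose_le (hk : 2 ≤ P.k) (h : (P.k : ℝ) < P.n / Real.log P.n) :
    (P.D.choose P.k : ℝ) ≤ (16 * (P.n / (P.k * Real.log P.k))) ^ P.k := by
  set y : ℝ := P.n / (P.k * Real.log P.k) with hy
  have hy1 : 1 ≤ y := one_le_ratio hk h
  have hk' : (2 : ℝ) ≤ P.k := by exact_mod_cast hk
  have hlk : 0 < Real.log P.k := Real.log_pos (by linarith)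
  have hl1 : (1 : ℝ) ≤ P.l := by
    rw [Par.l]; exact_mod_cast Nat.log_pos (by norm_num) hk
  have hll : Real.log P.k ≤ 2 * P.l := by rw [Par.l]; exact log_le_two_mul_log hk
  have hD : (P.D : ℝ) ≤ 3 * y * P.k := by
    have h₁ : ((P.n / P.l : ℕ) : ℝ) ≤ P.n / P.l := Nat.cast_div_le
    have h₂ : (P.n : ℝ) / P.l ≤ 2 * y * P.k := by
      have : 2 * y * P.k = P.n / (Real.log P.k / 2) := by rw [hy]; field_simp
      rw [this]
      exact div_le_div_of_nonneg_left (by positivity) (by positivity) (by linarith)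
    rw [Par.D]
    push_cast
    nlinarith
  have he : Real.exp P.k ≤ 3 ^ P.k := by
    have : Real.exp P.k = Real.exp 1 ^ P.k := by rw [← Real.exp_nat_mul, mul_one]
    rw [this]
    refine pow_le_pow_left₀ (Real.exp_pos _).le ?_ _
    have := Real.exp_one_lt_d9
    linarith
  calc (P.D.choose P.k : ℝ) ≤ (P.D : ℝ) ^ P.k / (P.k).factorial := Nat.choose_le_pow_div _ _
    _ ≤ (3 * y * P.k) ^ P.k / (P.k).factorial := by gcongr
    _ = (3 * y) ^ P.k * ((P.k : ℝ) ^ P.k / (P.k).factorial) := by rw [mul_pow]; ring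
    _ ≤ (3 * y) ^ P.k * 3 ^ P.k :=
        mul_le_mul_of_nonneg_left ((Real.pow_div_factorial_le_exp _ (by positivity) _).trans he)
          (by positivity)
    _ = (9 * y) ^ P.k := by rw [← mul_pow]; ring
    _ ≤ (16 * y) ^ P.k := by gcongr; norm_num

/-- The preparation, which is quadratic in `n`, is dominated by the time bound because `k ≥ 2`. -/
theorem Par.sq_le (hk : 2 ≤ P.k) (h : (P.k : ℝ) < P.n / Real.log P.n) :
    (P.n : ℝ) ^ 2 ≤ (16 * (P.n / (P.k * Real.log P.k))) ^ P.k := by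
  set y : ℝ := P.n / (P.k * Real.log P.k) with hy
  have hy1 : 1 ≤ y := one_le_ratio hk h
  have hk' : (2 : ℝ) ≤ P.k := by exact_mod_cast hk
  have hlk : 0 < Real.log P.k := Real.log_pos (by linarith)
  have hlk' : Real.log P.k ≤ P.k := (Real.log_le_sub_one_of_pos (by linarith)).trans (by linarith)
  have hkE : (P.k : ℝ) ≤ 2 ^ P.k := by exact_mod_cast Nat.lt_two_pow_self.le
  have hn : (P.n : ℝ) ≤ y * (2 ^ P.k) ^ 2 := by
    have : (P.n : ℝ) = y * (P.k * Real.log P.k) := by rw [hy]; field_simp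
    rw [this, sq]
    gcongr
    exact hlk'.trans hkE
  calc (P.n : ℝ) ^ 2 ≤ (y * (2 ^ P.k) ^ 2) ^ 2 := by gcongr
    _ = y ^ 2 * 16 ^ P.k := by
        rw [mul_pow, ← pow_mul, ← pow_mul, show (16 : ℝ) = 2 ^ 4 by norm_num, ← pow_mul]
        ring
    _ ≤ y ^ P.k * 16 ^ P.k := by gcongr
    _ = (16 * y) ^ P.k := by rw [mul_pow, mul_comm]

/-- All factors `2 ^ O(k)` are absorbed by the constant inside the power. -/
theorem Par.time_le_pow (hk : 2 ≤ P.k) (h : (P.k : ℝ) < P.n / Real.log P.n) :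
    (P.time : ℝ) ≤ (2 ^ (P.α + P.κ + 17) * (P.n / (P.k * Real.log P.k))) ^ P.k := by
  have hn := two_le_of_lt_div_log hk h
  have hc := Par.choose_le hk h
  have hs := Par.sq_le hk h
  set y : ℝ := P.n / (P.k * Real.log P.k)
  have hE4 : 4 ≤ 2 ^ P.k := by
    calc 4 = 2 ^ 2 := by norm_num
      _ ≤ 2 ^ P.k := Nat.pow_le_pow_right (by norm_num) hk
  have ht := Par.time_le (P := P) (E := 2 ^ P.k) (F := (2 ^ P.k) ^ P.α) (K := (2 ^ P.k) ^ P.κ) rfl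
    (by rw [Par.nf, ← pow_mul, mul_comm]) (Nat.one_le_pow _ _ (by positivity))
    (Nat.lt_pow_self (by omega)) (by omega)
  have h4096 : 4096 ≤ (2 ^ P.k) ^ 6 := by
    calc 4096 = 4 ^ 6 := by norm_num
      _ ≤ (2 ^ P.k) ^ 6 := Nat.pow_le_pow_left hE4 6
  have ht' : P.time ≤ (2 ^ P.k) ^ (P.α + P.κ + 12) * (P.D.choose P.k + P.n ^ 2) := by
    refine ht.trans (Nat.mul_le_mul_right _ ?_)
    calc 4096 * ((2 ^ P.k) ^ P.α * (2 ^ P.k) ^ P.κ * (2 ^ P.k) ^ 6)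
        ≤ (2 ^ P.k) ^ 6 * ((2 ^ P.k) ^ P.α * (2 ^ P.k) ^ P.κ * (2 ^ P.k) ^ 6) :=
          Nat.mul_le_mul_right _ h4096
      _ = (2 ^ P.k) ^ (P.α + P.κ + 12) := by ring
  have ht'' : (P.time : ℝ) ≤ (2 ^ P.k) ^ (P.α + P.κ + 12) * (P.D.choose P.k + P.n ^ 2) := by
    exact_mod_cast ht'
  have hE4' : (4 : ℝ) ≤ 2 ^ P.k := by exact_mod_cast hE4
  calc (P.time : ℝ) ≤ (2 ^ P.k) ^ (P.α + P.κ + 12) * ((16 * y) ^ P.k + (16 * y) ^ P.k) := by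
        refine ht''.trans ?_
        gcongr
    _ = (2 ^ P.k) ^ (P.α + P.κ + 12) * (2 * (16 * y) ^ P.k) := by ring
    _ ≤ (2 ^ P.k) ^ (P.α + P.κ + 12) * (2 ^ P.k * (16 * y) ^ P.k) := by
        have : 0 ≤ (16 * y) ^ P.k := le_trans (by positivity) hs
        gcongr
        linarith
    _ = (2 ^ (P.α + P.κ + 17) * y) ^ P.k := by
        rw [show (16 : ℝ) = 2 ^ 4 by norm_num]
        simp only [mul_pow, ← pow_mul]
        rw [← mul_assoc, ← mul_assoc, ← pow_add, ← pow_add]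
        congr 2
        ring

/-- The batches account for `2 ^ O(k)` examples.  The verification uses `O(k log n)` examples; if
`k ^ 2 ≤ n`, then `log n ≤ 2 * log (n / k)`, and otherwise `log n` is at most `2 * log k`, so
that this number is covered by `2 ^ O(k)` as well. -/
theorem Par.samples_le (hk : 2 ≤ P.k) (h : (P.k : ℝ) < P.n / Real.log P.n) {C : ℝ}
    (hC₁ : (P.α + P.κ + 6 : ℕ) ≤ C) (hC₂ : 4 * P.κ ≤ C) :
    (P.samples : ℝ) ≤ 2 ^ (C * P.k) + C * (P.k * Real.log (P.n / P.k)) := by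
  have hn := two_le_of_lt_div_log hk h
  have hkn := le_of_lt_div_log hk h
  have hkR : (0 : ℝ) < P.k := by exact_mod_cast (show 0 < P.k by omega)
  have hnR : (0 : ℝ) < P.n := by exact_mod_cast (show 0 < P.n by omega)
  have hknR : (P.k : ℝ) ≤ P.n := by exact_mod_cast hkn
  have hC0 : 0 ≤ C := le_trans (by positivity) hC₂
  have hlog0 : 0 ≤ Real.log (P.n / P.k) := Real.log_nonneg ((one_le_div hkR).mpr hknR)
  have hpow : ∀ m : ℕ, m ≤ P.α + P.κ + 6 → ((2 : ℝ) ^ P.k) ^ m ≤ 2 ^ (C * P.k) := fun m hm => by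
    rw [← pow_mul, ← Real.rpow_natCast]
    refine Real.rpow_le_rpow_of_exponent_le (by norm_num) ?_
    push_cast
    rw [mul_comm]
    have : (m : ℝ) ≤ C := le_trans (by exact_mod_cast hm) hC₁
    gcongr
  have hmB : (P.mB : ℝ) = (2 ^ P.k) ^ (P.α + 2) := by
    rw [Par.mB, Par.nf, Par.nb]; push_cast; rw [← pow_add, ← pow_mul]; congr 1; ring
  have hkc : ((P.kc * P.b : ℕ) : ℝ) = P.κ * P.k * P.b := by rw [Par.kc]; push_cast; ring
  rw [Par.samples, Nat.cast_add, hmB, hkc]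
  -- for `k ^ 2 ≤ n` the second summand of the bound is of order `k * log n`, otherwise the first one
  -- dominates everything
  rcases le_or_gt (P.k ^ 2) P.n with hsq | hsq
  · refine add_le_add (hpow _ (by omega)) ?_
    have hb : (P.b : ℝ) ≤ 2 * Real.log P.n := by
      have h₁ : 2 ^ P.b ≤ P.n := by rw [Par.b]; exact Nat.pow_log_le_self 2 (by omega)
      have h₂ : (2 : ℝ) ^ P.b ≤ P.n := by exact_mod_cast h₁
      have h₃ := Real.log_le_log (by positivity) h₂
      rw [Real.log_pow] at h₃
      have := Real.log_two_gt_d9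
      have hb0 : (0 : ℝ) ≤ P.b := Nat.cast_nonneg _
      nlinarith
    have hlog : Real.log P.n ≤ 2 * Real.log (P.n / P.k) := by
      have h₁ : (P.k : ℝ) ^ 2 ≤ P.n := by exact_mod_cast hsq
      have h₂ := Real.log_le_log (by positivity) h₁
      rw [Real.log_pow] at h₂
      rw [Real.log_div hnR.ne' hkR.ne']
      push_cast at h₂
      linarith
    calc (P.κ : ℝ) * P.k * P.b ≤ P.κ * P.k * (4 * Real.log (P.n / P.k)) := by
          gcongr; linarith
      _ = 4 * P.κ * (P.k * Real.log (P.n / P.k)) := by ring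
      _ ≤ C * (P.k * Real.log (P.n / P.k)) := by gcongr
  · have hbk : P.b ≤ 2 * 2 ^ P.k := by
      have h₁ : 2 ^ P.b ≤ P.n := by rw [Par.b]; exact Nat.pow_log_le_self 2 (by omega)
      have h₂ : 2 ^ P.b < (2 ^ P.k) ^ 2 :=
        (h₁.trans_lt hsq).trans_le (Nat.pow_le_pow_left Nat.lt_two_pow_self.le 2)
      rw [← pow_mul, Nat.pow_lt_pow_iff_right (by norm_num)] at h₂
      have := Nat.lt_two_pow_self (n := P.k)
      omega
    have hE4 : 4 ≤ 2 ^ P.k := by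
      calc 4 = 2 ^ 2 := by norm_num
        _ ≤ 2 ^ P.k := Nat.pow_le_pow_right (by norm_num) hk
    have hsum : (2 ^ P.k) ^ (P.α + 2) + P.κ * P.k * P.b ≤ (2 ^ P.k) ^ (P.α + P.κ + 6) := by
      have h₁ : P.κ * P.k * P.b ≤ (2 ^ P.k) ^ P.κ * 2 ^ P.k * (2 * 2 ^ P.k) := by
        have := (Nat.lt_pow_self (n := P.κ) (show 1 < 2 ^ P.k by omega)).le
        gcongr
        exact Nat.lt_two_pow_self.le
      generalize 2 ^ P.k = E at *
      have hp1 : 1 ≤ E ^ P.κ := Nat.one_le_pow _ _ (by omega)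
      have hp2 : 1 ≤ E ^ P.α := Nat.one_le_pow _ _ (by omega)
      have e : E ^ (P.α + P.κ + 6) = E ^ P.α * E ^ P.κ * (E ^ 2 * E ^ 4) := by ring
      have h₃ : 3 ≤ E ^ 4 := (by norm_num : 3 ≤ 4 ^ 4).trans (Nat.pow_le_pow_left hE4 4)
      calc E ^ (P.α + 2) + P.κ * P.k * P.b
          ≤ E ^ P.α * E ^ 2 + E ^ P.κ * E * (2 * E) :=
            Nat.add_le_add (by rw [pow_add]) h₁
        _ = E ^ P.α * 1 * E ^ 2 + 1 * E ^ P.κ * E ^ 2 * 2 := by ring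
        _ ≤ E ^ P.α * E ^ P.κ * E ^ 2 + E ^ P.α * E ^ P.κ * E ^ 2 * 2 := by gcongr
        _ = E ^ P.α * E ^ P.κ * (E ^ 2 * 3) := by ring
        _ ≤ E ^ P.α * E ^ P.κ * (E ^ 2 * E ^ 4) := by gcongr
        _ = _ := e.symm
    have hsum' : ((2 : ℝ) ^ P.k) ^ (P.α + 2) + P.κ * P.k * P.b ≤
        (2 ^ P.k) ^ (P.α + P.κ + 6) := by exact_mod_cast hsum
    have : 0 ≤ C * (P.k * Real.log (P.n / P.k)) := by positivity
    linarith [hpow (P.α + P.κ + 6) le_rfl]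

end time

end LSPN

end

theorem theorem3p4 (η : ℝ≥0) (hη : η < 1 / 2) :
    ∃ (P : LSPN.Prog) (a : ℕ) (C : ℝ), 1 ≤ a ∧ 0 < C ∧
      ∀ n k : ℕ, 2 ≤ k → (k : ℝ) < n / Real.log n →
        ∃ T M : ℕ,
          (T : ℝ) ≤ (C * (n / (k * Real.log k))) ^ k ∧
          (M : ℝ) ≤ (2 : ℝ) ^ (C * k) + C * (k * Real.log (n / k)) ∧
          LSPN.Solves P (a * (k + Nat.size n)) n k η (hη.le.trans (by norm_num)) T M := by
  have h1 : (η : ℝ) < 1 / 2 := by exact_mod_cast hη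
  obtain ⟨α, κ, num, den, hs⟩ := LSPN.exists_suits η.coe_nonneg h1
  -- one constant serves for the time and for the number of examples
  set C : ℝ := 2 ^ (α + κ + 17) + (α + κ + 6 : ℕ) + 4 * κ
  have hC₀ : (2 : ℝ) ^ (α + κ + 17) ≤ C := by
    have : (0 : ℝ) ≤ (α + κ + 6 : ℕ) + 4 * κ := by positivity
    simp only [C]; linarith
  refine ⟨LSPN.solver α κ num den, 4 * (α + κ + num + den) + 20, C, by omega,
    lt_of_lt_of_le (by positivity) hC₀, fun n k hk hkn => ?_⟩
  let P : LSPN.Par := ⟨n, k, α, κ, num, den⟩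
  have hn : 2 ≤ P.n := LSPN.two_le_of_lt_div_log hk hkn
  have hy : 1 ≤ (n : ℝ) / (k * Real.log k) := LSPN.one_le_ratio hk hkn
  refine ⟨P.time, P.samples, ?_, ?_, LSPN.solves_of_suits (P := P) (LSPN.Par.fits hn hk) hk hn h1 _ hs⟩
  · refine (LSPN.Par.time_le_pow (P := P) hk hkn).trans (pow_le_pow_left₀ ?_ ?_ k)
    · exact mul_nonneg (by positivity) (zero_le_one.trans hy)
    · exact mul_le_mul_of_nonneg_right hC₀ (zero_le_one.trans hy)
  · refine LSPN.Par.samples_le (P := P) hk hkn ?_ ?_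
    · have : (0 : ℝ) ≤ 2 ^ (α + κ + 17) + 4 * κ := by positivity
      simp only [C, P]; linarith
    · have : (0 : ℝ) ≤ 2 ^ (α + κ + 17) + (α + κ + 6 : ℕ) := by positivity
      simp only [C, P]; linarith
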